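/- Let $k$ be a field, $A$ a $k$-algebra (associative, unital), $K/k$ a field extension, $A^K=K\otimes_k A$, and $d\ge 0$ an integer. Definitions. Write $A^e=A\otimes_k A^{\mathrm{op}}$, so that $A$ is a left $A^e$-module. $A$ is *twisted Calabi-Yau of dimension $d$* over $k$ if (i) $A$ has a resolution of finite length by finitely generated projective left $A^e$-modules, and (ii) there is an invertible $k$-central $(A,A)$-bimodule $U$ (that is, $U\otimes_A V\cong A\cong V\otimes_A U$ as bimodules for some $k$-central bimodule $V$) such that $\operatorname{Ext}^i_{A^e}(A,A^e)=0$ for $i\ne d$ and $\operatorname{Ext}^d_{A^e}(A,A^e)\cong U$ as $(A,A)$-bimodules, where the bimodule structure on $\operatorname{Ext}$ comes from the right $A^e$-module structure of $A^e$. If $A=\bigoplus_{n\ge 0}A_n$ is an $\mathbb N$-graded $k$-algebra, then $A$ is *graded twisted Calabi-Yau of dimension $d$* if the same holds in the category of $\mathbb Z$-graded modules: $A$ has a finite resolution by finitely generated graded projective left $A^e$-modules (with maps of degree $0$), the graded Ext-groups $\underline{\operatorname{Ext}}^i_{A^e}(A,A^e)$ (the derived functors of $\underline{\operatorname{Hom}}(M,N)=\bigoplus_{j\in\mathbb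 Z}\operatorname{Hom}^j(M,N)$, where $\operatorname{Hom}^j$ denotes the homomorphisms of degree $j$) vanish for $i\ne d$, and for $i=d$ the group is isomorphic, as a graded bimodule, to a graded-invertible bimodule (a graded bimodule $U$ with $U\otimes_A V\cong A\cong V\otimes_A U$ as graded bimodules for some graded bimodule $V$). Over $K$, the algebra $A^K$ is considered as a $K$-algebra; when $A$ is graded, it is graded by $(A^K)_n=K\otimes_k A_n$. Proposition. 1. If $A$ is twisted Calabi-Yau of dimension $d$ over $k$, then $A^K$ is twisted Calabi-Yau of dimension $d$ over $K$. 2. Suppose that $A$ is $\mathbb N$-graded with $\dim_k A_0<\infty$. Then $A^K$ is twisted Calabi-Yau of dimension $d$ over $K$ if and only if $A$ is twisted Calabi-Yau of dimension $d$ over $k$; and $A^K$ is graded twisted Calabi-Yau of dimension $d$ over $K$ if and only if $A$ is graded twisted Calabi-Yau of dimension $d$ over $k$. -/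

import Mathlib

open CategoryTheory CategoryTheory.Abelian MulOpposite
open scoped TensorProduct

universe u v w

namespace TwistedCY

section Ungraded

/-- The enveloping algebra `A ⊗ Aᵒᵖ` of a `k`-algebra `A`. -/
abbrev Env (k : Type v) (A : Type u) [Field k] [Ring A] [Algebra k A] : Type u :=
  A ⊗[k] Aᵐᵒᵖ

/- `A` is a left module over its enveloping algebra by `(a ⊗ op b) • x = a * x * b`. -/
attribute [local instance] instModuleTensorProductMop

theorem env_tmul_smul (k : Type v) (A : Type u) [Field k] [Ring A] [Algebra k A]
    (a b x : A) : ((a ⊗ₜ[k] op b : Env k A) • x : A) = a * x * b := by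
  have h := AlgHom.mulLeftRight_apply k A a (op b) x
  simpa [AlgHom.mulLeftRight] using h

/-- `A` is homologically smooth over `k`: as a left module over its enveloping algebra, it has a
projective resolution of finite length whose terms are finitely generated. -/
def IsHomologicallySmooth (k : Type v) (A : Type u) [Field k] [Ring A] [Algebra k A] : Prop :=
  ∃ P : ProjectiveResolution (ModuleCat.of (Env k A) A),
    (∀ n, Module.Finite (Env k A) (P.complex.X n)) ∧
      ∃ N : ℕ, ∀ n, N < n → Limits.IsZero (P.complex.X n)

/-- Right multiplication by `r`, as an endomorphism of the left `R`-module `R`. -/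
def rightMul {R : Type u} [Ring R] (r : R) : ModuleCat.of R R ⟶ ModuleCat.of R R :=
  ModuleCat.ofHom (LinearMap.toSpanSingleton R R r)

theorem rightMul_apply {R : Type u} [Ring R] (r x : R) : (rightMul r).hom x = x * r := rfl

/-- `Ext^i_R(M, R)` is a right `R`-module through the right `R`-module structure of `R`. -/
noncomputable instance extRightModule {R : Type u} [Ring R] (M : ModuleCat.{u} R) (i : ℕ) :
    Module Rᵐᵒᵖ (Ext M (ModuleCat.of R R) i) where
  smul r x := x.comp (Ext.mk₀ (rightMul r.unop)) (add_zero i)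
  one_smul x := by
    change x.comp (Ext.mk₀ (rightMul (1 : R))) (add_zero i) = x
    have h : rightMul (1 : R) = 𝟙 _ := by
      ext; simp [rightMul]
    rw [h, Ext.comp_mk₀_id]
  mul_smul r s x := by
    change x.comp (Ext.mk₀ (rightMul (s.unop * r.unop))) (add_zero i) =
      (x.comp (Ext.mk₀ (rightMul s.unop)) (add_zero i)).comp
        (Ext.mk₀ (rightMul r.unop)) (add_zero i)
    have h : rightMul (s.unop * r.unop) = rightMul s.unop ≫ rightMul r.unop := by
      ext; simp [rightMul]
    rw [h, ← Ext.mk₀_comp_mk₀, Ext.comp_assoc_of_third_deg_zero]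
  smul_zero r := by
    change (0 : Ext M (ModuleCat.of R R) i).comp (Ext.mk₀ (rightMul r.unop)) (add_zero i) = 0
    rw [Ext.zero_comp]
  smul_add r x y := Ext.add_comp _ _ _ _
  zero_smul x := by
    change x.comp (Ext.mk₀ (rightMul (0 : R))) (add_zero i) = 0
    have h : rightMul (0 : R) = 0 := by
      ext; simp [rightMul]
    rw [h, Ext.mk₀_zero, Ext.comp_zero]
  add_smul r s x := by
    change x.comp (Ext.mk₀ (rightMul (r.unop + s.unop))) (add_zero i) =
      x.comp (Ext.mk₀ (rightMul r.unop)) (add_zero i) +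
        x.comp (Ext.mk₀ (rightMul s.unop)) (add_zero i)
    have h : rightMul (r.unop + s.unop) = rightMul r.unop + rightMul s.unop := by
      ext; simp [rightMul]
    rw [h, Ext.mk₀_add, Ext.comp_add]

/-- A `k`-central `(A, A)`-bimodule.  The right action of `A` is written as a left action of
`Aᵐᵒᵖ`; the two scalar towers say that `k` acts in the same way from both sides. -/
structure CentralBimodule (k : Type v) (A : Type u) [Field k] [Ring A] [Algebra k A] where
  carrier : Type u
  [addCommGroup : AddCommGroup carrier]
  [baseModule : Module k carrier]
  [leftModule : Module A carrier]
  [rightModule : Module Aᵐᵒᵖ carrier]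
  [smulComm : SMulCommClass A Aᵐᵒᵖ carrier]
  [leftTower : IsScalarTower k A carrier]
  [rightTower : IsScalarTower k Aᵐᵒᵖ carrier]

attribute [instance] CentralBimodule.addCommGroup CentralBimodule.baseModule
  CentralBimodule.leftModule CentralBimodule.rightModule CentralBimodule.smulComm
  CentralBimodule.leftTower CentralBimodule.rightTower

namespace CentralBimodule

variable {k : Type v} {A : Type u} [Field k] [Ring A] [Algebra k A]

instance : CoeSort (CentralBimodule k A) (Type u) := ⟨carrier⟩

/-- The relations `u a ⊗ v = u ⊗ a v`. -/
def balancedRel (U V : CentralBimodule k A) : Submodule k (U ⊗[k] V) :=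
  Submodule.span k {x | ∃ (u : U) (a : A) (v : V),
    x = (op a • u) ⊗ₜ[k] v - u ⊗ₜ[k] (a • v)}

/-- The underlying vector space of the tensor product `U ⊗_A V`. -/
abbrev TensorOver (U V : CentralBimodule k A) : Type u := (U ⊗[k] V) ⧸ balancedRel U V

/-- The class of `u ⊗ v` in `U ⊗_A V`. -/
def tmul {U V : CentralBimodule k A} (u : U) (v : V) : TensorOver U V :=
  (balancedRel U V).mkQ (u ⊗ₜ[k] v)

/-- An isomorphism `U ⊗_A V ≅ A` of `(A, A)`-bimodules, where `a (u ⊗ v) b = (a u) ⊗ (v b)`. -/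
structure TensorIso (U V : CentralBimodule k A) where
  equiv : TensorOver U V ≃ₗ[k] A
  map_left : ∀ (a : A) (u : U) (v : V), equiv (tmul (a • u) v) = a * equiv (tmul u v)
  map_right : ∀ (b : A) (u : U) (v : V), equiv (tmul u (op b • v)) = equiv (tmul u v) * b

/-- `U` is invertible: `U ⊗_A V ≅ A ≅ V ⊗_A U` as bimodules for some `V`. -/
def IsInvertible (U : CentralBimodule k A) : Prop :=
  ∃ V : CentralBimodule k A, Nonempty (TensorIso U V) ∧ Nonempty (TensorIso V U)

/-- An isomorphism of bimodules from a right module `E` over the enveloping algebra to `U`, where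
`E` is regarded as a bimodule by `a x b = x • (b ⊗ op a)`. -/
structure EnvIso (E : Type u) [AddCommGroup E] [Module (Env k A)ᵐᵒᵖ E]
    (U : CentralBimodule k A) where
  equiv : E ≃+ U
  map_smul : ∀ (a b : A) (x : E),
    equiv (op (b ⊗ₜ[k] op a : Env k A) • x) = a • op b • equiv x

end CentralBimodule

/-- `A` is twisted Calabi-Yau of dimension `d` over `k`. -/
def IsTwistedCY (k : Type v) (A : Type u) [Field k] [Ring A] [Algebra k A] (d : ℕ) : Prop :=
  IsHomologicallySmooth k A ∧
    ∃ U : CentralBimodule k A, U.IsInvertible ∧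
      (∀ i : ℕ, i ≠ d → Subsingleton
        (Ext (ModuleCat.of (Env k A) A) (ModuleCat.of (Env k A) (Env k A)) i)) ∧
      Nonempty (CentralBimodule.EnvIso
        (Ext (ModuleCat.of (Env k A) A) (ModuleCat.of (Env k A) (Env k A)) d) U)

end Ungraded

section GradedModules

variable {R : Type u} [Ring R]

/-- A `ℤ`-grading of the ring `R`. -/
structure ZGrading (R : Type u) [Ring R] where
  deg : ℤ → AddSubgroup R
  isInternal : DirectSum.IsInternal deg
  one_mem : 1 ∈ deg 0
  mul_mem : ∀ {i j : ℤ} {r s : R}, r ∈ deg i → s ∈ deg j → r * s ∈ deg (i + j)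

theorem ZGrading.mem_iSup_deg (G : ZGrading R) (r : R) : r ∈ ⨆ n, G.deg n := by
  obtain ⟨y, rfl⟩ := G.isInternal.2 r
  induction y using DirectSum.induction_on with
  | zero => rw [map_zero]; exact zero_mem _
  | of j s =>
    rw [DirectSum.coeAddMonoidHom_of]
    exact AddSubgroup.mem_iSup_of_mem j s.2
  | add y z hy hz =>
    rw [map_add]
    exact add_mem hy hz

/-- A graded left module over a graded ring. -/
structure GradedModule (G : ZGrading R) where
  carrier : Type u
  [addCommGroup : AddCommGroup carrier]
  [module : Module R carrier]
  deg : ℤ → AddSubgroup carrier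
  isInternal : DirectSum.IsInternal deg
  smul_mem : ∀ {i j : ℤ} {r : R} {m : carrier}, r ∈ G.deg i → m ∈ deg j → r • m ∈ deg (i + j)

attribute [instance] GradedModule.addCommGroup GradedModule.module

namespace GradedModule

variable {G : ZGrading R}

instance : CoeSort (GradedModule G) (Type u) := ⟨carrier⟩

/-- The homomorphisms of left `R`-modules from `P` to `R`. -/
def Dual (P : GradedModule G) : Type u := P →ₗ[R] R

instance (P : GradedModule G) : AddCommGroup P.Dual := inferInstanceAs (AddCommGroup (P →ₗ[R] R))

instance (P : GradedModule G) : FunLike P.Dual P R := inferInstanceAs (FunLike (P →ₗ[R] R) P R)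

/-- The right `R`-module structure of `Hom(P, R)`: `(φ r)(x) = φ(x) r`. -/
instance (P : GradedModule G) : Module Rᵐᵒᵖ P.Dual :=
  (inferInstance : Module Rᵐᵒᵖ (P →ₗ[R] R))

theorem smul_apply (P : GradedModule G) (r : R) (φ : P.Dual) (x : P) :
    (op r • φ) x = φ x * r := rfl

/-- The homomorphisms `φ : P → R` of degree `i`: those with `φ(P_n) ⊆ R_{n + i}` for all `n`. -/
def homDeg (P : GradedModule G) (i : ℤ) : AddSubgroup P.Dual where
  carrier := {φ | ∀ (n : ℤ) (x : P), x ∈ P.deg n → φ x ∈ G.deg (n + i)}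
  add_mem' hφ hψ n x hx := add_mem (hφ n x hx) (hψ n x hx)
  zero_mem' _ _ _ := zero_mem _
  neg_mem' hφ n x hx := neg_mem (hφ n x hx)

/-- The graded Hom-group `⨁ᵢ Homⁱ(P, R) ⊆ Hom(P, R)`, a right `R`-module. -/
def grHom (P : GradedModule G) : Submodule Rᵐᵒᵖ P.Dual where
  carrier := ((⨆ i : ℤ, P.homDeg i : AddSubgroup _) : Set _)
  add_mem' hφ hψ := add_mem hφ hψ
  zero_mem' := zero_mem _
  smul_mem' r φ hφ := by
    have hr := G.mem_iSup_deg r.unop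
    induction r using MulOpposite.rec' with | _ r
    simp only [unop_op] at hr
    simp only [SetLike.mem_coe] at hφ ⊢
    induction hφ using AddSubgroup.iSup_induction' with
    | h1 => rw [smul_zero]; exact zero_mem _
    | hadd φ ψ _ _ h h' => rw [smul_add]; exact add_mem h h'
    | hp i φ hφ =>
      induction hr using AddSubgroup.iSup_induction' with
      | h1 => rw [MulOpposite.op_zero, zero_smul]; exact zero_mem _
      | hadd r s _ _ h h' => rw [MulOpposite.op_add, add_smul]; exact add_mem h h'
      | hp j r hr =>
        refine AddSubgroup.mem_iSup_of_mem (i + j) fun n x hx ↦ ?_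
        rw [← add_assoc]
        exact G.mul_mem (hφ n x hx) hr

end GradedModule

/-- A graded projective resolution `⋯ → X 1 → X 0 → M → 0` of a graded module. -/
structure GradedResolution {G : ZGrading R} (M : GradedModule G) where
  X : ℕ → GradedModule G
  projective : ∀ n, Module.Projective R (X n)
  d : ∀ n, X (n + 1) →ₗ[R] X n
  ε : X 0 →ₗ[R] M
  d_deg : ∀ (n : ℕ) (i : ℤ) (x : X (n + 1)), x ∈ (X (n + 1)).deg i → d n x ∈ (X n).deg i
  ε_deg : ∀ (i : ℤ) (x : X 0), x ∈ (X 0).deg i → ε x ∈ M.deg i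
  ε_surjective : Function.Surjective ε
  exact_zero : Function.Exact (d 0) ε
  exact_succ : ∀ n, Function.Exact (d (n + 1)) (d n)

namespace GradedResolution

variable {G : ZGrading R} {M : GradedModule G}

/-- The resolution has finite length and finitely generated terms. -/
def IsPerfect (P : GradedResolution M) : Prop :=
  (∀ n, Module.Finite R (P.X n)) ∧ ∃ N : ℕ, ∀ n, N < n → Subsingleton (P.X n)

/-- The map `Hom(X n, R) → Hom(X (n + 1), R)` induced by the differential. -/
def dual (P : GradedResolution M) (n : ℕ) : (P.X n).Dual →ₗ[Rᵐᵒᵖ] (P.X (n + 1)).Dual where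
  toFun φ := LinearMap.comp (σ₁₂ := RingHom.id R) φ (P.d n)
  map_add' _ _ := rfl
  map_smul' _ _ := rfl

/-- The `n`-cocycles of the complex of graded Hom-groups `Hom(X •, R)`. -/
def cocycles (P : GradedResolution M) (n : ℕ) : Submodule Rᵐᵒᵖ (P.X n).Dual :=
  (P.X n).grHom ⊓ LinearMap.ker (P.dual n)

/-- The `n`-coboundaries of the complex of graded Hom-groups `Hom(X •, R)`. -/
def coboundaries (P : GradedResolution M) : (n : ℕ) → Submodule Rᵐᵒᵖ (P.X n).Dual
  | 0 => ⊥
  | n + 1 => ((P.X n).grHom).map (P.dual n)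

/-- The graded Ext-group `Extⁿ(M, R)`, computed by the graded projective resolution `P`, as a right
`R`-module. -/
abbrev GrExt (P : GradedResolution M) (n : ℕ) : Type u :=
  P.cocycles n ⧸ (P.coboundaries n).submoduleOf (P.cocycles n)

/-- The homogeneous elements of degree `j` of `Extⁿ(M, R)`: the classes of the cocycles of
degree `j`. -/
def grExtDeg (P : GradedResolution M) (n : ℕ) (j : ℤ) : Set (P.GrExt n) :=
  {x | ∃ φ : P.cocycles n, φ.1 ∈ (P.X n).homDeg j ∧ x = Submodule.Quotient.mk φ}

end GradedResolution

end GradedModules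

section Graded

attribute [local instance] instModuleTensorProductMop

variable {k : Type v} {A : Type u} [Field k] [Ring A] [Algebra k A]

/-- The `ℕ`-grading of `A` as a `ℤ`-grading. -/
def algDeg (𝒜 : ℕ → Submodule k A) : ℤ → Submodule k A
  | Int.ofNat n => 𝒜 n
  | Int.negSucc _ => ⊥

/-- The grading of the enveloping algebra: `a ⊗ op b` has degree `deg a + deg b`. -/
def envDeg (𝒜 : ℕ → Submodule k A) (n : ℤ) : Submodule k (Env k A) :=
  Submodule.span k {x | ∃ (i j : ℕ) (a b : A),
    (i : ℤ) + (j : ℤ) = n ∧ a ∈ 𝒜 i ∧ b ∈ 𝒜 j ∧ x = a ⊗ₜ[k] op b}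

theorem envDeg_mul (𝒜 : ℕ → Submodule k A) [SetLike.GradedMonoid 𝒜] {i j : ℤ} {r s : Env k A}
    (hr : r ∈ envDeg 𝒜 i) (hs : s ∈ envDeg 𝒜 j) : r * s ∈ envDeg 𝒜 (i + j) := by
  have h := Submodule.mul_mem_mul hr hs
  rw [envDeg, envDeg, Submodule.span_mul_span] at h
  refine Submodule.span_mono ?_ h
  rintro _ ⟨_, ⟨i₁, j₁, a, b, hij, ha, hb, rfl⟩, _, ⟨i₂, j₂, a', b', hij', ha', hb', rfl⟩, rfl⟩
  refine ⟨i₁ + i₂, j₂ + j₁, a * a', b' * b, ?_, SetLike.mul_mem_graded ha ha',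
    SetLike.mul_mem_graded hb' hb, ?_⟩
  · push_cast; omega
  · simp

theorem iSup_envDeg (𝒜 : ℕ → Submodule k A) [GradedAlgebra 𝒜] : ⨆ n, envDeg 𝒜 n = ⊤ := by
  rw [eq_top_iff]
  rintro x -
  have key : ∀ a b : A, (a ⊗ₜ[k] op b : Env k A) ∈ ⨆ n, envDeg 𝒜 n := by
    intro a b
    refine DirectSum.Decomposition.inductionOn 𝒜 (by simp) ?_ ?_ a
    · intro i a
      refine DirectSum.Decomposition.inductionOn 𝒜 (by simp) ?_ ?_ b
      · intro j b
        exact Submodule.mem_iSup_of_mem ((i : ℤ) + j)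
          (Submodule.subset_span ⟨i, j, a, b, rfl, a.2, b.2, rfl⟩)
      · intro b b' hb hb'
        rw [MulOpposite.op_add, TensorProduct.tmul_add]
        exact add_mem hb hb'
    · intro a a' ha ha'
      rw [TensorProduct.add_tmul]
      exact add_mem ha ha'
  induction x using TensorProduct.induction_on with
  | zero => exact zero_mem _
  | add x y hx hy => exact add_mem hx hy
  | tmul a b => exact key a b.unop

/-- The projection of the enveloping algebra to its component of degree `n`. -/
def envProj (𝒜 : ℕ → Submodule k A) [GradedAlgebra 𝒜] (n : ℤ) : Env k A →ₗ[k] Env k A :=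
  ∑ p ∈ Finset.HasAntidiagonal.antidiagonal n.toNat, if (p.1 + p.2 : ℤ) = n then
    TensorProduct.map (GradedAlgebra.proj 𝒜 p.1)
      ((opLinearEquiv k).toLinearMap ∘ₗ GradedAlgebra.proj 𝒜 p.2 ∘ₗ
        (opLinearEquiv k).symm.toLinearMap) else 0

theorem envProj_of_mem (𝒜 : ℕ → Submodule k A) [GradedAlgebra 𝒜] {m n : ℤ} {x : Env k A}
    (hx : x ∈ envDeg 𝒜 m) : envProj 𝒜 n x = if m = n then x else 0 := by
  induction hx using Submodule.span_induction with
  | zero => simp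
  | add x y _ _ hx hy => rw [map_add, hx, hy]; split_ifs <;> simp
  | smul c x _ hx => rw [map_smul, hx]; split_ifs <;> simp
  | mem x hx =>
    obtain ⟨i, j, a, b, rfl, ha, hb, rfl⟩ := hx
    have key : ∀ p : ℕ × ℕ, (if (p.1 + p.2 : ℤ) = n then
        TensorProduct.map (GradedAlgebra.proj 𝒜 p.1)
          ((opLinearEquiv k).toLinearMap ∘ₗ GradedAlgebra.proj 𝒜 p.2 ∘ₗ
            (opLinearEquiv k).symm.toLinearMap) else 0 : Env k A →ₗ[k] Env k A)
          (a ⊗ₜ[k] op b) =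
        if p = (i, j) then (if (i + j : ℤ) = n then a ⊗ₜ[k] op b else 0) else 0 := by
      rintro ⟨p, q⟩
      by_cases hp : i = p
      · by_cases hq : j = q
        · subst hp hq
          split_ifs <;>
            simp_all [GradedAlgebra.proj_apply, DirectSum.decompose_of_mem_same]
        · have hne : ¬ ((p, q) = (i, j)) := by simp [Ne.symm hq]
          rw [if_neg hne]
          split_ifs <;>
            simp [GradedAlgebra.proj_apply, DirectSum.decompose_of_mem_ne 𝒜 hb hq]
      · have hne : ¬ ((p, q) = (i, j)) := by simp [Ne.symm hp]
        rw [if_neg hne]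
        split_ifs <;>
          simp [GradedAlgebra.proj_apply, DirectSum.decompose_of_mem_ne 𝒜 ha hp]
    rw [envProj, LinearMap.sum_apply, Finset.sum_congr rfl fun p _ ↦ key p, Finset.sum_ite_eq']
    by_cases h : (i + j : ℤ) = n
    · rw [if_pos h, if_pos (by rw [Finset.HasAntidiagonal.mem_antidiagonal]; omega)]
    · simp [h]

theorem isInternal_of_proj {ι V : Type*} [DecidableEq ι] [AddCommGroup V] [Module k V]
    (W : ι → Submodule k V) (π : ι → V →ₗ[k] V)
    (hπ : ∀ (i j : ι) (x : V), x ∈ W i → π j x = if i = j then x else 0)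
    (htop : ⨆ i, W i = ⊤) : DirectSum.IsInternal W := by
  rw [DirectSum.isInternal_submodule_iff_iSupIndep_and_iSup_eq_top]
  refine ⟨fun j ↦ ?_, htop⟩
  rw [Submodule.disjoint_def]
  intro x hx hx'
  have h0 : π j x = 0 := by
    have : (⨆ i, ⨆ (_ : i ≠ j), W i) ≤ LinearMap.ker (π j) := by
      refine iSup_le fun i ↦ iSup_le fun hi y hy ↦ ?_
      rw [LinearMap.mem_ker, hπ i j y hy, if_neg hi]
    exact this hx'
  rwa [hπ j j x hx, if_pos rfl] at h0

/-- The enveloping algebra of a graded algebra as a graded ring. -/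
def envGrading (𝒜 : ℕ → Submodule k A) [GradedAlgebra 𝒜] : ZGrading (Env k A) where
  deg n := (envDeg 𝒜 n).toAddSubgroup
  isInternal := isInternal_of_proj (envDeg 𝒜) (envProj 𝒜)
    (fun _ _ _ hx ↦ envProj_of_mem 𝒜 hx) (iSup_envDeg 𝒜)
  one_mem := Submodule.subset_span
    ⟨0, 0, 1, 1, rfl, SetLike.one_mem_graded 𝒜, SetLike.one_mem_graded 𝒜, rfl⟩
  mul_mem hr hs := envDeg_mul 𝒜 hr hs

theorem algDeg_natCast (𝒜 : ℕ → Submodule k A) (n : ℕ) : algDeg 𝒜 n = 𝒜 n := rfl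

theorem exists_of_mem_algDeg (𝒜 : ℕ → Submodule k A) {n : ℤ} {a : A} (ha : a ∈ algDeg 𝒜 n) :
    a = 0 ∨ ∃ i : ℕ, (i : ℤ) = n ∧ a ∈ 𝒜 i := by
  cases n with
  | ofNat n => exact Or.inr ⟨n, rfl, ha⟩
  | negSucc n => exact Or.inl ha

theorem isInternal_algDeg (𝒜 : ℕ → Submodule k A) [GradedAlgebra 𝒜] :
    DirectSum.IsInternal (algDeg 𝒜) := by
  refine isInternal_of_proj (algDeg 𝒜)
    (fun n ↦ if 0 ≤ n then GradedAlgebra.proj 𝒜 n.toNat else 0) ?_ ?_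
  · intro m n x hx
    obtain rfl | ⟨i, rfl, hx⟩ := exists_of_mem_algDeg 𝒜 hx
    · simp
    · by_cases h : (i : ℤ) = n
      · subst h
        simp [GradedAlgebra.proj_apply, DirectSum.decompose_of_mem_same 𝒜 hx]
      · rw [if_neg h]
        split_ifs with h0
        · rw [GradedAlgebra.proj_apply, DirectSum.decompose_of_mem_ne 𝒜 hx (by omega)]
        · simp
  · rw [eq_top_iff, ← (DirectSum.Decomposition.isInternal 𝒜).submodule_iSup_eq_top]
    exact iSup_le fun n ↦ le_iSup (algDeg 𝒜) (n : ℤ)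

/-- The graded algebra `A` as a graded left module over its enveloping algebra. -/
def diagModule (𝒜 : ℕ → Submodule k A) [GradedAlgebra 𝒜] : GradedModule (envGrading 𝒜) where
  carrier := A
  deg n := (algDeg 𝒜 n).toAddSubgroup
  isInternal := isInternal_algDeg 𝒜
  smul_mem := by
    intro i j r m hr hm
    change r ∈ envDeg 𝒜 i at hr
    change r • m ∈ algDeg 𝒜 (i + j)
    obtain rfl | ⟨l, rfl, hm⟩ := exists_of_mem_algDeg 𝒜 hm
    · rw [smul_zero]; exact zero_mem _
    have h : envDeg 𝒜 i ≤
        (algDeg 𝒜 (i + l)).comap ((AlgHom.mulLeftRight k A).toLinearMap.flip m) := by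
      refine Submodule.span_le.2 ?_
      rintro _ ⟨i, j, a, b, rfl, ha, hb, rfl⟩
      change AlgHom.mulLeftRight k A (a ⊗ₜ[k] op b) m ∈ algDeg 𝒜 (i + j + l)
      rw [AlgHom.mulLeftRight_apply,
        show (i + j + l : ℤ) = ((i + l + j : ℕ) : ℤ) by push_cast; ring]
      exact SetLike.mul_mem_graded (SetLike.mul_mem_graded ha hm) hb
    exact h hr

/-- A graded (that is, `ℤ`-graded) `k`-central `(A, A)`-bimodule. -/
structure GradedBimodule (𝒜 : ℕ → Submodule k A) extends CentralBimodule k A where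
  deg : ℤ → AddSubgroup carrier
  isInternal : DirectSum.IsInternal deg
  left_mem : ∀ (i : ℕ) (j : ℤ) (a : A) (u : carrier), a ∈ 𝒜 i → u ∈ deg j → a • u ∈ deg (i + j)
  right_mem : ∀ (i : ℕ) (j : ℤ) (a : A) (u : carrier),
    a ∈ 𝒜 i → u ∈ deg j → op a • u ∈ deg (j + i)

namespace GradedBimodule

variable {𝒜 : ℕ → Submodule k A}

/-- The isomorphism `U ⊗_A V ≅ A` is graded, where `deg (u ⊗ v) = deg u + deg v`. -/
def IsGradedIso (U V : GradedBimodule 𝒜)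
    (e : CentralBimodule.TensorIso U.toCentralBimodule V.toCentralBimodule) : Prop :=
  ∀ (i j : ℤ) (u : U.carrier) (v : V.carrier), u ∈ U.deg i → v ∈ V.deg j →
    e.equiv (CentralBimodule.tmul u v) ∈ algDeg 𝒜 (i + j)

/-- `U` is graded-invertible: `U ⊗_A V ≅ A ≅ V ⊗_A U` as graded bimodules for some graded `V`. -/
def IsGradedInvertible (U : GradedBimodule 𝒜) : Prop :=
  ∃ V : GradedBimodule 𝒜, (∃ e, IsGradedIso U V e) ∧ (∃ e, IsGradedIso V U e)

end GradedBimodule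

/-- The graded algebra `A` is graded twisted Calabi-Yau of dimension `d` over `k`: it has a finite
graded projective resolution over `Aᵉ` with finitely generated terms, and the graded Ext-groups of
`A` with values in `Aᵉ` (which, up to isomorphism of graded right `Aᵉ`-modules, do not depend on
the graded projective resolution that computes them) vanish outside degree `d` and form a
graded-invertible bimodule in degree `d`. -/
def IsGradedTwistedCY (𝒜 : ℕ → Submodule k A) [GradedAlgebra 𝒜] (d : ℕ) : Prop :=
  ∃ P : GradedResolution (diagModule 𝒜), P.IsPerfect ∧
    ∃ U : GradedBimodule 𝒜, U.IsGradedInvertible ∧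
      (∀ i : ℕ, i ≠ d → Subsingleton (P.GrExt i)) ∧
      ∃ e : CentralBimodule.EnvIso (P.GrExt d) U.toCentralBimodule,
        ∀ (j : ℤ) (x : P.GrExt d), x ∈ P.grExtDeg d j → e.equiv x ∈ U.deg j

end Graded

end TwistedCY

/-!
Extension of the ground field preserves, and descends, the twisted Calabi-Yau property for the
following reasons.

*Invertible bimodules.* A bimodule `U` is invertible if and only if it is a *balanced progenerator*:
a finitely generated projective generator as a left module, such that every left linear
endomorphism is right multiplication by a unique element of `A`
(`IsInvertible.isBalancedProgenerator`, `isInvertible_of_isBalancedProgenerator`).  The inverse is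
the left dual `Hom_A(U, A)`.  A linear form `l : K → k` with `l 1 = 1` retracts `K ⊗ M` onto `M`, and
contracting with it turns the data that witness these properties over `K` into data over `k`.  So
being a balanced progenerator passes from `U` to `K ⊗ U` and back
(`IsBalancedProgenerator.baseChange`, `IsBalancedProgenerator.of_baseChange`).

*Ascent.* The enveloping algebra of `K ⊗ A` is `K ⊗ Aᵉ`.  If `P` is a finite resolution of `A` by
finitely generated projective modules, then `K ⊗ P` is one of `K ⊗ A`, and
`Hom(K ⊗ P, K ⊗ Aᵉ) = K ⊗ Hom(P, Aᵉ)`, whence the Ext-groups of `K ⊗ A` are those of `A` tensored with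
`K` (`PerfectResolution.exists_ext_env_baseChange`).  This gives `IsTwistedCY.baseChange`.

*Descent.* Let `A` be graded and `K ⊗ A` twisted Calabi-Yau.  A graded resolution of `A` is built
from graded free covers of the successive syzygies.  The base change of a syzygy is a syzygy of
`K ⊗ A`, which by Schanuel's lemma has a finite resolution by finitely generated projective
modules, one step shorter than that of its predecessor.  Finite generation and projectivity
descend, so the construction stops
(`HasPerfectLength.exists_gradedResolution`).  Since the terms are finitely generated, every linear
form on them is a sum of homogeneous ones, and the graded Ext-groups are the ungraded ones with a
grading (`GradedResolution.grExtEquiv`).  Their base change vanishes outside degree `d` and is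
invertible in degree `d`, so they vanish outside degree `d`, and the one in degree `d` is a balanced
progenerator.  The isomorphisms of a graded balanced progenerator with its left dual preserve
degrees, so it is graded-invertible.  Hence `A` is graded twisted Calabi-Yau
(`IsTwistedCY.isGradedTwistedCY_of_baseChange`).

Forgetting the gradings (`IsGradedTwistedCY.isTwistedCY`) and combining these implications, where
descent is also applied to `K ⊗ A` and the trivial extension `K / K`, gives all the claims.
-/

set_option linter.unusedSectionVars false

/-! ### Progenerators and invertible bimodules -/

namespace TwistedCY

section Progenerator

/-- The identity of the left `A`-module `U` is a finite sum of maps `x ↦ f x • w` with `f : U → A`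
linear: a finite dual basis, written without indices. -/
def HasDualBasis (A U : Type*) [Ring A] [AddCommGroup U] [Module A U] : Prop :=
  LinearMap.id ∈ AddSubgroup.closure
    {g : U →ₗ[A] U | ∃ (f : U →ₗ[A] A) (w : U), ∀ x, g x = f x • w}

/-- The left `A`-module underlying the bimodule `U` is a progenerator, and every endomorphism of it
is right multiplication by a unique element of `A`. -/
structure IsBalancedProgenerator (A U : Type*) [Ring A] [AddCommGroup U] [Module A U]
    [Module Aᵐᵒᵖ U] : Prop where
  generator : (1 : A) ∈ AddSubgroup.closure {a : A | ∃ (f : U →ₗ[A] A) (u : U), f u = a}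
  dualBasis : HasDualBasis A U
  faithful : ∀ a : A, (∀ x : U, op a • x = 0) → a = 0
  full : ∀ f : U →ₗ[A] U, ∃ a : A, ∀ x, f x = op a • x

end Progenerator

namespace CentralBimodule

variable {k : Type v} {A : Type u} [Field k] [Ring A] [Algebra k A]

section tmul

variable {U V : CentralBimodule k A}

theorem tmul_add (u : U) (v v' : V) : tmul u (v + v') = tmul u v + tmul u v' := by
  simp [tmul, TensorProduct.tmul_add]

theorem add_tmul (u u' : U) (v : V) : tmul (u + u') v = tmul u v + tmul u' v := by
  simp [tmul, TensorProduct.add_tmul]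

theorem tmul_zero (u : U) : tmul u (0 : V) = 0 := by
  simp [tmul]

theorem sum_tmul {ι : Type*} (s : Finset ι) (f : ι → U) (v : V) :
    tmul (∑ i ∈ s, f i) v = ∑ i ∈ s, tmul (f i) v := by
  simp only [tmul, TensorProduct.sum_tmul, map_sum]

theorem op_smul_tmul (u : U) (a : A) (v : V) : tmul (op a • u) v = tmul u (a • v) := by
  rw [← sub_eq_zero, tmul, tmul, ← map_sub]
  exact (Submodule.Quotient.mk_eq_zero _).2 (Submodule.subset_span ⟨u, a, v, rfl⟩)

theorem smul_tmul' (c : k) (u : U) (v : V) : tmul (c • u) v = c • tmul u v := by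
  rw [tmul, tmul, ← map_smul, TensorProduct.smul_tmul']

theorem tensorOver_induction {p : TensorOver U V → Prop} (t : TensorOver U V) (h0 : p 0)
    (ht : ∀ u v, p (tmul u v)) (ha : ∀ x y, p x → p y → p (x + y)) : p t := by
  obtain ⟨t, rfl⟩ := (balancedRel U V).mkQ_surjective t
  induction t using TensorProduct.induction_on with
  | zero => simpa using h0
  | tmul u v => exact ht u v
  | add x y hx hy => rw [map_add]; exact ha _ _ hx hy

theorem exists_finset_tmul (t : TensorOver U V) :
    ∃ s : Finset (U × V), t = ∑ i ∈ s, tmul i.1 i.2 := by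
  obtain ⟨t, rfl⟩ := (balancedRel U V).mkQ_surjective t
  obtain ⟨s, rfl⟩ := TensorProduct.exists_finset t
  exact ⟨s, by simp [tmul]⟩

/-- The map out of `U ⊗_A V` induced by a balanced biadditive map that is `k`-linear in the
first variable. -/
def liftTensor {W : Type*} [AddCommGroup W] [Module k W] (f : U → V → W)
    (hl : ∀ u u' v, f (u + u') v = f u v + f u' v) (hr : ∀ u v v', f u (v + v') = f u v + f u v')
    (hs : ∀ (c : k) u v, f (c • u) v = c • f u v)
    (hb : ∀ (u : U) (a : A) (v : V), f (op a • u) v = f u (a • v)) : TensorOver U V →ₗ[k] W :=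
  (balancedRel U V).liftQ (TensorProduct.lift (LinearMap.mk₂ k f hl hs hr (fun c u v ↦ by
      rw [← hs, ← algebraMap_smul A c v, ← hb, ← IsScalarTower.algebraMap_smul Aᵐᵒᵖ c u]
      rfl))) <| by
    refine Submodule.span_le.2 ?_
    rintro _ ⟨u, a, v, rfl⟩
    simp [hb]

theorem liftTensor_tmul {W : Type*} [AddCommGroup W] [Module k W] (f : U → V → W)
    (hl hr hs hb) (u : U) (v : V) : liftTensor (k := k) (A := A) f hl hr hs hb (tmul u v) = f u v :=
  rfl

/-- A surjective bimodule map `U ⊗_A V → A` that satisfies one of the two associativity laws of a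
Morita context is injective. -/
theorem injective_of_associative (ev : TensorOver U V →ₗ[k] A)
    (hs : Function.Surjective ev)
    (h : ∀ (x : U) (g : V) (u : U) (f : V),
      tmul x (op (ev (tmul u f)) • g) = tmul (ev (tmul x g) • u) f) :
    Function.Injective ev := by
  rw [injective_iff_map_eq_zero]
  intro t ht
  -- `R a` is the right action of `a`; associativity gives `R (ev r) s = 0` for `s` in the kernel,
  -- and surjectivity provides an `r` with `ev r = 1`
  let R (a : A) : TensorOver U V →ₗ[k] TensorOver U V :=
    liftTensor (fun u v ↦ tmul u (op a • v)) (fun _ _ _ ↦ add_tmul _ _ _)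
      (fun _ _ _ ↦ by rw [smul_add, tmul_add]) (fun _ _ _ ↦ smul_tmul' _ _ _)
      (fun u b v ↦ by rw [op_smul_tmul, smul_comm])
  have hR (a : A) (u : U) (v : V) : R a (tmul u v) = tmul u (op a • v) := rfl
  have hRadd (a b : A) (s : TensorOver U V) : R (a + b) s = R a s + R b s := by
    induction s using tensorOver_induction with
    | h0 => simp
    | ht u v => rw [hR, hR, hR, MulOpposite.op_add, add_smul, tmul_add]
    | ha x y hx hy => rw [map_add, map_add, map_add, hx, hy]; abel
  have hRev (s r : TensorOver U V) (hs0 : ev s = 0) : R (ev r) s = 0 := by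
    induction r using tensorOver_induction with
    | h0 =>
      rw [map_zero]
      have := hRadd 0 0 s
      rwa [add_zero, left_eq_add] at this
    | ha x y hx hy => rw [map_add, hRadd, hx, hy, add_zero]
    | ht u f =>
      have key : R (ev (tmul u f)) s = tmul (ev s • u) f := by
        clear hs0
        induction s using tensorOver_induction with
        | h0 => rw [map_zero, map_zero, zero_smul]; simp [tmul]
        | ht x g => rw [hR, h]
        | ha x y hx hy => rw [map_add, hx, hy, map_add, add_smul, add_tmul]
      rw [key, hs0, zero_smul]
      simp [tmul]
  obtain ⟨r, hr⟩ := hs 1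
  have h1 : R 1 t = t := by
    induction t using tensorOver_induction with
    | h0 => simp
    | ht u v => rw [hR, op_one, one_smul]
    | ha x y hx hy =>
      clear hx hy ht
      obtain ⟨s, hs⟩ := exists_finset_tmul (x + y)
      rw [hs, map_sum]
      exact Finset.sum_congr rfl fun i _ ↦ by rw [hR, op_one, one_smul]
  rw [← h1, ← hr]
  exact hRev t r ht

end tmul

section Invertible

variable {X Y : CentralBimodule k A}

/-- If `∑ y ⊗ x` corresponds to `1`, then `∑ a y ⊗ x` corresponds to `a`. -/
theorem TensorIso.sum_left (β : TensorIso Y X) (R : Finset (Y × X))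
    (hR : β.equiv.symm 1 = ∑ j ∈ R, tmul j.1 j.2) (q : Y) (z : X) :
    ∑ j ∈ R, tmul (β.equiv (tmul q z) • j.1) j.2 = tmul q z := by
  apply β.equiv.injective
  rw [map_sum]
  simp_rw [β.map_left]
  rw [← Finset.mul_sum, ← map_sum, ← hR, LinearEquiv.apply_symm_apply, mul_one]

/-- The two isomorphisms `X ⊗ Y ≅ A ≅ Y ⊗ X` need not form a Morita context, but they do after the
first is composed with an automorphism `T'` of `X`: the pairing is `γ q p = α(T' p ⊗ q)`. -/
theorem exists_moritaContext (α : TensorIso X Y) (β : TensorIso Y X) :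
    ∃ (γ : Y → X →ₗ[A] A),
      (∀ (p : X) (q : Y) (z : X), γ q p • z = op (β.equiv (tmul q z)) • p) ∧
      ∃ R : Finset (Y × X), β.equiv.symm 1 = ∑ j ∈ R, tmul j.1 j.2 ∧
        ∀ x, ∑ j ∈ R, γ j.1 x • j.2 = x := by
  obtain ⟨S, hS⟩ := exists_finset_tmul (α.equiv.symm 1)
  obtain ⟨R, hR⟩ := exists_finset_tmul (β.equiv.symm 1)
  -- `T` measures how far `α(p ⊗ q) z` is from `p β(q ⊗ z)`; it is inverted by `T'` below
  let T (x : X) : X := ∑ j ∈ R, α.equiv (tmul x j.1) • j.2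
  have hT (p : X) (q : Y) (z : X) : T (op (β.equiv (tmul q z)) • p) = α.equiv (tmul p q) • z := by
    let Ψ : TensorOver Y X →ₗ[k] X := liftTensor (fun y x ↦ α.equiv (tmul p y) • x)
      (fun _ _ _ ↦ by rw [tmul_add, map_add, add_smul]) (fun _ _ _ ↦ smul_add _ _ _)
      (fun c y x ↦ by
        have : tmul p (c • y) = c • tmul p y := by
          rw [tmul, tmul, ← map_smul, TensorProduct.tmul_smul]
        rw [this, map_smul, smul_assoc])
      (fun y a x ↦ by rw [α.map_right, mul_smul])
    have := congrArg Ψ (β.sum_left R hR q z)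
    rw [map_sum] at this
    simp only [Ψ, liftTensor_tmul] at this
    rw [← this]
    refine Finset.sum_congr rfl fun j _ ↦ ?_
    rw [op_smul_tmul]
  let T' : X →ₗ[A] X :=
    { toFun x := ∑ i ∈ S, op (β.equiv (tmul i.2 x)) • i.1
      map_add' x y := by
        simp_rw [tmul_add, map_add, MulOpposite.op_add, add_smul]
        exact Finset.sum_add_distrib
      map_smul' a x := by
        rw [RingHom.id_apply]
        -- both sides agree with the image of `a` under the isomorphism `X ⊗ Y ≅ A`
        have h1 : ∑ i ∈ S, tmul (a • i.1) i.2 = ∑ i ∈ S, tmul i.1 (op a • i.2) := by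
          apply α.equiv.injective
          rw [map_sum, map_sum]
          simp_rw [α.map_left, α.map_right]
          rw [← Finset.mul_sum, ← Finset.sum_mul, ← map_sum, ← hS, LinearEquiv.apply_symm_apply,
            mul_one, one_mul]
        let Φ : TensorOver X Y →ₗ[k] X := liftTensor (fun p q ↦ op (β.equiv (tmul q x)) • p)
          (fun _ _ _ ↦ smul_add _ _ _)
          (fun _ _ _ ↦ by rw [add_tmul, map_add, MulOpposite.op_add, add_smul])
          (fun c p q ↦ smul_comm _ _ _)
          (fun p b q ↦ by rw [β.map_left, op_mul, mul_smul])
        have h2 := congrArg Φ h1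
        rw [map_sum, map_sum] at h2
        simp only [Φ, liftTensor_tmul] at h2
        rw [Finset.smul_sum]
        simp_rw [← op_smul_tmul]
        rw [← h2]
        exact Finset.sum_congr rfl fun i _ ↦ (smul_comm _ _ _).symm }
  have hT' (x : X) : T' x = ∑ i ∈ S, op (β.equiv (tmul i.2 x)) • i.1 := rfl
  have hTT' (x : X) : T (T' x) = x := by
    have hTadd (s : Finset (X × Y)) (f : X × Y → X) : T (∑ i ∈ s, f i) = ∑ i ∈ s, T (f i) := by
      simp only [T, sum_tmul, map_sum, Finset.sum_smul]
      exact Finset.sum_comm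
    rw [hT', hTadd]
    simp_rw [hT]
    rw [← Finset.sum_smul, ← map_sum, ← hS, LinearEquiv.apply_symm_apply, one_smul]
  have hT'r (x : X) (b : A) : T' (op b • x) = op b • T' x := by
    rw [hT', hT', Finset.smul_sum]
    refine Finset.sum_congr rfl fun i _ ↦ ?_
    rw [β.map_right, op_mul, mul_smul]
  refine ⟨fun q ↦
    { toFun p := α.equiv (tmul (T' p) q)
      map_add' p p' := by rw [map_add, add_tmul, map_add]
      map_smul' a p := by rw [map_smul, α.map_left]; rfl }, fun p q z ↦ ?_, R, hR, fun x ↦ ?_⟩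
  · change α.equiv (tmul (T' p) q) • z = _
    rw [← hT, ← hT'r, hTT']
  · exact hTT' x

/-- An invertible bimodule is a balanced progenerator. -/
theorem IsInvertible.isBalancedProgenerator (h : X.IsInvertible) :
    IsBalancedProgenerator A X := by
  obtain ⟨Y, ⟨α⟩, ⟨β⟩⟩ := h
  obtain ⟨γ, hγ, R, hR, hγR⟩ := exists_moritaContext α β
  have hR1 : ∑ j ∈ R, β.equiv (tmul j.1 j.2) = 1 := by
    rw [← map_sum, ← hR, LinearEquiv.apply_symm_apply]
  refine ⟨?_, ?_, fun a ha ↦ ?_, fun f ↦ ?_⟩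
  · obtain ⟨S, hS⟩ := exists_finset_tmul (α.equiv.symm 1)
    rw [← α.equiv.apply_symm_apply 1, hS, map_sum]
    refine sum_mem fun i _ ↦ AddSubgroup.subset_closure ⟨?_, i.1, ?_⟩
    · exact { toFun p := α.equiv (tmul p i.2)
              map_add' p p' := by rw [add_tmul, map_add]
              map_smul' a p := by rw [α.map_left]; rfl }
    · rfl
  · have : LinearMap.id = ∑ j ∈ R, (LinearMap.toSpanSingleton A X j.2).comp (γ j.1) := by
      ext x
      rw [LinearMap.sum_apply]
      exact (hγR x).symm
    rw [HasDualBasis, this]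
    exact sum_mem fun j _ ↦ AddSubgroup.subset_closure ⟨γ j.1, j.2, fun x ↦ rfl⟩
  -- `a = ∑ β(y ⊗ x) a = ∑ β(y ⊗ x a)`
  · rw [← one_mul a, ← hR1, Finset.sum_mul]
    refine Finset.sum_eq_zero fun j _ ↦ ?_
    rw [← β.map_right, ha, tmul_zero, map_zero]
  -- `f x = ∑ γ(y, x) f(x') = ∑ x β(y ⊗ f x')`, where `∑ y ⊗ x'` corresponds to `1`
  · refine ⟨∑ j ∈ R, β.equiv (tmul j.1 (f j.2)), fun x ↦ ?_⟩
    conv_lhs => rw [← hγR x, map_sum]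
    rw [Finset.op_sum, Finset.sum_smul]
    refine Finset.sum_congr rfl fun j _ ↦ ?_
    rw [map_smul, hγ]

end Invertible

end CentralBimodule

end TwistedCY

/-! ### The left dual of a balanced progenerator -/

namespace TwistedCY

namespace CentralBimodule

variable {k : Type v} {A : Type u} [Field k] [Ring A] [Algebra k A]

/-- The left dual `Hom_A(U, A)` of a bimodule, with `(a f b)(x) = f(x a) b`. -/
def dual (U : CentralBimodule k A) : CentralBimodule k A :=
  letI : Module A (U →ₗ[A] A) :=
    { smul a f :=
        { toFun x := f (op a • x)
          map_add' x y := by rw [smul_add, map_add]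
          map_smul' b x := by rw [← smul_comm, map_smul]; rfl }
      one_smul f := LinearMap.ext fun x ↦ congrArg f (one_smul Aᵐᵒᵖ x)
      mul_smul a b f := LinearMap.ext fun x ↦ congrArg f (mul_smul (op b) (op a) x)
      smul_zero a := rfl
      smul_add a f g := rfl
      add_smul a b f := LinearMap.ext fun x ↦
        (congrArg f (add_smul (op a) (op b) x)).trans (map_add f _ _)
      zero_smul f := LinearMap.ext fun x ↦ (congrArg f (zero_smul Aᵐᵒᵖ x)).trans (map_zero f) }
  { carrier := U →ₗ[A] A
    smulComm := ⟨fun _ _ _ ↦ rfl⟩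
    leftTower := ⟨fun c a f ↦ LinearMap.ext fun x ↦
      (congrArg f (smul_assoc c (op a) x)).trans (f.map_smul_of_tower c _)⟩
    rightTower := ⟨fun c b f ↦ LinearMap.ext fun x ↦ smul_assoc c b (f x)⟩ }

/-- An element of the dual bimodule as a linear form. -/
def dualForm {U : CentralBimodule k A} (f : U.dual) : U →ₗ[A] A := f

variable {U : CentralBimodule k A}

theorem dualForm_left (a : A) (f : U.dual) (x : U) : dualForm (a • f) x = dualForm f (op a • x) :=
  rfl

theorem dualForm_right (b : A) (f : U.dual) (x : U) : dualForm (op b • f) x = dualForm f x * b :=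
  rfl

theorem dualForm_ext {f g : U.dual} (h : ∀ x, dualForm f x = dualForm g x) : f = g :=
  LinearMap.ext h

theorem dualForm_add (f g : U.dual) (x : U) :
    dualForm (f + g) x = dualForm f x + dualForm g x := rfl

theorem dualForm_baseSMul (c : k) (f : U.dual) (x : U) :
    dualForm (c • f) x = c • dualForm f x := rfl

/-- The evaluation `U ⊗_A Hom_A(U, A) → A`. -/
def evalDual (U : CentralBimodule k A) : TensorOver U U.dual →ₗ[k] A :=
  liftTensor (fun u f ↦ dualForm f u) (fun u u' f ↦ map_add (dualForm f) u u')
    (fun _ _ _ ↦ rfl) (fun c u f ↦ (dualForm f).map_smul_of_tower c u) (fun _ _ _ ↦ rfl)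

theorem evalDual_tmul (u : U) (f : U.dual) : evalDual U (tmul u f) = dualForm f u := rfl

/-- A balanced progenerator is inverse to its left dual: the evaluation `u ⊗ f ↦ f u` and the map
sending `f ⊗ u` to the element by which `x ↦ f x • u` is right multiplication form a Morita
context whose maps are surjective. -/
theorem exists_tensorIso_dual (h : IsBalancedProgenerator A U) :
    ∃ (e : TensorIso U U.dual) (e' : TensorIso U.dual U),
      (∀ u f, e.equiv (tmul u f) = dualForm f u) ∧
      ∀ f u x, op (e'.equiv (tmul f u)) • x = dualForm f x • u := by
  have hfull (f : U.dual) (u : U) : ∃ a : A, ∀ x : U, op a • x = dualForm f x • u := by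
    obtain ⟨a, ha⟩ := h.full ((LinearMap.toSpanSingleton A U u).comp (dualForm f))
    exact ⟨a, fun x ↦ (ha x).symm⟩
  -- `m f u` is the element by which the endomorphism `x ↦ f x • u` is right multiplication
  choose m hm using hfull
  have hinj (a b : A) (hab : ∀ x : U, op a • x = op b • x) : a = b := by
    rw [← sub_eq_zero]
    refine h.faithful _ fun x ↦ ?_
    rw [MulOpposite.op_sub, sub_smul, hab, sub_self]
  let ev' : TensorOver U.dual U →ₗ[k] A := liftTensor m
    (fun f g u ↦ hinj _ _ fun x ↦ by
      rw [MulOpposite.op_add, add_smul, hm, hm, hm, dualForm_add, add_smul])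
    (fun f u u' ↦ hinj _ _ fun x ↦ by
      rw [MulOpposite.op_add, add_smul, hm, hm, hm, smul_add])
    (fun c f u ↦ hinj _ _ fun x ↦ by
      rw [MulOpposite.op_smul, smul_assoc, hm, hm, dualForm_baseSMul, smul_assoc])
    (fun f a u ↦ hinj _ _ fun x ↦ by
      rw [hm, hm, dualForm_right, mul_smul])
  have hev' (f : U.dual) (u x : U) : op (ev' (tmul f u)) • x = dualForm f x • u := hm f u x
  have hev'm (f : U.dual) (u : U) : ev' (tmul f u) = m f u := rfl
  have hmr (f : U.dual) (u : U) (b : A) : m f (op b • u) = m f u * b := by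
    refine hinj _ _ fun x ↦ ?_
    rw [hm, MulOpposite.op_mul, mul_smul, hm, smul_comm]
  have hml (f : U.dual) (u : U) (a : A) : m (a • f) u = a * m f u := by
    refine hinj _ _ fun x ↦ ?_
    rw [hm, MulOpposite.op_mul, mul_smul, hm, dualForm_left]
  have hevs : Function.Surjective (evalDual U) := by
    intro a
    suffices h' : ∀ b ∈ AddSubgroup.closure {b : A | ∃ (f : U →ₗ[A] A) (u : U), f u = b},
        ∃ t, evalDual U t = a * b by
      simpa using h' 1 h.generator
    intro b hb
    induction hb using AddSubgroup.closure_induction with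
    | mem b hb =>
      obtain ⟨f, u, rfl⟩ := hb
      exact ⟨tmul (a • u) f, map_smul f a u⟩
    | zero => exact ⟨0, by simp⟩
    | add b c _ _ hb hc =>
      obtain ⟨t, ht⟩ := hb
      obtain ⟨s, hs⟩ := hc
      exact ⟨t + s, by rw [map_add, ht, hs, mul_add]⟩
    | neg b _ hb =>
      obtain ⟨t, ht⟩ := hb
      exact ⟨-t, by rw [map_neg, ht, mul_neg]⟩
  have hev's : Function.Surjective ev' := by
    intro a
    suffices h' : ∀ g ∈ AddSubgroup.closure {g : U →ₗ[A] U | ∃ (f : U →ₗ[A] A) (w : U),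
        ∀ x, g x = f x • w}, ∃ t, ∀ x, op (ev' t) • x = op a • g x by
      obtain ⟨t, ht⟩ := h' _ h.dualBasis
      exact ⟨t, hinj _ _ ht⟩
    intro g hg
    induction hg using AddSubgroup.closure_induction with
    | mem g hg =>
      obtain ⟨f, w, hf⟩ := hg
      obtain ⟨f, rfl⟩ : ∃ f' : U.dual, dualForm f' = f := ⟨f, rfl⟩
      exact ⟨tmul f (op a • w), fun x ↦ by rw [hev', hf, smul_comm]⟩
    | zero => exact ⟨0, by simp⟩
    | add b c _ _ hb hc =>
      obtain ⟨t, ht⟩ := hb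
      obtain ⟨s, hs⟩ := hc
      exact ⟨t + s, fun x ↦ by
        rw [map_add, MulOpposite.op_add, add_smul, ht, hs, LinearMap.add_apply, smul_add]⟩
    | neg b _ hb =>
      obtain ⟨t, ht⟩ := hb
      exact ⟨-t, fun x ↦ by
        rw [map_neg, MulOpposite.op_neg, neg_smul, ht, LinearMap.neg_apply, smul_neg]⟩
  have h1 : Function.Injective (evalDual U) := by
    refine injective_of_associative _ hevs fun x g u f ↦ ?_
    have : op (dualForm f u) • g = m g u • f := dualForm_ext fun y ↦ by
      rw [dualForm_right, dualForm_left, hm, map_smul, smul_eq_mul]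
    rw [evalDual_tmul, evalDual_tmul, this, ← op_smul_tmul, hm]
  have h2 : Function.Injective ev' := by
    refine injective_of_associative _ hev's fun g y f u ↦ ?_
    have : op (dualForm f y) • g = m g y • f := dualForm_ext fun x ↦ by
      rw [dualForm_right, dualForm_left, hm, map_smul, smul_eq_mul]
    rw [hev', ← op_smul_tmul, this, hev'm]
  exact ⟨⟨LinearEquiv.ofBijective _ ⟨h1, hevs⟩, fun a u f ↦ map_smul (dualForm f) a u,
      fun _ _ _ ↦ rfl⟩,
    ⟨LinearEquiv.ofBijective _ ⟨h2, hev's⟩, fun a f u ↦ hml f u a, fun b f u ↦ hmr f u b⟩,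
    fun _ _ ↦ rfl, hev'⟩

theorem isInvertible_of_isBalancedProgenerator (h : IsBalancedProgenerator A U) :
    U.IsInvertible := by
  obtain ⟨e, e', -⟩ := exists_tensorIso_dual h
  exact ⟨U.dual, ⟨e⟩, ⟨e'⟩⟩

end CentralBimodule

end TwistedCY

/-! ### Modules over a base change of rings -/

namespace TwistedCY

section Contract

variable {k K : Type*} [Field k] [Field K] [Algebra k K]

/-- A linear form on `K`, applied to the first factor of `K ⊗ M`. -/
def contract (M : Type*) [AddCommGroup M] [Module k M] (l : K →ₗ[k] k) : K ⊗[k] M →ₗ[k] M :=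
  (TensorProduct.lid k M).toLinearMap ∘ₗ l.rTensor M

variable {M : Type*} [AddCommGroup M] [Module k M]

theorem contract_tmul (l : K →ₗ[k] k) (c : K) (m : M) : contract M l (c ⊗ₜ m) = l c • m := by
  simp [contract]

variable (k K) in
theorem exists_retraction : ∃ l : K →ₗ[k] k, l 1 = 1 := by
  obtain ⟨l, hl⟩ := (Algebra.linearMap k K).exists_leftInverse_of_injective
    (LinearMap.ker_eq_bot.2 (algebraMap k K).injective)
  exact ⟨l, by simpa using LinearMap.congr_fun hl 1⟩

theorem contract_one_tmul {l : K →ₗ[k] k} (hl : l 1 = 1) (m : M) :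
    contract M l (1 ⊗ₜ m) = m := by
  rw [contract_tmul, hl, one_smul]

theorem eq_zero_of_contract {y : K ⊗[k] M} (h : ∀ l : K →ₗ[k] k, contract M l y = 0) :
    y = 0 := by
  classical
  let b := Module.Basis.ofVectorSpace k K
  apply (TensorProduct.equivFinsuppOfBasisLeft b).injective
  rw [map_zero]
  ext i
  rw [Finsupp.zero_apply, ← h (b.coord i)]
  clear h
  induction y using TensorProduct.induction_on with
  | zero => simp
  | add x y hx hy => rw [map_add, map_add, Finsupp.add_apply, hx, hy]
  | tmul c m => simp [contract_tmul]

end Contract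

/-- The ring `S` is the base change to `K` of the `k`-algebra `R`, through `θ`, and the `S`-module
`N` is the base change of the `R`-module `M`, through `T`. -/
structure IsModuleBaseChange {k K R S M N : Type*} [Field k] [Field K] [Algebra k K] [Ring R]
    [Algebra k R] [Ring S] [AddCommGroup M] [Module k M] [Module R M]
    [AddCommGroup N] [Module S N] (θ : K ⊗[k] R ≃+* S) (T : K ⊗[k] M ≃+ N) : Prop where
  smul : ∀ (c c' : K) (r : R) (m : M), θ (c ⊗ₜ r) • T (c' ⊗ₜ m) = T ((c * c') ⊗ₜ (r • m))

namespace IsModuleBaseChange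

variable {k K R S M N M' N' : Type*} [Field k] [Field K] [Algebra k K] [Ring R]
  [Algebra k R] [Ring S] [AddCommGroup M] [Module k M] [Module R M]
  [AddCommGroup N] [Module S N]
  [AddCommGroup M'] [Module k M'] [Module R M']
  [AddCommGroup N'] [Module S N']
  {θ : K ⊗[k] R ≃+* S} {T : K ⊗[k] M ≃+ N} {T' : K ⊗[k] M' ≃+ N'}

theorem ring (θ : K ⊗[k] R ≃+* S) : IsModuleBaseChange (k := k) (R := R) θ θ.toAddEquiv where
  smul c c' r r' := by
    change θ _ * θ _ = θ _
    rw [← map_mul, Algebra.TensorProduct.tmul_mul_tmul]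
    rfl

theorem induction (T : K ⊗[k] M ≃+ N) {p : N → Prop} (y : N) (h0 : p 0)
    (ht : ∀ c m, p (T (c ⊗ₜ m))) (ha : ∀ x y, p x → p y → p (x + y)) : p y := by
  obtain ⟨y, rfl⟩ := T.surjective y
  induction y using TensorProduct.induction_on with
  | zero => rwa [map_zero]
  | tmul c m => exact ht c m
  | add x y hx hy => rw [map_add]; exact ha _ _ hx hy

theorem smul_one_tmul (h : IsModuleBaseChange θ T) (c : K) (r : R) (m : M) :
    θ (c ⊗ₜ r) • T (1 ⊗ₜ m) = T (c ⊗ₜ (r • m)) := by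
  rw [h.smul, mul_one]

theorem eq_smul (h : IsModuleBaseChange θ T) (c : K) (m : M) :
    T (c ⊗ₜ m) = θ (c ⊗ₜ 1) • T (1 ⊗ₜ m) := by
  rw [h.smul_one_tmul, one_smul]

/-- Linear maps out of a base change are determined by the elements `1 ⊗ m`. -/
theorem hom_ext (h : IsModuleBaseChange θ T) {f g : N →ₗ[S] N'}
    (hfg : ∀ m, f (T (1 ⊗ₜ m)) = g (T (1 ⊗ₜ m))) : f = g := by
  ext y
  induction y using induction T with
  | h0 => simp
  | ht c m => rw [h.eq_smul, map_smul, map_smul, hfg]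
  | ha x y hx hy => rw [map_add, map_add, hx, hy]

theorem map_smul_of_tmul (h : IsModuleBaseChange θ T) (f : N →+ N')
    (hf : ∀ c c' r m, f (T ((c * c') ⊗ₜ (r • m))) = θ (c ⊗ₜ r) • f (T (c' ⊗ₜ m)))
    (s : S) (y : N) : f (s • y) = s • f y := by
  induction s using induction θ.toAddEquiv with
  | h0 => simp
  | ha s t hs ht => rw [add_smul, map_add, hs, ht, add_smul]
  | ht c r =>
    change f (θ (c ⊗ₜ r) • y) = θ (c ⊗ₜ r) • f y
    induction y using induction T with
    | h0 => simp
    | ha x y hx hy => rw [smul_add, map_add, hx, hy, map_add, smul_add]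
    | ht c' m => rw [h.smul, hf]

variable [IsScalarTower k R M] [IsScalarTower k R M']

/-- The base change of a linear map. -/
def map (h : IsModuleBaseChange θ T) (h' : IsModuleBaseChange θ T') (f : M →ₗ[R] M') :
    N →ₗ[S] N' where
  toFun y := T' ((f.restrictScalars k).lTensor K (T.symm y))
  map_add' x y := by rw [map_add, map_add, map_add]
  map_smul' := h.map_smul_of_tmul
    (T'.toAddMonoidHom.comp (((f.restrictScalars k).lTensor K).toAddMonoidHom.comp
      T.symm.toAddMonoidHom)) fun c c' r m ↦ by
        change T' (LinearMap.lTensor K _ (T.symm (T _))) =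
          _ • T' (LinearMap.lTensor K _ (T.symm (T _)))
        rw [T.symm_apply_apply, T.symm_apply_apply, LinearMap.lTensor_tmul, LinearMap.lTensor_tmul,
          h'.smul]
        exact congrArg (fun z ↦ T' (_ ⊗ₜ z)) (map_smul f r m)

theorem map_apply (h : IsModuleBaseChange θ T) (h' : IsModuleBaseChange θ T') (f : M →ₗ[R] M')
    (y : K ⊗[k] M) : h.map h' f (T y) = T' ((f.restrictScalars k).lTensor K y) := by
  change T' (LinearMap.lTensor K _ (T.symm (T _))) = _
  rw [T.symm_apply_apply]

theorem map_tmul (h : IsModuleBaseChange θ T) (h' : IsModuleBaseChange θ T') (f : M →ₗ[R] M')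
    (c : K) (m : M) : h.map h' f (T (c ⊗ₜ m)) = T' (c ⊗ₜ f m) :=
  h.map_apply h' f _

theorem contract_smul (h : IsModuleBaseChange θ T) (l : K →ₗ[k] k) (r : R) (y : N) :
    contract M l (T.symm (θ (1 ⊗ₜ r) • y)) = r • contract M l (T.symm y) := by
  induction y using induction T with
  | h0 => simp
  | ht c m =>
    rw [h.smul, T.symm_apply_apply, T.symm_apply_apply, contract_tmul, contract_tmul, one_mul]
    exact (smul_algebra_smul_comm _ _ _).symm
  | ha x y hx hy => simp only [smul_add, map_add, hx, hy]

theorem contract_smul_one_tmul (h : IsModuleBaseChange θ T) (l : K →ₗ[k] k) (s : S) (m : M) :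
    contract M l (T.symm (s • T (1 ⊗ₜ m))) = contract R l (θ.symm s) • m := by
  induction s using induction θ.toAddEquiv with
  | h0 => simp
  | ht c r =>
    change contract M l (T.symm (θ (c ⊗ₜ r) • T (1 ⊗ₜ m))) = contract R l (θ.symm (θ _)) • m
    rw [h.smul_one_tmul, T.symm_apply_apply, θ.symm_apply_apply, contract_tmul, contract_tmul,
      smul_assoc]
  | ha x y hx hy => simp only [add_smul, map_add, hx, hy]

/-- The restriction of a linear map to the elements `1 ⊗ m`, followed by a contraction. -/
def descend (h : IsModuleBaseChange θ T) (h' : IsModuleBaseChange θ T') (l : K →ₗ[k] k)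
    (f : N →ₗ[S] N') : M →ₗ[R] M' where
  toFun m := contract M' l (T'.symm (f (T (1 ⊗ₜ m))))
  map_add' x y := by rw [TensorProduct.tmul_add, map_add, map_add, map_add, map_add]
  map_smul' r m := by
    rw [← h.smul_one_tmul, map_smul, h'.contract_smul, RingHom.id_apply]

theorem descend_apply (h : IsModuleBaseChange θ T) (h' : IsModuleBaseChange θ T')
    (l : K →ₗ[k] k) (f : N →ₗ[S] N') (m : M) :
    h.descend h' l f m = contract M' l (T'.symm (f (T (1 ⊗ₜ m)))) := rfl

/-- The linear form `m ↦ l (f (1 ⊗ m) c)` on `M`, where `f` is a linear form on its base change,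
`c ∈ K`, and `l` is a linear form on `K`. -/
def descendForm (h : IsModuleBaseChange θ T) (l : K →ₗ[k] k) (f : N →ₗ[S] S) (c : K) :
    M →ₗ[R] R :=
  h.descend (ring θ) l ((LinearMap.toSpanSingleton S S (θ (c ⊗ₜ 1))).comp f)

theorem descendForm_apply (h : IsModuleBaseChange θ T) (l : K →ₗ[k] k) (f : N →ₗ[S] S) (c : K)
    (m : M) : h.descendForm l f c m = contract R l (θ.symm (f (T (1 ⊗ₜ m)) * θ (c ⊗ₜ 1))) := rfl

/-- A linear form on the base change sends `c ⊗ m` to `f (1 ⊗ m) c`, as `c` is central. -/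
theorem form_tmul (h : IsModuleBaseChange θ T) (f : N →ₗ[S] S) (c : K) (m : M) :
    f (T (c ⊗ₜ m)) = f (T (1 ⊗ₜ m)) * θ (c ⊗ₜ 1) := by
  have hc (s : S) : θ (c ⊗ₜ 1) * s = s * θ (c ⊗ₜ 1) := by
    induction s using induction θ.toAddEquiv with
    | h0 => simp
    | ha s t hs ht => rw [mul_add, add_mul, hs, ht]
    | ht c' r =>
      change θ _ * θ _ = θ _ * θ _
      rw [← map_mul, ← map_mul, Algebra.TensorProduct.tmul_mul_tmul,
        Algebra.TensorProduct.tmul_mul_tmul, mul_comm]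
      simp
  rw [h.eq_smul, map_smul, smul_eq_mul, hc]

theorem hasDualBasis (h : IsModuleBaseChange θ T) (hM : HasDualBasis R M) :
    HasDualBasis S N := by
  let φ : (M →ₗ[R] M) →+ (N →ₗ[S] N) :=
    { toFun := h.map h
      map_zero' := h.hom_ext fun m ↦ by simp [map_tmul]
      map_add' f g := h.hom_ext fun m ↦ by simp [map_tmul, TensorProduct.tmul_add] }
  have hφ (f : M →ₗ[R] M) : φ f = h.map h f := rfl
  have hid : φ LinearMap.id = LinearMap.id := h.hom_ext fun m ↦ by simp [hφ, map_tmul]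
  rw [HasDualBasis, ← hid]
  refine (AddSubgroup.closure_le ((AddSubgroup.closure _).comap φ)).2 ?_ hM
  rintro g ⟨f, w, hf⟩
  refine AddSubgroup.subset_closure ⟨h.map (ring θ) f, T (1 ⊗ₜ w), fun x ↦ ?_⟩
  suffices φ g = (LinearMap.toSpanSingleton S N (T (1 ⊗ₜ w))).comp (h.map (ring θ) f) from
    LinearMap.congr_fun this x
  refine h.hom_ext fun m ↦ ?_
  rw [hφ, map_tmul, LinearMap.comp_apply, map_tmul, LinearMap.toSpanSingleton_apply, hf]
  exact (h.smul_one_tmul _ _ _).symm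

/-- A finite dual basis of the base change contracts to one of the module. -/
theorem hasDualBasis_of_baseChange (h : IsModuleBaseChange θ T) (hN : HasDualBasis S N) :
    HasDualBasis R M := by
  obtain ⟨l, hl⟩ := exists_retraction k K
  -- contraction maps `x ↦ f x • (c ⊗ w)` to `m ↦ l (f (1 ⊗ m) c) • w`
  let φ : (N →ₗ[S] N) →+ (M →ₗ[R] M) :=
    { toFun := h.descend h l
      map_zero' := LinearMap.ext fun m ↦ by simp [descend_apply]
      map_add' f g := LinearMap.ext fun m ↦ by simp [descend_apply] }
  have hφ (f : N →ₗ[S] N) (m : M) : φ f m = contract M l (T.symm (f (T (1 ⊗ₜ m)))) := rfl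
  have hid : φ LinearMap.id = LinearMap.id :=
    LinearMap.ext fun m ↦ by simp [hφ, contract_one_tmul hl]
  rw [HasDualBasis, ← hid]
  refine (AddSubgroup.closure_le ((AddSubgroup.closure _).comap φ)).2 ?_ hN
  rintro g ⟨f, w, hf⟩
  obtain rfl : g = (LinearMap.toSpanSingleton S N w).comp f := LinearMap.ext hf
  clear hf
  rw [SetLike.mem_coe, AddSubgroup.mem_comap]
  induction w using induction T with
  | h0 =>
    rw [show φ _ = 0 from LinearMap.ext fun m ↦ by simp]
    exact zero_mem _
  | ha x y hx hy =>
    rw [show φ ((LinearMap.toSpanSingleton S N (x + y)).comp f) =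
        φ ((LinearMap.toSpanSingleton S N x).comp f) +
          φ ((LinearMap.toSpanSingleton S N y).comp f) from LinearMap.ext fun m ↦ by simp [hφ]]
    exact add_mem hx hy
  | ht c w =>
    refine AddSubgroup.subset_closure ⟨h.descendForm l f c, w, fun x ↦ ?_⟩
    rw [hφ, descendForm_apply, ← h.contract_smul_one_tmul, LinearMap.comp_apply,
      LinearMap.toSpanSingleton_apply, h.eq_smul c w, mul_smul]

/-- Finite generation descends: the elements of `M` that occur in the generators of its base
change generate `M`. -/
theorem finite_of_baseChange (h : IsModuleBaseChange θ T) [hN : Module.Finite S N] :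
    Module.Finite R M := by
  obtain ⟨l, hl⟩ := exists_retraction k K
  obtain ⟨s, hs⟩ := hN.fg_top
  have hex (y : N) : ∃ t : Finset M, y ∈ Submodule.span S ((fun m ↦ T (1 ⊗ₜ m)) '' (t : Set M)) := by
    classical
    induction y using induction T with
    | h0 => exact ⟨∅, zero_mem _⟩
    | ht c m =>
      refine ⟨{m}, ?_⟩
      rw [h.eq_smul]
      exact Submodule.smul_mem _ _ (Submodule.subset_span ⟨m, by simp⟩)
    | ha x y hx hy =>
      obtain ⟨t, ht⟩ := hx
      obtain ⟨t', ht'⟩ := hy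
      refine ⟨t ∪ t', add_mem (Submodule.span_mono (Set.image_mono ?_) ht)
        (Submodule.span_mono (Set.image_mono ?_) ht')⟩ <;> simp
  choose t ht using hex
  classical
  refine ⟨⟨s.biUnion t, ?_⟩⟩
  rw [eq_top_iff]
  rintro m -
  have hm : T (1 ⊗ₜ m) ∈ Submodule.span S ((fun m ↦ T (1 ⊗ₜ m)) '' (s.biUnion t : Set M)) := by
    have : (⊤ : Submodule S N) ≤ _ := hs ▸ Submodule.span_le.2 fun y hy ↦
      Submodule.span_mono (Set.image_mono (t := (s.biUnion t : Set M)) (by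
        intro x hx
        simp only [Finset.coe_biUnion, Set.mem_iUnion]
        exact ⟨y, hy, hx⟩)) (ht y)
    exact this trivial
  -- contraction maps the `S`-span of the elements `1 ⊗ m` into the `R`-span of the elements `m`
  have key : ∀ y ∈ Submodule.span S ((fun m ↦ T (1 ⊗ₜ m)) '' (s.biUnion t : Set M)), ∀ a : S,
      contract M l (T.symm (a • y)) ∈ Submodule.span R (s.biUnion t : Set M) := by
    intro y hy
    induction hy using Submodule.span_induction with
    | mem y hy =>
      obtain ⟨m, hm, rfl⟩ := hy
      intro a
      rw [h.contract_smul_one_tmul]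
      exact Submodule.smul_mem _ _ (Submodule.subset_span hm)
    | zero => simp
    | add x y _ _ hx hy =>
      intro a
      rw [smul_add, map_add, map_add]
      exact add_mem (hx a) (hy a)
    | smul b y _ hy =>
      intro a
      rw [← mul_smul]
      exact hy _
  have := key _ hm 1
  rwa [one_smul, T.symm_apply_apply, contract_one_tmul hl] at this

end IsModuleBaseChange

section DualBasis

variable {R M : Type*} [Ring R] [AddCommGroup M] [Module R M]

theorem HasDualBasis.exists_sum (h : HasDualBasis R M) :
    ∃ (n : ℕ) (f : Fin n → M →ₗ[R] R) (w : Fin n → M), ∀ x, ∑ i, f i x • w i = x := by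
  suffices h' : ∀ g ∈ AddSubgroup.closure {g : M →ₗ[R] M | ∃ (f : M →ₗ[R] R) (w : M),
      ∀ x, g x = f x • w}, ∃ (n : ℕ) (f : Fin n → M →ₗ[R] R) (w : Fin n → M),
        ∀ x, ∑ i, f i x • w i = g x from h' _ h
  intro g hg
  induction hg using AddSubgroup.closure_induction with
  | mem g hg =>
    obtain ⟨f, w, hf⟩ := hg
    exact ⟨1, fun _ ↦ f, fun _ ↦ w, fun x ↦ by simp [hf]⟩
  | zero => exact ⟨0, Fin.elim0, Fin.elim0, fun x ↦ by simp⟩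
  | add g g' _ _ hg hg' =>
    obtain ⟨n, f, w, h⟩ := hg
    obtain ⟨n', f', w', h'⟩ := hg'
    exact ⟨n + n', Fin.append f f', Fin.append w w', fun x ↦ by
      simp [Fin.sum_univ_add, h, h']⟩
  | neg g _ hg =>
    obtain ⟨n, f, w, h⟩ := hg
    exact ⟨n, f, fun i ↦ -w i, fun x ↦ by simp [h]⟩

theorem HasDualBasis.finite_projective (h : HasDualBasis R M) :
    Module.Finite R M ∧ Module.Projective R M := by
  obtain ⟨n, f, w, h⟩ := h.exists_sum
  have hfw : Fintype.linearCombination R w ∘ₗ LinearMap.pi f = LinearMap.id := by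
    ext x
    simp [Fintype.linearCombination_apply, h]
  exact ⟨Module.Finite.of_surjective (Fintype.linearCombination R w)
    fun x ↦ ⟨_, LinearMap.congr_fun hfw x⟩, Module.Projective.of_split _ _ hfw⟩

theorem hasDualBasis_of_projective [Module.Finite R M] [Module.Projective R M] :
    HasDualBasis R M := by
  obtain ⟨n, f, g, -, -, hfg⟩ := Module.Finite.exists_comp_eq_id_of_projective R M
  have : LinearMap.id = ∑ i, (LinearMap.toSpanSingleton R M (f (Pi.single i 1))).comp
      ((LinearMap.proj i).comp g) := by
    ext x
    conv_lhs => rw [← hfg, LinearMap.comp_apply, ← Finset.univ_sum_single (g x), map_sum]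
    rw [LinearMap.sum_apply]
    refine Finset.sum_congr rfl fun i _ ↦ ?_
    rw [LinearMap.comp_apply, LinearMap.toSpanSingleton_apply, ← map_smul, ← Pi.single_smul,
      smul_eq_mul, mul_one]
    rfl
  rw [HasDualBasis, this]
  exact sum_mem fun i _ ↦ AddSubgroup.subset_closure
    ⟨(LinearMap.proj i).comp g, f (Pi.single i 1), fun x ↦ rfl⟩

end DualBasis

end TwistedCY

/-! ### Balanced progenerators and duals under extension of the ground field -/

namespace TwistedCY

section Bimodule

variable {k K A U N : Type*} [Field k] [Field K] [Algebra k K] [Ring A] [Algebra k A]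
  [AddCommGroup U] [Module k U] [Module A U] [Module Aᵐᵒᵖ U] [IsScalarTower k A U]
  [IsScalarTower k Aᵐᵒᵖ U]
  [AddCommGroup N] [Module (K ⊗[k] A) N] [Module (K ⊗[k] A)ᵐᵒᵖ N]
  [SMulCommClass (K ⊗[k] A) (K ⊗[k] A)ᵐᵒᵖ N] {T : K ⊗[k] U ≃+ N}

theorem contract_op_smul_one_tmul
    (hr : ∀ (c c' : K) (a : A) (x : U),
      op (c ⊗ₜ[k] a) • T (c' ⊗ₜ x) = T ((c * c') ⊗ₜ (op a • x)))
    (l : K →ₗ[k] k) (s : K ⊗[k] A) (x : U) :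
    contract U l (T.symm (op s • T (1 ⊗ₜ x))) = op (contract A l s) • x := by
  induction s using TensorProduct.induction_on with
  | zero => simp
  | tmul c a =>
    rw [hr, T.symm_apply_apply, contract_tmul, contract_tmul, mul_one, MulOpposite.op_smul,
      smul_assoc]
  | add x y hx hy => simp only [MulOpposite.op_add, add_smul, map_add, hx, hy]

/-- Being a balanced progenerator descends along an extension of the ground field: contract with
a retraction of `k → K`. -/
theorem IsBalancedProgenerator.of_baseChange (h : IsBalancedProgenerator (K ⊗[k] A) N)
    (hl : IsModuleBaseChange (RingEquiv.refl (K ⊗[k] A)) T)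
    (hr : ∀ (c c' : K) (a : A) (x : U),
      op (c ⊗ₜ[k] a) • T (c' ⊗ₜ x) = T ((c * c') ⊗ₜ (op a • x))) :
    IsBalancedProgenerator A U := by
  obtain ⟨l, hl1⟩ := exists_retraction k K
  refine ⟨?_, hl.hasDualBasis_of_baseChange h.dualBasis, fun a ha ↦ ?_, fun f ↦ ?_⟩
  · have h1 : (1 : A) = contract A l (1 : K ⊗[k] A) := (contract_one_tmul hl1 1).symm
    rw [h1]
    refine (AddSubgroup.closure_le ((AddSubgroup.closure _).comap
      (contract A l).toAddMonoidHom)).2 ?_ h.generator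
    rintro _ ⟨f, y, rfl⟩
    change contract A l (f y) ∈ AddSubgroup.closure _
    induction y using IsModuleBaseChange.induction T with
    | h0 => simp
    | ha x y hx hy => rw [map_add, map_add]; exact add_mem hx hy
    | ht c x =>
      refine AddSubgroup.subset_closure ⟨hl.descendForm l f c, x, ?_⟩
      rw [hl.form_tmul]
      rfl
  · have h1 : (1 ⊗ₜ a : K ⊗[k] A) = 0 := by
      refine h.faithful _ fun y ↦ ?_
      induction y using IsModuleBaseChange.induction T with
      | h0 => simp
      | ha x y hx hy => rw [smul_add, hx, hy, add_zero]
      | ht c x => rw [hr, ha, TensorProduct.tmul_zero, map_zero]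
    rw [← contract_one_tmul hl1 a, h1, map_zero]
  · obtain ⟨s, hs⟩ := h.full (hl.map hl f)
    refine ⟨contract A l s, fun x ↦ ?_⟩
    rw [← contract_op_smul_one_tmul hr, ← hs, hl.map_tmul hl, T.symm_apply_apply,
      contract_one_tmul hl1]

theorem IsBalancedProgenerator.baseChange (h : IsBalancedProgenerator A U)
    (hl : IsModuleBaseChange (RingEquiv.refl (K ⊗[k] A)) T)
    (hr : ∀ (c c' : K) (a : A) (x : U),
      op (c ⊗ₜ[k] a) • T (c' ⊗ₜ x) = T ((c * c') ⊗ₜ (op a • x))) :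
    IsBalancedProgenerator (K ⊗[k] A) N := by
  refine ⟨?_, hl.hasDualBasis h.dualBasis, fun s hs ↦ ?_, fun F ↦ ?_⟩
  · refine (AddSubgroup.closure_le ((AddSubgroup.closure _).comap
      (Algebra.TensorProduct.includeRight : A →ₐ[k] K ⊗[k] A).toRingHom.toAddMonoidHom)).2 ?_
        h.generator
    rintro _ ⟨f, u, rfl⟩
    exact AddSubgroup.subset_closure
      ⟨hl.map (IsModuleBaseChange.ring _) f, T (1 ⊗ₜ u), hl.map_tmul _ f 1 u⟩
  · refine eq_zero_of_contract fun l ↦ h.faithful _ fun x ↦ ?_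
    rw [← contract_op_smul_one_tmul hr, hs, map_zero, map_zero]
  -- an endomorphism `F` is determined on the elements `1 ⊗ x`; as the identity of `U` is a sum of
  -- maps `g = f(·) w`, it suffices to treat the maps `x ↦ F (1 ⊗ g x) = f x • F (1 ⊗ w)`
  · have key : ∀ g ∈ AddSubgroup.closure {g : U →ₗ[A] U | ∃ (f : U →ₗ[A] A) (w : U),
        ∀ x, g x = f x • w}, ∃ s : K ⊗[k] A, ∀ x, F (T (1 ⊗ₜ g x)) = op s • T (1 ⊗ₜ x) := by
      intro g hg
      induction hg using AddSubgroup.closure_induction with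
      | mem g hg =>
        obtain ⟨f, w, hf⟩ := hg
        have hF (x : U) : F (T (1 ⊗ₜ g x)) = ((1 : K) ⊗ₜ[k] f x) • F (T (1 ⊗ₜ w)) := by
          rw [hf, ← map_smul]
          exact congrArg F (hl.smul_one_tmul 1 (f x) w).symm
        simp only [hF]
        induction F (T (1 ⊗ₜ w)) using IsModuleBaseChange.induction T with
        | h0 => exact ⟨0, by simp⟩
        | ha y z hy hz =>
          obtain ⟨s, hs⟩ := hy
          obtain ⟨t, ht⟩ := hz
          exact ⟨s + t, fun x ↦ by rw [smul_add, hs, ht, MulOpposite.op_add, add_smul]⟩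
        | ht c z =>
          obtain ⟨a, ha⟩ := h.full ((LinearMap.toSpanSingleton A U z).comp f)
          refine ⟨c ⊗ₜ a, fun x ↦ ?_⟩
          rw [hr, mul_one, ← ha]
          refine (hl.smul 1 c (f x) z).trans ?_
          rw [one_mul]
          rfl
      | zero => exact ⟨0, by simp⟩
      | add f g _ _ hf hg =>
        obtain ⟨s, hs⟩ := hf
        obtain ⟨t, ht⟩ := hg
        exact ⟨s + t, fun x ↦ by
          rw [LinearMap.add_apply, TensorProduct.tmul_add, map_add, map_add, hs, ht,
            MulOpposite.op_add, add_smul]⟩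
      | neg g _ hg =>
        obtain ⟨t, ht⟩ := hg
        exact ⟨-t, fun x ↦ by
          rw [LinearMap.neg_apply, TensorProduct.tmul_neg, map_neg, map_neg, ht,
            MulOpposite.op_neg, neg_smul]⟩
    obtain ⟨s, hs⟩ := key _ h.dualBasis
    refine ⟨s, fun y ↦ ?_⟩
    let G : N →ₗ[K ⊗[k] A] N :=
      { toFun y := op s • y
        map_add' := smul_add _
        map_smul' b y := (smul_comm _ _ _).symm }
    exact LinearMap.congr_fun (hl.hom_ext (f := F) (g := G) hs) y

end Bimodule

namespace IsModuleBaseChange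

variable {k K R S M N M' N' : Type*} [Field k] [Field K] [Algebra k K] [Ring R]
  [Algebra k R] [Ring S] [AddCommGroup M] [Module k M] [Module R M] [IsScalarTower k R M]
  [AddCommGroup N] [Module S N]
  [AddCommGroup M'] [Module k M'] [Module R M'] [IsScalarTower k R M']
  [AddCommGroup N'] [Module S N']
  {θ : K ⊗[k] R ≃+* S} {T : K ⊗[k] M ≃+ N} {T' : K ⊗[k] M' ≃+ N'}

/-- The map `K ⊗ Hom(M, R) → Hom(N, S)`, where `N` and `S` are the base changes of `M` and `R`. -/
noncomputable def dualMap (h : IsModuleBaseChange θ T) : K ⊗[k] (M →ₗ[R] R) →+ (N →ₗ[S] S) :=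
  TensorProduct.liftAddHom
    { toFun c :=
        { toFun f := op (θ (c ⊗ₜ 1)) • h.map (ring θ) f
          map_zero' := h.hom_ext fun m ↦ by simp [map_tmul]
          map_add' f g := h.hom_ext fun m ↦ by
            simp [map_tmul, TensorProduct.tmul_add] }
      map_zero' := by
        ext f
        simp
      map_add' c c' := by
        ext f
        simp [TensorProduct.add_tmul, mul_add] }
    (fun a c f ↦ h.hom_ext fun m ↦ by
      simp only [AddMonoidHom.coe_mk, ZeroHom.coe_mk, LinearMap.smul_apply, op_smul_eq_mul]
      rw [map_tmul, map_tmul]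
      change θ _ * θ _ = θ _ * θ _
      rw [← map_mul, ← map_mul, Algebra.TensorProduct.tmul_mul_tmul,
        Algebra.TensorProduct.tmul_mul_tmul, one_mul, one_mul, mul_one, mul_one]
      exact congrArg θ (TensorProduct.smul_tmul a c (f m)))

theorem dualMap_tmul (h : IsModuleBaseChange θ T) (c : K) (f : M →ₗ[R] R) :
    h.dualMap (c ⊗ₜ f) = op (θ (c ⊗ₜ 1)) • h.map (ring θ) f := rfl

theorem dualMap_tmul_one_tmul (h : IsModuleBaseChange θ T) (c : K) (f : M →ₗ[R] R) (m : M) :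
    h.dualMap (c ⊗ₜ f) (T (1 ⊗ₜ m)) = θ (c ⊗ₜ f m) := by
  rw [dualMap_tmul, LinearMap.smul_apply, map_tmul, op_smul_eq_mul]
  change θ _ * θ _ = θ _
  rw [← map_mul, Algebra.TensorProduct.tmul_mul_tmul, mul_one, one_mul]

theorem dualMap_smul (h : IsModuleBaseChange θ T) (c c' : K) (r : R) (f : M →ₗ[R] R) :
    h.dualMap ((c * c') ⊗ₜ (op r • f)) = op (θ (c ⊗ₜ r)) • h.dualMap (c' ⊗ₜ f) := by
  refine h.hom_ext fun m ↦ ?_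
  rw [LinearMap.smul_apply, dualMap_tmul_one_tmul, dualMap_tmul_one_tmul, op_smul_eq_mul,
    ← map_mul, Algebra.TensorProduct.tmul_mul_tmul, mul_comm]
  rfl

theorem dualMap_comp (h : IsModuleBaseChange θ T) (h' : IsModuleBaseChange θ T')
    (g : M →ₗ[R] M') (δ : (M' →ₗ[R] R) →ₗ[k] (M →ₗ[R] R)) (hδ : ∀ f, δ f = f.comp g)
    (t : K ⊗[k] (M' →ₗ[R] R)) :
    h.dualMap (δ.lTensor K t) = (h'.dualMap t).comp (h.map h' g) := by
  induction t using TensorProduct.induction_on with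
  | zero => simp
  | add x y hx hy => rw [map_add, map_add, hx, hy, map_add, LinearMap.add_comp]
  | tmul c f =>
    refine h.hom_ext fun m ↦ ?_
    rw [LinearMap.lTensor_tmul, dualMap_tmul_one_tmul, LinearMap.comp_apply, map_tmul,
      dualMap_tmul_one_tmul, hδ]
    rfl

/-- For a module with a finite dual basis, forming the dual commutes with extension of the ground
field. -/
theorem dualMap_bijective (h : IsModuleBaseChange θ T) (hM : HasDualBasis R M) :
    Function.Bijective h.dualMap := by
  constructor
  · rw [injective_iff_map_eq_zero]
    intro t ht
    refine eq_zero_of_contract fun l ↦ LinearMap.ext fun m ↦ ?_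
    have key : contract _ l t m = contract R l (θ.symm (h.dualMap t (T (1 ⊗ₜ m)))) := by
      clear ht
      induction t using TensorProduct.induction_on with
      | zero => simp
      | add x y hx hy => simp only [map_add, LinearMap.add_apply, hx, hy]
      | tmul c f =>
        rw [dualMap_tmul_one_tmul, θ.symm_apply_apply, contract_tmul, contract_tmul]
        rfl
    rw [key, ht]
    simp
  · intro ψ
    -- the identity of `M` is a sum of maps `g = f(·) w`, so it suffices to find a preimage of the
    -- form `1 ⊗ m ↦ ψ (1 ⊗ g m) = f m • ψ (1 ⊗ w)`
    have key : ∀ g ∈ AddSubgroup.closure {g : M →ₗ[R] M | ∃ (f : M →ₗ[R] R) (w : M),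
        ∀ x, g x = f x • w}, ∃ t, ∀ m, h.dualMap t (T (1 ⊗ₜ m)) = ψ (T (1 ⊗ₜ g m)) := by
      intro g hg
      induction hg using AddSubgroup.closure_induction with
      | mem g hg =>
        obtain ⟨f, w, hf⟩ := hg
        have hF (x : M) : ψ (T (1 ⊗ₜ g x)) = θ (1 ⊗ₜ f x) * ψ (T (1 ⊗ₜ w)) := by
          rw [hf, ← smul_eq_mul, ← map_smul]
          exact congrArg ψ (h.smul_one_tmul 1 (f x) w).symm
        simp only [hF]
        induction ψ (T (1 ⊗ₜ w)) using IsModuleBaseChange.induction θ.toAddEquiv with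
        | h0 => exact ⟨0, by simp⟩
        | ha y z hy hz =>
          obtain ⟨s, hs⟩ := hy
          obtain ⟨t, ht⟩ := hz
          exact ⟨s + t, fun x ↦ by rw [mul_add, ← hs, ← ht, map_add, LinearMap.add_apply]⟩
        | ht c r =>
          refine ⟨c ⊗ₜ (op r • f), fun x ↦ ?_⟩
          change _ = θ _ * θ _
          rw [dualMap_tmul_one_tmul, ← map_mul, Algebra.TensorProduct.tmul_mul_tmul, one_mul]
          rfl
      | zero => exact ⟨0, by simp⟩
      | add f g _ _ hf hg =>
        obtain ⟨s, hs⟩ := hf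
        obtain ⟨t, ht⟩ := hg
        exact ⟨s + t, fun x ↦ by
          rw [map_add, LinearMap.add_apply, hs, ht, LinearMap.add_apply, TensorProduct.tmul_add,
            map_add, map_add]⟩
      | neg g _ hg =>
        obtain ⟨t, ht⟩ := hg
        exact ⟨-t, fun x ↦ by
          rw [map_neg, LinearMap.neg_apply, ht, LinearMap.neg_apply, TensorProduct.tmul_neg,
            map_neg, map_neg]⟩
    obtain ⟨t, ht⟩ := key _ hM
    exact ⟨t, h.hom_ext ht⟩

end IsModuleBaseChange

/-- Cohomology at the middle of a complex commutes with extension of the ground field, for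
cohomology groups `E` and `E'` presented as quotients of the groups of cocycles. -/
theorem exists_cohomology_baseChange {k K C₀ C₁ C₂ D₀ D₁ D₂ E E' : Type*} [Field k] [Field K]
    [Algebra k K] [AddCommGroup C₀] [Module k C₀] [AddCommGroup C₁] [Module k C₁]
    [AddCommGroup C₂] [Module k C₂] [AddCommGroup E] [Module k E] [AddCommGroup D₀]
    [AddCommGroup D₁] [AddCommGroup D₂] [AddCommGroup E'] (f : C₀ →ₗ[k] C₁) (g : C₁ →ₗ[k] C₂)
    (hgf : ∀ y, g (f y) = 0)
    (z : LinearMap.ker g →ₗ[k] E) (hz : Function.Surjective z)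
    (hz0 : ∀ x, z x = 0 ↔ ∃ y, f y = x)
    (f' : D₀ →+ D₁) (g' : D₁ →+ D₂) (z' : g'.ker →+ E') (hz' : Function.Surjective z')
    (hz0' : ∀ x, z' x = 0 ↔ ∃ y, f' y = x)
    (b₀ : K ⊗[k] C₀ →+ D₀) (b₁ : K ⊗[k] C₁ →+ D₁) (b₂ : K ⊗[k] C₂ →+ D₂)
    (hb₀ : Function.Surjective b₀) (hb₁ : Function.Bijective b₁) (hb₂ : Function.Injective b₂)
    (hf : ∀ t, b₁ (f.lTensor K t) = f' (b₀ t)) (hg : ∀ t, b₂ (g.lTensor K t) = g' (b₁ t)) :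
    ∃ e : K ⊗[k] E ≃+ E', ∀ (c : K) (x : LinearMap.ker g) (y : g'.ker), b₁ (c ⊗ₜ x.1) = y →
      e (c ⊗ₜ z x) = z' y := by
  let ι := (LinearMap.ker g).subtype.lTensor K
  have hι : Function.Injective ι :=
    Module.Flat.lTensor_preserves_injective_linearMap _ (Submodule.subtype_injective _)
  have hex : Function.Exact ι (g.lTensor K) :=
    Module.Flat.lTensor_exact K (LinearMap.exact_subtype_ker_map g)
  have hk (t : K ⊗[k] LinearMap.ker g) : b₁ (ι t) ∈ g'.ker := by
    rw [AddMonoidHom.mem_ker, ← hg, (hex _).2 ⟨t, rfl⟩, map_zero]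
  let q : K ⊗[k] LinearMap.ker g →+ E' :=
    z'.comp ((b₁.comp ι.toAddMonoidHom).codRestrict g'.ker hk)
  have hq (t) : q t = z' ⟨b₁ (ι t), hk t⟩ := rfl
  have hqs : Function.Surjective q := by
    intro x
    obtain ⟨⟨y, hy⟩, rfl⟩ := hz' x
    obtain ⟨t, rfl⟩ := hb₁.2 y
    rw [AddMonoidHom.mem_ker, ← hg] at hy
    obtain ⟨t, rfl⟩ := (hex t).1 (hb₂ (hy.trans (map_zero b₂).symm))
    exact ⟨t, rfl⟩
  let F : C₀ →ₗ[k] LinearMap.ker g := f.codRestrict _ hgf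
  have hιF (t) : ι (F.lTensor K t) = f.lTensor K t := by
    rw [← LinearMap.comp_apply, ← LinearMap.lTensor_comp]
    rfl
  have hFz : Function.Exact (F.lTensor K) (z.lTensor K) := by
    refine lTensor_exact K (fun x ↦ (hz0 x).trans ?_) hz
    exact ⟨fun ⟨y, hy⟩ ↦ ⟨y, Subtype.ext hy⟩, fun ⟨y, hy⟩ ↦ ⟨y, congrArg Subtype.val hy⟩⟩
  have hker : (z.lTensor K).toAddMonoidHom.ker = q.ker := by
    ext t
    rw [AddMonoidHom.mem_ker, AddMonoidHom.mem_ker, hq, hz0']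
    refine (hFz t).trans ⟨?_, ?_⟩
    · rintro ⟨s, rfl⟩
      exact ⟨b₀ s, by rw [← hf, ← hιF]⟩
    · rintro ⟨y, hy⟩
      obtain ⟨s, rfl⟩ := hb₀ y
      exact ⟨s, hι (hb₁.1 (by rw [hιF, hf]; exact hy))⟩
  have hzs : Function.Surjective (z.lTensor K).toAddMonoidHom := LinearMap.lTensor_surjective K hz
  let e₁ := QuotientAddGroup.quotientKerEquivOfSurjective _ hzs
  let e₂ := QuotientAddGroup.quotientKerEquivOfSurjective _ hqs
  refine ⟨(e₁.symm.trans (QuotientAddGroup.quotientAddEquivOfEq hker)).trans e₂,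
    fun c x y hxy ↦ ?_⟩
  have h1 : e₁.symm (c ⊗ₜ z x) = QuotientAddGroup.mk (c ⊗ₜ x) := by
    rw [AddEquiv.symm_apply_eq]
    rfl
  rw [AddEquiv.trans_apply, AddEquiv.trans_apply, h1]
  exact congrArg z' (Subtype.ext hxy)

end TwistedCY

/-! ### Perfect resolutions and Ext -/

namespace TwistedCY

/-- A resolution `⋯ → X 1 → X 0 → M → 0` of finite length by finitely generated projective
modules. -/
structure PerfectResolution (R : Type u) [Ring R] (M : Type u) [AddCommGroup M] [Module R M] where
  X : ℕ → Type u
  [addCommGroup : ∀ n, AddCommGroup (X n)]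
  [module : ∀ n, Module R (X n)]
  [projective : ∀ n, Module.Projective R (X n)]
  [finite : ∀ n, Module.Finite R (X n)]
  bounded : ∃ N : ℕ, ∀ n, N < n → Subsingleton (X n)
  d : ∀ n, X (n + 1) →ₗ[R] X n
  ε : X 0 →ₗ[R] M
  ε_surjective : Function.Surjective ε
  exact_zero : Function.Exact (d 0) ε
  exact_succ : ∀ n, Function.Exact (d (n + 1)) (d n)

attribute [instance] PerfectResolution.addCommGroup PerfectResolution.module
  PerfectResolution.projective PerfectResolution.finite

/-- There are no coboundaries in degree zero. -/
theorem extMk_zero_eq_zero_iff {C : Type*} [Category C] [Abelian C] [HasExt.{w} C] {X Y : C}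
    (P : ProjectiveResolution X) (f : P.complex.X 0 ⟶ Y) (hf : P.complex.d 1 0 ≫ f = 0) :
    P.extMk f 1 rfl hf = 0 ↔ f = 0 := by
  simp only [← P.extEquivCohomologyClass.apply_eq_iff_eq,
    ProjectiveResolution.extEquivCohomologyClass_extMk,
    ProjectiveResolution.extEquivCohomologyClass_zero,
    CochainComplex.HomComplex.CohomologyClass.mk_eq_zero_iff]
  rw [CochainComplex.HomComplex.Cocycle.toSingleMk_mem_coboundaries_iff _ _ _ _ _ 1 (by simp)]
  have h0 : Limits.IsZero (P.cochainComplex.X 1) :=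
    CochainComplex.isZero_of_isStrictlyLE _ 0 _
  constructor
  · rintro ⟨g, hg⟩
    rw [h0.eq_of_src g 0, Limits.comp_zero] at hg
    rw [← cancel_epi (P.cochainComplexXIso (-(0 : ℕ)) 0 rfl).hom]
    simpa using hg.symm
  · rintro rfl
    exact ⟨0, by simp⟩

namespace PerfectResolution

variable {R : Type u} [Ring R] {M : Type u} [AddCommGroup M] [Module R M]

/-- The underlying chain complex of modules. -/
noncomputable def complex (P : PerfectResolution R M) : ChainComplex (ModuleCat.{u} R) ℕ :=
  ChainComplex.of (fun n ↦ ModuleCat.of R (P.X n)) (fun n ↦ ModuleCat.ofHom (P.d n)) fun n ↦ by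
    ext x
    exact (P.exact_succ n).apply_apply_eq_zero x

theorem complex_d (P : PerfectResolution R M) (n : ℕ) :
    P.complex.d (n + 1) n = ModuleCat.ofHom (P.d n) :=
  ChainComplex.of_d (fun n ↦ ModuleCat.of R (P.X n)) (fun n ↦ ModuleCat.ofHom (P.d n)) n

theorem complex_exactAt_succ (P : PerfectResolution R M) (n : ℕ) :
    P.complex.ExactAt (n + 1) := by
  rw [HomologicalComplex.exactAt_iff' _ (n + 1 + 1) (n + 1) n (by simp) (by simp),
    ShortComplex.ShortExact.moduleCat_exact_iff_function_exact]
  change Function.Exact (P.complex.d (n + 1 + 1) (n + 1)).hom (P.complex.d (n + 1) n).hom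
  rw [complex_d, complex_d]
  exact P.exact_succ n

/-- The augmentation of the underlying chain complex. -/
noncomputable def augmentation (P : PerfectResolution R M) :
    P.complex ⟶ (ChainComplex.single₀ (ModuleCat.{u} R)).obj (ModuleCat.of R M) :=
  (ChainComplex.toSingle₀Equiv P.complex (ModuleCat.of R M)).symm ⟨ModuleCat.ofHom P.ε, by
    rw [complex_d]
    ext x
    exact P.exact_zero.apply_apply_eq_zero x⟩

theorem augmentation_f_zero (P : PerfectResolution R M) :
    P.augmentation.f 0 = (ModuleCat.ofHom P.ε : P.complex.X 0 ⟶ ModuleCat.of R M) :=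
  ChainComplex.toSingle₀Equiv_symm_apply_f_zero _ _

/-- A perfect resolution as a projective resolution in the category of modules. -/
noncomputable def toProjectiveResolution (P : PerfectResolution R M) :
    ProjectiveResolution (ModuleCat.of R M) where
  complex := P.complex
  projective n := (IsProjective.iff_projective (R := R) (P.X n)).1 (P.projective n)
  π := P.augmentation
  quasiIso := ⟨fun n ↦ by
    cases n with
    | zero =>
      rw [ChainComplex.quasiIsoAt₀_iff, ShortComplex.quasiIso_iff_of_zeros']
      · refine (ShortComplex.exact_and_epi_g_iff_of_iso (S₂ := ShortComplex.mk
          (ModuleCat.ofHom (P.d 0)) (ModuleCat.ofHom P.ε) (by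
            ext x
            exact P.exact_zero.apply_apply_eq_zero x)) ?_).2 ⟨?_, ?_⟩
        · exact ShortComplex.isoMk (Iso.refl _) (Iso.refl _) (Iso.refl _)
            ((Category.id_comp _).trans
              ((P.complex_d 0).symm.trans (Category.comp_id _).symm))
            ((Category.id_comp _).trans
              (P.augmentation_f_zero.symm.trans (Category.comp_id _).symm))
        · rw [ShortComplex.ShortExact.moduleCat_exact_iff_function_exact]
          exact P.exact_zero
        · exact (ModuleCat.epi_iff_surjective _).2 P.ε_surjective
      all_goals rfl
    | succ n =>
      rw [quasiIsoAt_iff_exactAt']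
      · exact P.complex_exactAt_succ n
      · apply ChainComplex.exactAt_succ_single_obj⟩

/-- A projective resolution of finite length with finitely generated terms is perfect. -/
noncomputable def ofProjectiveResolution (P : ProjectiveResolution (ModuleCat.of R M))
    (hP : ∀ n, Module.Finite R (P.complex.X n))
    (hN : ∃ N : ℕ, ∀ n, N < n → Limits.IsZero (P.complex.X n)) : PerfectResolution R M where
  X n := P.complex.X n
  projective n := (IsProjective.iff_projective (R := R) (P.complex.X n)).2 (P.projective n)
  finite := hP
  bounded := hN.imp fun _ h n hn ↦ ModuleCat.subsingleton_of_isZero (h n hn)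
  d n := (P.complex.d (n + 1) n).hom
  ε := (P.π.f 0).hom
  ε_surjective := (ModuleCat.epi_iff_surjective (P.π.f 0)).1 inferInstance
  exact_zero := (ShortComplex.ShortExact.moduleCat_exact_iff_function_exact
    (ShortComplex.mk _ _ P.complex_d_comp_π_f_zero)).1
      (ShortComplex.exact_of_g_is_cokernel _ P.isColimitCokernelCofork)
  exact_succ n := (ShortComplex.ShortExact.moduleCat_exact_iff_function_exact _).1 (P.exact_succ n)

/-- The map `Hom(X n, R) → Hom(X (n + 1), R)` induced by the differential. -/
def dual (P : PerfectResolution R M) (n : ℕ) : (P.X n →ₗ[R] R) →ₗ[Rᵐᵒᵖ] (P.X (n + 1) →ₗ[R] R) where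
  toFun φ := φ.comp (P.d n)
  map_add' _ _ := rfl
  map_smul' _ _ := rfl

/-- A linear form on the `n`-th term, as a morphism of the category of modules. -/
def cochain (P : PerfectResolution R M) {n : ℕ} (φ : P.X n →ₗ[R] R) :
    P.toProjectiveResolution.complex.X n ⟶ ModuleCat.of R R := ModuleCat.ofHom φ

theorem d_comp_cochain (P : PerfectResolution R M) {n : ℕ} {φ : P.X n →ₗ[R] R}
    (hφ : φ ∈ LinearMap.ker (P.dual n)) :
    P.toProjectiveResolution.complex.d (n + 1) n ≫ P.cochain φ = 0 := by
  change P.complex.d (n + 1) n ≫ _ = 0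
  rw [complex_d]
  ext x
  exact LinearMap.congr_fun hφ x

/-- The class in `Ext` of a cocycle of the complex `Hom(X •, R)`. -/
noncomputable def extClass (P : PerfectResolution R M) (n : ℕ) :
    LinearMap.ker (P.dual n) →ₗ[Rᵐᵒᵖ] Ext (ModuleCat.of R M) (ModuleCat.of R R) n where
  toFun φ := P.toProjectiveResolution.extMk (P.cochain φ.1) (n + 1) rfl (P.d_comp_cochain φ.2)
  map_add' φ ψ := (P.toProjectiveResolution.add_extMk (P.cochain φ.1) (P.cochain ψ.1) (n + 1) rfl
    (P.d_comp_cochain φ.2) (P.d_comp_cochain ψ.2)).symm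
  map_smul' r φ := (P.toProjectiveResolution.extMk_comp_mk₀ (P.cochain φ.1) (n + 1) rfl
    (P.d_comp_cochain φ.2) (rightMul r.unop)).symm

theorem extClass_surjective (P : PerfectResolution R M) (n : ℕ) :
    Function.Surjective (P.extClass n) := by
  intro x
  obtain ⟨f, hf, rfl⟩ := P.toProjectiveResolution.extMk_surjective x (n + 1) rfl
  refine ⟨⟨f.hom, ?_⟩, rfl⟩
  change P.complex.d (n + 1) n ≫ f = 0 at hf
  rw [complex_d] at hf
  exact congrArg ModuleCat.Hom.hom hf

theorem extClass_zero_eq_zero_iff (P : PerfectResolution R M) (φ : LinearMap.ker (P.dual 0)) :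
    P.extClass 0 φ = 0 ↔ φ.1 = 0 := by
  refine (extMk_zero_eq_zero_iff P.toProjectiveResolution (P.cochain φ.1)
    (P.d_comp_cochain φ.2)).trans ⟨fun h ↦ ?_, fun h ↦ ?_⟩
  · exact congrArg ModuleCat.Hom.hom h
  · rw [h]
    rfl

theorem extClass_succ_eq_zero_iff (P : PerfectResolution R M) (n : ℕ)
    (φ : LinearMap.ker (P.dual (n + 1))) :
    P.extClass (n + 1) φ = 0 ↔ ∃ ψ, P.dual n ψ = φ.1 := by
  refine (P.toProjectiveResolution.extMk_eq_zero_iff (P.cochain φ.1) (n + 1 + 1) rfl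
    (P.d_comp_cochain φ.2) n rfl).trans ⟨?_, ?_⟩
  · rintro ⟨g, hg⟩
    change P.complex.d (n + 1) n ≫ g = _ at hg
    rw [complex_d] at hg
    exact ⟨g.hom, congrArg ModuleCat.Hom.hom hg⟩
  · rintro ⟨ψ, hψ⟩
    refine ⟨ModuleCat.ofHom ψ, ?_⟩
    change P.complex.d (n + 1) n ≫ _ = _
    rw [complex_d, ← hψ]
    rfl

end PerfectResolution

end TwistedCY

/-! ### Base change of perfect resolutions -/

namespace TwistedCY

section BaseChangeModule

variable {k K R S : Type*} [Field k] [Field K] [Algebra k K] [Ring R]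
  [Algebra k R] [Ring S] (θ : K ⊗[k] R ≃+* S) (M : Type*) [AddCommGroup M] [Module k M]
  [Module R M] [IsScalarTower k R M]

/-- The module structure of `K ⊗ M` over the ring `S ≅ K ⊗ R`. -/
@[reducible]
noncomputable def baseChangeModule : Module S (K ⊗[k] M) :=
  Module.compHom (K ⊗[k] M) (R := Module.End K (K ⊗[k] M))
    ((AlgHom.liftEquiv k K R (Module.End K (K ⊗[k] M))
      ((Module.End.baseChangeHom k K M).comp (Algebra.lsmul k k M))).toRingHom.comp
        θ.symm.toRingHom)

theorem isModuleBaseChange_baseChangeModule :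
    letI := baseChangeModule θ M
    IsModuleBaseChange θ (AddEquiv.refl (K ⊗[k] M)) := by
  let := baseChangeModule θ M
  refine ⟨fun c c' r m ↦ ?_⟩
  change (AlgHom.liftEquiv k K R (Module.End K (K ⊗[k] M))
      ((Module.End.baseChangeHom k K M).comp (Algebra.lsmul k k M))) (θ.symm (θ (c ⊗ₜ r)))
        (c' ⊗ₜ m) = (c * c') ⊗ₜ (r • m)
  rw [θ.symm_apply_apply]
  simp only [AlgHom.liftEquiv, Equiv.coe_fn_mk]
  rw [AlgHom.ofLinearMap_apply, LinearMap.liftBaseChange_tmul]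
  change c • (c' ⊗ₜ[k] (r • m) : K ⊗[k] M) = _
  rw [TensorProduct.smul_tmul', smul_eq_mul]

end BaseChangeModule

namespace PerfectResolution

section

variable {k : Type v} {K : Type w} {R M : Type u} {S N : Type (max u w)} [Field k] [Field K]
  [Algebra k K] [Ring R] [Algebra k R] [Ring S] [AddCommGroup M] [Module k M] [Module R M]
  [IsScalarTower k R M] [AddCommGroup N] [Module S N]
  {θ : K ⊗[k] R ≃+* S} {T : K ⊗[k] M ≃+ N}

/-- The terms of a resolution over a `k`-algebra are `k`-modules. -/
@[reducible]
def baseModule (k : Type v) [Field k] [Algebra k R] (P : PerfectResolution R M) (n : ℕ) :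
    Module k (P.X n) := Module.restrictScalars k R (P.X n)

attribute [local instance] baseModule

theorem isScalarTower_baseModule (P : PerfectResolution R M) (n : ℕ) :
    IsScalarTower k R (P.X n) := IsScalarTower.restrictScalars k R (P.X n)

attribute [local instance] isScalarTower_baseModule

theorem exact_map {M₁ M₂ M₃ N₁ N₂ N₃ : Type*} [AddCommGroup M₁] [AddCommGroup M₂] [AddCommGroup M₃]
    [AddCommGroup N₁] [AddCommGroup N₂] [AddCommGroup N₃] [Module k M₁] [Module k M₂] [Module k M₃]
    [Module R M₁] [Module R M₂] [Module R M₃] [Module S N₁] [Module S N₂] [Module S N₃]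
    [IsScalarTower k R M₁] [IsScalarTower k R M₂] [IsScalarTower k R M₃] {T₁ : K ⊗[k] M₁ ≃+ N₁}
    {T₂ : K ⊗[k] M₂ ≃+ N₂} {T₃ : K ⊗[k] M₃ ≃+ N₃} (h₁ : IsModuleBaseChange θ T₁)
    (h₂ : IsModuleBaseChange θ T₂) (h₃ : IsModuleBaseChange θ T₃) {f : M₁ →ₗ[R] M₂}
    {g : M₂ →ₗ[R] M₃} (h : Function.Exact f g) : Function.Exact (h₁.map h₂ f) (h₂.map h₃ g) := by
  have hex : Function.Exact ((f.restrictScalars k).lTensor K) ((g.restrictScalars k).lTensor K) :=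
    Module.Flat.lTensor_exact K h
  intro y
  obtain ⟨y, rfl⟩ := T₂.surjective y
  rw [h₂.map_apply h₃, map_eq_zero_iff T₃ T₃.injective, hex y]
  constructor
  · rintro ⟨x, rfl⟩
    exact ⟨T₁ x, h₁.map_apply h₂ f x⟩
  · rintro ⟨x, hx⟩
    obtain ⟨x, rfl⟩ := T₁.surjective x
    rw [h₁.map_apply h₂] at hx
    exact ⟨x, T₂.injective hx⟩

/-- The base change of a perfect resolution. -/
noncomputable def baseChange (P : PerfectResolution R M) (h : IsModuleBaseChange θ T) :
    PerfectResolution S N :=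
  letI (n : ℕ) : Module S (K ⊗[k] P.X n) := baseChangeModule θ (P.X n)
  haveI hP (n : ℕ) : IsModuleBaseChange θ (AddEquiv.refl (K ⊗[k] P.X n)) :=
    isModuleBaseChange_baseChangeModule θ (P.X n)
  { X n := K ⊗[k] P.X n
    projective n := ((hP n).hasDualBasis hasDualBasis_of_projective).finite_projective.2
    finite n := ((hP n).hasDualBasis hasDualBasis_of_projective).finite_projective.1
    bounded := by
      obtain ⟨N, hN⟩ := P.bounded
      refine ⟨N, fun n hn ↦ ⟨fun x y ↦ ?_⟩⟩
      have := hN n hn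
      have h0 (z : K ⊗[k] P.X n) : z = 0 := by
        induction z using TensorProduct.induction_on with
        | zero => rfl
        | tmul c m => rw [Subsingleton.elim m 0, TensorProduct.tmul_zero]
        | add x y hx hy => rw [hx, hy, add_zero]
      rw [h0 x, h0 y]
    d n := (hP (n + 1)).map (hP n) (P.d n)
    ε := (hP 0).map h P.ε
    ε_surjective y := by
      obtain ⟨y, rfl⟩ := T.surjective y
      obtain ⟨x, rfl⟩ := LinearMap.lTensor_surjective K (g := P.ε.restrictScalars k)
        P.ε_surjective y
      exact ⟨x, (hP 0).map_apply h P.ε x⟩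
    exact_zero := exact_map _ _ _ P.exact_zero
    exact_succ n := exact_map _ _ _ (P.exact_succ n) }

theorem isModuleBaseChange (P : PerfectResolution R M) (h : IsModuleBaseChange θ T) (n : ℕ) :
    IsModuleBaseChange (N := (P.baseChange h).X n) θ (AddEquiv.refl (K ⊗[k] P.X n)) :=
  isModuleBaseChange_baseChangeModule θ (P.X n)

/-- The map induced by the differential on the dual complex, as a `k`-linear map. -/
def baseDual (k : Type v) [Field k] [Algebra k R] (P : PerfectResolution R M) (n : ℕ) :
    (P.X n →ₗ[R] R) →ₗ[k] (P.X (n + 1) →ₗ[R] R) where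
  toFun φ := φ.comp (P.d n)
  map_add' _ _ := rfl
  map_smul' _ _ := rfl

/-- `Ext(M, R)` commutes with extension of the ground field.  Here `E` is a copy of the Ext-group
over `R` that carries a `k`-module structure. -/
theorem exists_ext_baseChange (P : PerfectResolution R M) (h : IsModuleBaseChange θ T) (n : ℕ)
    {E : Type*} [AddCommGroup E] [Module k E]
    (f : Ext (ModuleCat.of R M) (ModuleCat.of R R) n ≃+ E)
    (hf : ∀ (c : k) x, f (op (algebraMap k R c) • x) = c • f x) :
    ∃ e : K ⊗[k] E ≃+ Ext (ModuleCat.of S N) (ModuleCat.of S S) n,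
      ∀ (c c' : K) (r : R) x,
        e ((c * c') ⊗ₜ f (op r • x)) = op (θ (c ⊗ₜ r)) • e (c' ⊗ₜ f x) := by
  let P' := P.baseChange h
  let b (m : ℕ) := (P.isModuleBaseChange h m).dualMap
  have hb (m : ℕ) : Function.Bijective (b m) :=
    (P.isModuleBaseChange h m).dualMap_bijective hasDualBasis_of_projective
  have hbd (m : ℕ) (t) : b (m + 1) ((P.baseDual k m).lTensor K t) = P'.dual m (b m t) :=
    (P.isModuleBaseChange h (m + 1)).dualMap_comp (P.isModuleBaseChange h m) (P.d m)
      (P.baseDual k m) (fun _ ↦ rfl) t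
  let z : LinearMap.ker (P.baseDual k n) →ₗ[k] E :=
    { toFun φ := f (P.extClass n ⟨φ.1, φ.2⟩)
      map_add' φ ψ := by
        rw [← map_add, ← map_add]
        rfl
      map_smul' c φ := by
        rw [RingHom.id_apply, ← hf, ← map_smul]
        congr 2
        refine Subtype.ext (LinearMap.ext fun x ↦ ?_)
        change c • φ.1 x = φ.1 x * algebraMap k R c
        rw [Algebra.smul_def, Algebra.commutes] }
  have hz : Function.Surjective z := fun x ↦ by
    obtain ⟨φ, hφ⟩ := P.extClass_surjective n (f.symm x)
    refine ⟨⟨φ.1, φ.2⟩, ?_⟩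
    change f (P.extClass n φ) = x
    rw [hφ, f.apply_symm_apply]
  have hz0 (φ) : z φ = 0 ↔ P.extClass n ⟨φ.1, φ.2⟩ = 0 := map_eq_zero_iff f f.injective
  let g' := (P'.dual n).toAddMonoidHom
  let z' : g'.ker →+ Ext (ModuleCat.of S N) (ModuleCat.of S S) n :=
    { toFun φ := P'.extClass n ⟨φ.1, φ.2⟩
      map_zero' := map_zero (P'.extClass n)
      map_add' φ ψ := map_add (P'.extClass n) _ _ }
  have hz' : Function.Surjective z' := fun x ↦ by
    obtain ⟨φ, hφ⟩ := P'.extClass_surjective n x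
    exact ⟨⟨φ.1, φ.2⟩, hφ⟩
  obtain ⟨e, he⟩ : ∃ e : K ⊗[k] E ≃+ Ext (ModuleCat.of S N) (ModuleCat.of S S) n,
      ∀ (c : K) (x : LinearMap.ker (P.baseDual k n)) (y : g'.ker), b n (c ⊗ₜ x.1) = y →
        e (c ⊗ₜ z x) = z' y := by
    cases n with
    -- the complex is extended by a zero map, as there are no coboundaries in degree zero
    | zero =>
      refine exists_cohomology_baseChange (0 : (P.X 0 →ₗ[R] R) →ₗ[k] (P.X 0 →ₗ[R] R))
        (P.baseDual k 0) (fun _ ↦ rfl) z hz (fun φ ↦ ?_) (0 : (P'.X 0 →ₗ[S] S) →+ _) g' z' hz'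
        (fun φ ↦ ?_) (b 0) (b 0) (b 1) (hb 0).2 (hb 0) (hb 1).1 (fun t ↦ ?_) (hbd 0)
      · rw [hz0, extClass_zero_eq_zero_iff]
        exact ⟨fun h0 ↦ ⟨0, h0.symm⟩, fun ⟨_, h0⟩ ↦ h0.symm⟩
      · refine (P'.extClass_zero_eq_zero_iff _).trans ?_
        exact ⟨fun h0 ↦ ⟨0, h0.symm⟩, fun ⟨_, h0⟩ ↦ h0.symm⟩
      · rw [LinearMap.lTensor_zero, LinearMap.zero_apply, map_zero]
        rfl
    | succ n =>
      refine exists_cohomology_baseChange (P.baseDual k n)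
        (P.baseDual k (n + 1)) (fun φ ↦ ?_) z hz (fun φ ↦ ?_) (P'.dual n).toAddMonoidHom g' z' hz'
        (fun φ ↦ ?_) (b n) (b (n + 1)) (b (n + 2)) (hb _).2 (hb _) (hb _).1 (hbd n) (hbd (n + 1))
      · ext x
        change φ (P.d n (P.d (n + 1) x)) = 0
        rw [(P.exact_succ n).apply_apply_eq_zero, map_zero]
      · rw [hz0, extClass_succ_eq_zero_iff]
        rfl
      · exact P'.extClass_succ_eq_zero_iff n _
  refine ⟨e, fun c c' r x ↦ ?_⟩
  obtain ⟨φ, rfl⟩ := P.extClass_surjective n x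
  have hker (c : K) (φ : LinearMap.ker (P.dual n)) : b n (c ⊗ₜ φ.1) ∈ g'.ker := by
    have h1 : P.baseDual k n φ.1 = 0 := φ.2
    rw [AddMonoidHom.mem_ker]
    change P'.dual n _ = 0
    rw [← hbd, LinearMap.lTensor_tmul, h1, TensorProduct.tmul_zero, map_zero]
  have key (c : K) (φ : LinearMap.ker (P.dual n)) :
      e (c ⊗ₜ f (P.extClass n φ)) = P'.extClass n ⟨b n (c ⊗ₜ φ.1), hker c φ⟩ :=
    he c ⟨φ.1, φ.2⟩ ⟨b n (c ⊗ₜ φ.1), hker c φ⟩ rfl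
  rw [← map_smul, key, key, ← map_smul]
  congr 1
  exact Subtype.ext ((P.isModuleBaseChange h n).dualMap_smul c c' r φ.1)

end

end PerfectResolution

end TwistedCY

/-! ### Extension of the ground field for twisted Calabi-Yau algebras -/

namespace TwistedCY

attribute [local instance] instModuleTensorProductMop

section Env

variable (k : Type v) (K : Type w) (A : Type u) [Field k] [Field K] [Algebra k K] [Ring A]
  [Algebra k A]

/-- `K ⊗ Aᵒᵖ ≅ (K ⊗ A)ᵒᵖ`. -/
noncomputable def opBaseChange : K ⊗[k] Aᵐᵒᵖ ≃ₐ[K] (K ⊗[k] A)ᵐᵒᵖ :=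
  (Algebra.TensorProduct.congr (AlgEquiv.toOpposite K K) AlgEquiv.refl).trans
    (Algebra.TensorProduct.opAlgEquiv k K K A)

theorem opBaseChange_tmul (c : K) (a : A) :
    opBaseChange k K A (c ⊗ₜ op a) = op (c ⊗ₜ a) := by
  simp [opBaseChange]

/-- Forming the enveloping algebra commutes with extension of the ground field. -/
noncomputable def envBaseChange : K ⊗[k] Env k A ≃+* Env K (K ⊗[k] A) :=
  (((Algebra.TensorProduct.congr (AlgEquiv.refl (R := K) (A₁ := K ⊗[k] A))
    (opBaseChange k K A).symm).trans
      ((Algebra.TensorProduct.tensorTensorTensorComm k k K K K A K Aᵐᵒᵖ).trans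
        (Algebra.TensorProduct.congr (Algebra.TensorProduct.lid K K) AlgEquiv.refl))).symm).toRingEquiv

theorem envBaseChange_tmul (c c' : K) (a b : A) :
    envBaseChange k K A ((c * c') ⊗ₜ (a ⊗ₜ op b)) = (c ⊗ₜ a) ⊗ₜ op (c' ⊗ₜ b) := by
  change AlgEquiv.symm _ _ = _
  rw [AlgEquiv.symm_apply_eq]
  have : (opBaseChange k K A).symm (op (c' ⊗ₜ b)) = c' ⊗ₜ op b := by
    rw [AlgEquiv.symm_apply_eq, opBaseChange_tmul]
  simp [this]

theorem isScalarTower_env : IsScalarTower k (Env k A) A := by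
  refine ⟨fun c r x ↦ ?_⟩
  induction r using TensorProduct.induction_on with
  | zero =>
    rw [smul_zero]
    exact (zero_smul (Env k A) x).trans
      ((smul_zero c).symm.trans (congrArg (c • ·) (zero_smul (Env k A) x).symm))
  | tmul a b =>
    rw [TensorProduct.smul_tmul', ← op_unop b, env_tmul_smul, env_tmul_smul, smul_mul_assoc,
      smul_mul_assoc]
  | add r s hr hs => rw [smul_add, add_smul, hr, hs, add_smul, smul_add]

attribute [local instance] isScalarTower_env

theorem isModuleBaseChange_env :
    IsModuleBaseChange (envBaseChange k K A) (AddEquiv.refl (K ⊗[k] A)) := by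
  refine ⟨fun c c' r m ↦ ?_⟩
  change envBaseChange k K A (c ⊗ₜ r) • (c' ⊗ₜ m : K ⊗[k] A) = (c * c') ⊗ₜ (r • m)
  induction r using TensorProduct.induction_on with
  | zero =>
    rw [TensorProduct.tmul_zero, map_zero]
    exact (zero_smul (Env K (K ⊗[k] A)) _).trans ((TensorProduct.tmul_zero A (c * c')).symm.trans
      (congrArg ((c * c') ⊗ₜ[k] ·) (zero_smul (Env k A) m).symm))
  | tmul a b =>
    have h := envBaseChange_tmul k K A c 1 a b.unop
    rw [mul_one, op_unop] at h
    rw [h, env_tmul_smul, Algebra.TensorProduct.tmul_mul_tmul,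
      Algebra.TensorProduct.tmul_mul_tmul, mul_one, ← op_unop b, env_tmul_smul, unop_op]
  | add r s hr hs =>
    rw [TensorProduct.tmul_add, map_add, add_smul, hr, hs, add_smul, TensorProduct.tmul_add]

theorem isHomologicallySmooth_iff :
    IsHomologicallySmooth k A ↔ Nonempty (PerfectResolution (Env k A) A) := by
  constructor
  · rintro ⟨P, h1, h2⟩
    exact ⟨PerfectResolution.ofProjectiveResolution P h1 h2⟩
  · rintro ⟨P⟩
    refine ⟨P.toProjectiveResolution, P.finite, P.bounded.imp fun N hN n hn ↦ ?_⟩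
    have := hN n hn
    exact ModuleCat.isZero_of_subsingleton (ModuleCat.of (Env k A) (P.X n))

end Env

section

variable {k : Type v} {K : Type w} {A : Type u} [Field k] [Field K] [Algebra k K] [Ring A]
  [Algebra k A]

theorem IsHomologicallySmooth.baseChange (h : IsHomologicallySmooth k A) :
    IsHomologicallySmooth K (K ⊗[k] A) := by
  rw [isHomologicallySmooth_iff] at h ⊢
  obtain ⟨P⟩ := h
  have := isScalarTower_env k A
  exact ⟨P.baseChange (isModuleBaseChange_env k K A)⟩

namespace CentralBimodule

variable (K) in
/-- The bimodule `K ⊗ U` over `K ⊗ A`. -/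
noncomputable def baseChange (U : CentralBimodule k A) : CentralBimodule K (K ⊗[k] A) :=
  letI : Module (K ⊗[k] A) (K ⊗[k] U) := baseChangeModule (RingEquiv.refl _) U
  letI : Module (K ⊗[k] A)ᵐᵒᵖ (K ⊗[k] U) := baseChangeModule (opBaseChange k K A).toRingEquiv U
  haveI hl (c c' : K) (a : A) (x : U) :
      (c ⊗ₜ a : K ⊗[k] A) • (c' ⊗ₜ x : K ⊗[k] U) = (c * c') ⊗ₜ (a • x) :=
    (isModuleBaseChange_baseChangeModule (RingEquiv.refl (K ⊗[k] A)) U).smul c c' a x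
  haveI hr (c c' : K) (a : A) (x : U) :
      op (c ⊗ₜ a : K ⊗[k] A) • (c' ⊗ₜ x : K ⊗[k] U) = (c * c') ⊗ₜ (op a • x) := by
    rw [← opBaseChange_tmul]
    exact (isModuleBaseChange_baseChangeModule (opBaseChange k K A).toRingEquiv U).smul
      c c' (op a) x
  { carrier := K ⊗[k] U
    smulComm := ⟨fun s t y ↦ by
      induction t using MulOpposite.rec' with | _ t
      induction s using TensorProduct.induction_on with
      | zero => simp
      | add s s' hs hs' => rw [add_smul, add_smul, smul_add, hs, hs']
      | tmul c a =>
        induction t using TensorProduct.induction_on with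
        | zero => simp
        | add s s' hs hs' => rw [MulOpposite.op_add, add_smul, add_smul, smul_add, hs, hs']
        | tmul c' b =>
          induction y using TensorProduct.induction_on with
          | zero => simp
          | add s s' hs hs' => simp only [smul_add, hs, hs']
          | tmul c'' x => rw [hr, hl, hl, hr, smul_comm, mul_left_comm]⟩
    leftTower := ⟨fun c s y ↦ by
      induction s using TensorProduct.induction_on with
      | zero => simp
      | add s s' hs hs' => simp only [smul_add, add_smul, hs, hs']
      | tmul c' a =>
        induction y using TensorProduct.induction_on with
        | zero => simp
        | add s s' hs hs' => simp only [smul_add, hs, hs']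
        | tmul c'' x =>
          rw [TensorProduct.smul_tmul', hl, hl, TensorProduct.smul_tmul', smul_eq_mul, smul_eq_mul,
            mul_assoc]⟩
    rightTower := ⟨fun c t y ↦ by
      induction t using MulOpposite.rec' with | _ t
      rw [← MulOpposite.op_smul]
      induction t using TensorProduct.induction_on with
      | zero => simp
      | add s s' hs hs' => simp only [smul_add, add_smul, MulOpposite.op_add, hs, hs']
      | tmul c' a =>
        induction y using TensorProduct.induction_on with
        | zero => simp
        | add s s' hs hs' => simp only [smul_add, hs, hs']
        | tmul c'' x =>
          rw [TensorProduct.smul_tmul', hr, hr, TensorProduct.smul_tmul', smul_eq_mul, smul_eq_mul,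
            mul_assoc]⟩ }

/-- The identity map from `K ⊗ U` to the underlying group of the base change. -/
noncomputable def baseChangeEquiv (U : CentralBimodule k A) : K ⊗[k] U ≃+ U.baseChange K :=
  AddEquiv.refl _

theorem baseChange_left (U : CentralBimodule k A) :
    IsModuleBaseChange (RingEquiv.refl (K ⊗[k] A)) U.baseChangeEquiv :=
  isModuleBaseChange_baseChangeModule (RingEquiv.refl (K ⊗[k] A)) U

theorem baseChange_right (U : CentralBimodule k A) (c c' : K) (a : A) (x : U) :
    op (c ⊗ₜ[k] a) • U.baseChangeEquiv (c' ⊗ₜ x) =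
      U.baseChangeEquiv ((c * c') ⊗ₜ (op a • x)) := by
  rw [← opBaseChange_tmul]
  let : Module (K ⊗[k] A)ᵐᵒᵖ (K ⊗[k] U) := baseChangeModule (opBaseChange k K A).toRingEquiv U
  exact (isModuleBaseChange_baseChangeModule (opBaseChange k K A).toRingEquiv U).smul
    c c' (op a) x

theorem IsInvertible.baseChange {U : CentralBimodule k A} (h : U.IsInvertible) :
    (U.baseChange K).IsInvertible :=
  isInvertible_of_isBalancedProgenerator
    (h.isBalancedProgenerator.baseChange U.baseChange_left U.baseChange_right)

end CentralBimodule

/-- The Ext-groups of `A` over its enveloping algebra commute with extension of the ground field.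
Here `E` is a copy of the Ext-group over `k` that carries a `k`-module structure. -/
theorem PerfectResolution.exists_ext_env_baseChange (P : PerfectResolution (Env k A) A) (n : ℕ)
    {E : Type*} [AddCommGroup E] [Module k E]
    (f : Ext (ModuleCat.of (Env k A) A) (ModuleCat.of (Env k A) (Env k A)) n ≃+ E)
    (hf : ∀ (c : k) x, f (op (algebraMap k (Env k A) c) • x) = c • f x) :
    ∃ e : K ⊗[k] E ≃+ Ext (ModuleCat.of (Env K (K ⊗[k] A)) (K ⊗[k] A))
        (ModuleCat.of (Env K (K ⊗[k] A)) (Env K (K ⊗[k] A))) n,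
      ∀ (c₁ c₂ c₃ : K) (a b : A) x, e ((c₁ * c₂ * c₃) ⊗ₜ f (op (b ⊗ₜ op a : Env k A) • x)) =
        op ((c₁ ⊗ₜ b) ⊗ₜ op (c₂ ⊗ₜ a) : Env K (K ⊗[k] A)) • e (c₃ ⊗ₜ f x) := by
  have := isScalarTower_env k A
  obtain ⟨e, he⟩ := P.exists_ext_baseChange (isModuleBaseChange_env k K A) n f hf
  exact ⟨e, fun c₁ c₂ c₃ a b x ↦ by rw [he, envBaseChange_tmul]⟩

theorem CentralBimodule.EnvIso.map_algebraMap {E : Type u} [AddCommGroup E] [Module (Env k A)ᵐᵒᵖ E]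
    {U : CentralBimodule k A} (φ : CentralBimodule.EnvIso E U) (c : k) (x : E) :
    φ.equiv (op (algebraMap k (Env k A) c) • x) = c • φ.equiv x := by
  rw [Algebra.TensorProduct.algebraMap_apply, ← op_one, φ.map_smul, one_smul]
  exact algebraMap_smul Aᵐᵒᵖ c (φ.equiv x)

/-- The twisted Calabi-Yau property passes to `K ⊗ A`, with the bimodule `K ⊗ U`. -/
theorem IsTwistedCY.baseChange {d : ℕ} (h : IsTwistedCY k A d) :
    IsTwistedCY K (K ⊗[k] A) d := by
  obtain ⟨hs, U, hU, hv, ⟨φ⟩⟩ := h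
  obtain ⟨P⟩ := (isHomologicallySmooth_iff k A).1 hs
  refine ⟨hs.baseChange, U.baseChange K, hU.baseChange, fun i hi ↦ ?_, ⟨?_⟩⟩
  · have := hv i hi
    let : Module k (Ext (ModuleCat.of (Env k A) A) (ModuleCat.of (Env k A) (Env k A)) i) :=
      Module.restrictScalars k (Env k A)ᵐᵒᵖ _
    obtain ⟨e, -⟩ := P.exists_ext_env_baseChange (K := K) i (AddEquiv.refl _) (fun c x ↦ rfl)
    refine e.symm.toEquiv.subsingleton_congr.2 ⟨fun x y ↦ ?_⟩
    have h0 (z : K ⊗[k] Ext (ModuleCat.of (Env k A) A) (ModuleCat.of (Env k A) (Env k A)) i) :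
        z = 0 := by
      induction z using TensorProduct.induction_on with
      | zero => rfl
      | tmul c m => rw [Subsingleton.elim m 0, TensorProduct.tmul_zero]
      | add x y hx hy => rw [hx, hy, add_zero]
    rw [h0 x, h0 y]
  · have := P.exists_ext_env_baseChange (K := K) d φ.equiv φ.map_algebraMap
    choose e he using this
    refine ⟨e.symm.trans U.baseChangeEquiv, fun a b x ↦ ?_⟩
    obtain ⟨y, rfl⟩ := e.surjective x
    rw [AddEquiv.trans_apply, AddEquiv.trans_apply, e.symm_apply_apply]
    induction a using TensorProduct.induction_on with
    | zero =>
      simp only [MulOpposite.op_zero, TensorProduct.tmul_zero, zero_smul]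
      exact (congrArg _ (zero_smul (Env K (K ⊗[k] A))ᵐᵒᵖ (e y))).trans
          (map_zero (e.symm.trans U.baseChangeEquiv))
    | add a a' ha ha' =>
      rw [MulOpposite.op_add, TensorProduct.tmul_add, MulOpposite.op_add, add_smul, map_add,
        map_add, ha, ha', add_smul]
    | tmul c₂ a =>
      induction b using TensorProduct.induction_on with
      | zero =>
        simp only [MulOpposite.op_zero, TensorProduct.zero_tmul, zero_smul, smul_zero]
        exact (congrArg _ (zero_smul (Env K (K ⊗[k] A))ᵐᵒᵖ (e y))).trans
          (map_zero (e.symm.trans U.baseChangeEquiv))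
      | add b b' hb hb' =>
        rw [TensorProduct.add_tmul, MulOpposite.op_add, MulOpposite.op_add, add_smul, map_add,
          map_add, hb, hb', add_smul, smul_add]
      | tmul c₁ b =>
        induction y using TensorProduct.induction_on with
        | zero => simp
        | add y y' hy hy' => simp only [map_add, smul_add, hy, hy']
        | tmul c₃ u =>
          obtain ⟨u, rfl⟩ := φ.equiv.surjective u
          rw [← he, e.symm_apply_apply, U.baseChange_right]
          refine Eq.trans ?_ (U.baseChange_left.smul c₂ (c₁ * c₃) a _).symm
          rw [φ.map_smul, mul_left_comm, mul_assoc]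

end

end TwistedCY

/-! ### Homogeneous components -/

namespace TwistedCY

section Internal

variable {M : Type*} [AddCommGroup M] {D : ℤ → AddSubgroup M}

/-- The homogeneous component of degree `n` of an element of a graded abelian group. -/
noncomputable def homogeneousComponent (hD : DirectSum.IsInternal D) (n : ℤ) : M →+ M :=
  letI := hD.chooseDecomposition
  { toFun x := DirectSum.decompose D x n
    map_zero' := by simp
    map_add' x y := by simp [DirectSum.decompose_add] }

theorem homogeneousComponent_mem (hD : DirectSum.IsInternal D) (n : ℤ) (x : M) :
    homogeneousComponent hD n x ∈ D n :=
  letI := hD.chooseDecomposition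
  (DirectSum.decompose D x n).2

theorem homogeneousComponent_same (hD : DirectSum.IsInternal D) {n : ℤ} {x : M} (hx : x ∈ D n) :
    homogeneousComponent hD n x = x :=
  letI := hD.chooseDecomposition
  DirectSum.decompose_of_mem_same D hx

theorem homogeneousComponent_ne (hD : DirectSum.IsInternal D) {m n : ℤ} {x : M} (hx : x ∈ D m)
    (hmn : m ≠ n) : homogeneousComponent hD n x = 0 :=
  letI := hD.chooseDecomposition
  DirectSum.decompose_of_mem_ne D hx hmn

theorem exists_sum_homogeneousComponent (hD : DirectSum.IsInternal D) (x : M) :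
    ∃ s : Finset ℤ, x = ∑ n ∈ s, homogeneousComponent hD n x := by
  classical
  let := hD.chooseDecomposition
  exact ⟨_, (DirectSum.sum_support_decompose D x).symm⟩

theorem exists_homogeneousComponent_eq_zero (hD : DirectSum.IsInternal D) (x : M) :
    ∃ s : Finset ℤ, ∀ n ∉ s, homogeneousComponent hD n x = 0 := by
  obtain ⟨s, hs⟩ := exists_sum_homogeneousComponent hD x
  refine ⟨s, fun n hn ↦ ?_⟩
  rw [hs, map_sum]
  exact Finset.sum_eq_zero fun m hm ↦ homogeneousComponent_ne hD
    (homogeneousComponent_mem hD m x) (fun h ↦ hn (h ▸ hm))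

theorem eq_of_homogeneousComponent_eq (hD : DirectSum.IsInternal D) {x y : M}
    (h : ∀ n, homogeneousComponent hD n x = homogeneousComponent hD n y) : x = y := by
  rw [← sub_eq_zero]
  obtain ⟨s, hs⟩ := exists_sum_homogeneousComponent hD (x - y)
  rw [hs]
  exact Finset.sum_eq_zero fun n _ ↦ by rw [map_sub, h, sub_self]

theorem internal_induction (hD : DirectSum.IsInternal D) {p : M → Prop} (x : M) (h0 : p 0)
    (hh : ∀ n, ∀ x ∈ D n, p x) (ha : ∀ x y, p x → p y → p (x + y)) : p x := by
  classical
  obtain ⟨s, hs⟩ := exists_sum_homogeneousComponent hD x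
  rw [hs]
  clear hs
  induction s using Finset.induction_on with
  | empty => simpa
  | insert n s hn hs =>
    rw [Finset.sum_insert hn]
    exact ha _ _ (hh n _ (homogeneousComponent_mem hD n x)) hs

/-- To show that a sum of subgroups is direct, it is enough to provide the projections. -/
theorem isInternal_of_components (π : ℤ → M →+ M)
    (hs : ∀ n, ∀ x ∈ D n, π n x = x) (hne : ∀ m n, m ≠ n → ∀ x ∈ D m, π n x = 0)
    (htop : ∀ x, x ∈ ⨆ n, D n) : DirectSum.IsInternal D := by
  constructor
  · rw [injective_iff_map_eq_zero]
    intro x hx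
    have key (n : ℤ) : π n (DirectSum.coeAddMonoidHom D x) = x n := by
      clear hx
      induction x using DirectSum.induction_on with
      | zero => simp
      | of m x =>
        rw [DirectSum.coeAddMonoidHom_of]
        by_cases hmn : m = n
        · subst hmn
          rw [hs m x x.2, DirectSum.of_eq_same]
        · rw [hne m n hmn x x.2, DirectSum.of_eq_of_ne _ _ _ (Ne.symm hmn)]
          rfl
      | add x y hx hy => rw [map_add, map_add, hx, hy]; rfl
    ext n
    rw [← key, hx, map_zero]
    rfl
  · intro x
    have := htop x
    induction this using AddSubgroup.iSup_induction' with
    | hp n x hx => exact ⟨DirectSum.of _ n ⟨x, hx⟩, DirectSum.coeAddMonoidHom_of _ _ _⟩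
    | h1 => exact ⟨0, map_zero _⟩
    | hadd x y _ _ hx hy =>
      obtain ⟨x', rfl⟩ := hx
      obtain ⟨y', rfl⟩ := hy
      exact ⟨x' + y', map_add _ _ _⟩

theorem mem_iSup_of_sum {x : M} (s : Finset ℤ) (f : ℤ → M) (hf : ∀ n, f n ∈ D n)
    (hx : x = ∑ n ∈ s, f n) : x ∈ ⨆ n, D n := by
  rw [hx]
  exact sum_mem fun n _ ↦ AddSubgroup.mem_iSup_of_mem n (hf n)

/-- A subgroup that contains the homogeneous components of its elements is graded.  The subgroup is
given as the image of an injective map `f`. -/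
theorem isInternal_comap {Z : Type*} [AddCommGroup Z] (hD : DirectSum.IsInternal D) (f : Z →+ M)
    (hf : Function.Injective f) (h : ∀ n z, ∃ z', f z' = homogeneousComponent hD n (f z)) :
    DirectSum.IsInternal fun n ↦ (D n).comap f := by
  choose π hπ using h
  refine isInternal_of_components (fun n ↦ AddMonoidHom.mk' (π n) fun x y ↦ hf ?_)
    (fun n x hx ↦ hf ?_) (fun m n hmn x hx ↦ hf ?_) fun x ↦ ?_
  · rw [map_add, hπ, hπ, hπ, map_add, map_add]
  · exact (hπ n x).trans (homogeneousComponent_same hD hx)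
  · exact (hπ n x).trans ((homogeneousComponent_ne hD hx hmn).trans (map_zero f).symm)
  · obtain ⟨s, hs⟩ := exists_sum_homogeneousComponent hD (f x)
    refine mem_iSup_of_sum s (fun n ↦ π n x) (fun n ↦ ?_) (hf ?_)
    · rw [AddSubgroup.mem_comap, hπ]
      exact homogeneousComponent_mem hD n _
    · rw [map_sum]
      exact hs.trans (Finset.sum_congr rfl fun n _ ↦ (hπ n x).symm)

/-- A quotient by a subgroup that contains the homogeneous components of its elements is graded. -/
theorem isInternal_map {E : Type*} [AddCommGroup E] (hD : DirectSum.IsInternal D) (f : M →+ E)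
    (hf : Function.Surjective f) (h : ∀ n x, f x = 0 → f (homogeneousComponent hD n x) = 0) :
    DirectSum.IsInternal fun n ↦ (D n).map f := by
  have h' (n : ℤ) (x y : M) (hxy : f x = f y) :
      f (homogeneousComponent hD n x) = f (homogeneousComponent hD n y) := by
    rw [← sub_eq_zero, ← map_sub, ← map_sub]
    exact h n _ (by rw [map_sub, hxy, sub_self])
  refine isInternal_of_components (fun n ↦ AddMonoidHom.mk'
    (fun x ↦ f (homogeneousComponent hD n (Function.surjInv hf x))) fun x y ↦ ?_)
    (fun n x hx ↦ ?_) (fun m n hmn x hx ↦ ?_) fun x ↦ ?_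
  · rw [← map_add, ← map_add]
    exact h' _ _ _ (by simp [Function.surjInv_eq])
  · obtain ⟨y, hy, rfl⟩ := hx
    refine (h' n _ y (Function.surjInv_eq hf _)).trans ?_
    rw [homogeneousComponent_same hD hy]
  · obtain ⟨y, hy, rfl⟩ := hx
    refine (h' n _ y (Function.surjInv_eq hf _)).trans ?_
    rw [homogeneousComponent_ne hD hy hmn, map_zero]
  · obtain ⟨x, rfl⟩ := hf x
    obtain ⟨s, hs⟩ := exists_sum_homogeneousComponent hD x
    refine mem_iSup_of_sum s (fun n ↦ f (homogeneousComponent hD n x))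
      (fun n ↦ ⟨_, homogeneousComponent_mem hD n x, rfl⟩) ?_
    rw [← map_sum, ← hs]

end Internal

section Graded

variable {R : Type u} [Ring R] {G : ZGrading R}

theorem GradedModule.component_smul (M : GradedModule G) {m : ℤ} {r : R} (hr : r ∈ G.deg m) (n : ℤ)
    (x : M) : homogeneousComponent M.isInternal (m + n) (r • x) =
      r • homogeneousComponent M.isInternal n x := by
  induction x using internal_induction M.isInternal with
  | h0 => simp
  | ha x y hx hy => simp only [smul_add, map_add, hx, hy]
  | hh i x hx =>
    have h := M.smul_mem hr hx
    by_cases hi : i = n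
    · subst hi
      rw [homogeneousComponent_same _ hx, homogeneousComponent_same _ h]
    · rw [homogeneousComponent_ne _ hx hi, homogeneousComponent_ne _ h (by omega), smul_zero]

theorem ZGrading.component_mul (G : ZGrading R) {m : ℤ} {r : R} (hr : r ∈ G.deg m) (n : ℤ)
    (s : R) : homogeneousComponent G.isInternal (m + n) (r * s) =
      r * homogeneousComponent G.isInternal n s :=
  GradedModule.component_smul (G := G) ⟨R, G.deg, G.isInternal, G.mul_mem⟩ hr n s

namespace GradedModule

/-- The component of degree `i` of a linear form on a graded module: on an element of degree `n`
it is the component of degree `n + i` of the value. -/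
theorem exists_homComponent (P : GradedModule G) (i : ℤ) (φ : P.Dual) :
    ∃ ψ : P.Dual, ∀ n, ∀ x ∈ P.deg n,
      ψ x = homogeneousComponent G.isInternal (n + i) (φ x) := by
  let := P.isInternal.chooseDecomposition
  let ψ : P →+ R := (DirectSum.toAddMonoid fun n ↦ ((homogeneousComponent G.isInternal (n + i)).comp
    (LinearMap.toAddMonoidHom (show P →ₗ[R] R from φ))).comp (P.deg n).subtype).comp
      (DirectSum.decomposeAddEquiv P.deg).toAddMonoidHom
  have hψ (n : ℤ) (x : P) (hx : x ∈ P.deg n) :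
      ψ x = homogeneousComponent G.isInternal (n + i) (φ x) := by
    change DirectSum.toAddMonoid _ (DirectSum.decompose P.deg x) = _
    rw [DirectSum.decompose_of_mem _ hx, DirectSum.toAddMonoid_of]
    rfl
  refine ⟨show P →ₗ[R] R from { ψ with map_smul' := fun r x ↦ ?_ }, hψ⟩
  change ψ (r • x) = r * ψ x
  induction r using internal_induction G.isInternal with
  | h0 => simp
  | ha r s hr hs => rw [add_smul, map_add, hr, hs, add_mul]
  | hh m r hr =>
    induction x using internal_induction P.isInternal with
    | h0 => simp
    | ha x y hx hy => rw [smul_add, map_add, hx, hy, map_add, mul_add]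
    | hh n x hx =>
      rw [hψ _ _ (P.smul_mem hr hx), hψ _ _ hx, add_assoc, ← G.component_mul hr]
      exact congrArg _ (map_smul (show P →ₗ[R] R from φ) r x)

theorem dual_ext {P : GradedModule G} {φ ψ : P.Dual} (h : ∀ n, ∀ x ∈ P.deg n, φ x = ψ x) :
    φ = ψ := by
  refine LinearMap.ext fun x ↦ ?_
  induction x using internal_induction P.isInternal with
  | h0 => exact (map_zero (show P →ₗ[R] R from φ)).trans (map_zero (show P →ₗ[R] R from ψ)).symm
  | ha x y hx hy =>
    exact (map_add (show P →ₗ[R] R from φ) x y).trans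
      ((congrArg₂ (· + ·) hx hy).trans (map_add (show P →ₗ[R] R from ψ) x y).symm)
  | hh n x hx => exact h n x hx

/-- The component of degree `i` of a linear form on a graded module. -/
noncomputable def homComponent (P : GradedModule G) (i : ℤ) : P.Dual →+ P.Dual :=
  AddMonoidHom.mk' (fun φ ↦ (P.exists_homComponent i φ).choose) fun φ ψ ↦ dual_ext fun n x hx ↦ by
    refine ((P.exists_homComponent i (φ + ψ)).choose_spec n x hx).trans ?_
    refine Eq.trans ?_ (congrArg₂ (· + ·) ((P.exists_homComponent i φ).choose_spec n x hx)
      ((P.exists_homComponent i ψ).choose_spec n x hx)).symm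
    exact map_add _ _ _

theorem homComponent_apply (P : GradedModule G) (i : ℤ) (φ : P.Dual) {n : ℤ} {x : P}
    (hx : x ∈ P.deg n) :
    P.homComponent i φ x = homogeneousComponent G.isInternal (n + i) (φ x) :=
  (P.exists_homComponent i φ).choose_spec n x hx

theorem homComponent_mem (P : GradedModule G) (i : ℤ) (φ : P.Dual) :
    P.homComponent i φ ∈ P.homDeg i := by
  intro n x hx
  rw [homComponent_apply _ _ _ hx]
  exact homogeneousComponent_mem _ _ _

theorem finsetSum_apply (P : GradedModule G) (s : Finset ℤ) (f : ℤ → P.Dual) (x : P) :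
    (∑ i ∈ s, f i) x = ∑ i ∈ s, f i x :=
  LinearMap.sum_apply (σ₁₂ := RingHom.id R) s f x

/-- A linear form on a finitely generated graded module has finitely many components, because they
can be detected on finitely many generators. -/
theorem eq_sum_homComponent (P : GradedModule G) [hP : Module.Finite R P] (φ : P.Dual) :
    ∃ s : Finset ℤ, φ = ∑ i ∈ s, P.homComponent i φ := by
  classical
  have hex (x : P) : ∃ s : Finset ℤ, ∀ i ∉ s, P.homComponent i φ x = 0 := by
    induction x using internal_induction P.isInternal with
    | h0 => exact ⟨∅, fun i _ ↦ map_zero (show P →ₗ[R] R from P.homComponent i φ)⟩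
    | ha x y hx hy =>
      obtain ⟨s, hs⟩ := hx
      obtain ⟨t, ht⟩ := hy
      refine ⟨s ∪ t, fun i hi ↦ ?_⟩
      rw [Finset.mem_union, not_or] at hi
      refine (map_add (show P →ₗ[R] R from P.homComponent i φ) x y).trans ?_
      exact (congrArg₂ (· + ·) (hs i hi.1) (ht i hi.2)).trans (add_zero 0)
    | hh n x hx =>
      obtain ⟨s, hs⟩ := exists_homogeneousComponent_eq_zero G.isInternal (φ x)
      refine ⟨s.image (· - n), fun i hi ↦ ?_⟩
      rw [homComponent_apply _ _ _ hx]
      refine hs _ fun h ↦ hi ?_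
      rw [Finset.mem_image]
      exact ⟨_, h, by ring⟩
  choose s hs using hex
  obtain ⟨t, ht⟩ := hP.fg_top
  have hzero (i : ℤ) (hi : i ∉ t.biUnion s) : P.homComponent i φ = 0 := by
    have hle : (⊤ : Submodule R P) ≤ LinearMap.ker (show P →ₗ[R] R from P.homComponent i φ) := by
      rw [← ht, Submodule.span_le]
      intro x hx
      refine hs x i fun h ↦ hi ?_
      rw [Finset.mem_biUnion]
      exact ⟨x, hx, h⟩
    exact LinearMap.ext fun x ↦ hle trivial
  refine ⟨t.biUnion s, dual_ext fun n x hx ↦ eq_of_homogeneousComponent_eq G.isInternal fun j ↦ ?_⟩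
  rw [finsetSum_apply, map_sum, Finset.sum_eq_single (j - n)]
  · rw [homComponent_apply _ _ _ hx, add_sub_cancel,
      homogeneousComponent_same _ (homogeneousComponent_mem _ _ _)]
  · intro i _ hi
    rw [homComponent_apply _ _ _ hx]
    exact homogeneousComponent_ne _ (homogeneousComponent_mem _ _ _) (by omega)
  · intro hi
    rw [hzero _ hi]
    exact map_zero _

theorem isInternal_homDeg (P : GradedModule G) [Module.Finite R P] :
    DirectSum.IsInternal P.homDeg := by
  refine isInternal_of_components P.homComponent (fun i φ hφ ↦ dual_ext fun n x hx ↦ ?_)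
    (fun i j hij φ hφ ↦ dual_ext fun n x hx ↦ ?_) fun φ ↦ ?_
  · rw [homComponent_apply _ _ _ hx, homogeneousComponent_same _ (hφ n x hx)]
  · rw [homComponent_apply _ _ _ hx, homogeneousComponent_ne _ (hφ n x hx) (by omega)]
    rfl
  · obtain ⟨s, hs⟩ := P.eq_sum_homComponent φ
    exact mem_iSup_of_sum s _ (fun i ↦ P.homComponent_mem i φ) hs

/-- On a finitely generated graded module all linear forms are sums of homogeneous ones. -/
theorem grHom_eq_top (P : GradedModule G) [Module.Finite R P] : P.grHom = ⊤ := by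
  refine eq_top_iff.2 fun φ _ ↦ ?_
  obtain ⟨s, hs⟩ := P.eq_sum_homComponent φ
  exact mem_iSup_of_sum s _ (fun i ↦ P.homComponent_mem i φ) hs

end GradedModule

end Graded

end TwistedCY

/-! ### Graded Ext-groups and graded invertible bimodules -/

namespace TwistedCY

theorem map_homogeneousComponent {M N : Type*} [AddCommGroup M] [AddCommGroup N]
    {D : ℤ → AddSubgroup M} {E : ℤ → AddSubgroup N} (hD : DirectSum.IsInternal D)
    (hE : DirectSum.IsInternal E) (f : M →+ N) (hf : ∀ n, ∀ x ∈ D n, f x ∈ E n) (n : ℤ) (x : M) :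
    f (homogeneousComponent hD n x) = homogeneousComponent hE n (f x) := by
  induction x using internal_induction hD with
  | h0 => simp only [map_zero]
  | ha x y hx hy => simp only [map_add, hx, hy]
  | hh m x hx =>
    by_cases hmn : m = n
    · subst hmn
      rw [homogeneousComponent_same hD hx, homogeneousComponent_same hE (hf _ x hx)]
    · rw [homogeneousComponent_ne hD hx hmn, homogeneousComponent_ne hE (hf _ x hx) hmn, map_zero]

namespace GradedResolution

variable {R : Type u} [Ring R] {G : ZGrading R} {M : GradedModule G} {P : GradedResolution M}

/-- A perfect graded resolution, with the gradings forgotten. -/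
def IsPerfect.toPerfectResolution (hP : P.IsPerfect) : PerfectResolution R M where
  X n := P.X n
  projective := P.projective
  finite := hP.1
  bounded := hP.2
  d := P.d
  ε := P.ε
  ε_surjective := P.ε_surjective
  exact_zero := P.exact_zero
  exact_succ := P.exact_succ

/-- A cocycle of the complex of graded Hom-groups as a cocycle of the complex of Hom-groups. -/
def forgetCocycle (hP : P.IsPerfect) (n : ℕ) :
    P.cocycles n →ₗ[Rᵐᵒᵖ] LinearMap.ker (hP.toPerfectResolution.dual n) where
  toFun φ := ⟨φ.1, φ.2.2⟩
  map_add' _ _ := rfl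
  map_smul' _ _ := rfl

/-- The class in `Ext` of a cocycle of the complex of graded Hom-groups. -/
noncomputable def extOfCocycle (hP : P.IsPerfect) (n : ℕ) :
    P.cocycles n →ₗ[Rᵐᵒᵖ] Ext (ModuleCat.of R M) (ModuleCat.of R R) n :=
  (hP.toPerfectResolution.extClass n).comp (forgetCocycle hP n)

theorem mem_grHom (hP : P.IsPerfect) {n : ℕ} (φ : (P.X n).Dual) : φ ∈ (P.X n).grHom := by
  have := hP.1 n
  rw [GradedModule.grHom_eq_top]
  trivial

theorem extOfCocycle_surjective (hP : P.IsPerfect) (n : ℕ) :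
    Function.Surjective (extOfCocycle hP n) := by
  intro x
  obtain ⟨φ, rfl⟩ := hP.toPerfectResolution.extClass_surjective n x
  exact ⟨⟨φ.1, mem_grHom hP _, φ.2⟩, rfl⟩

theorem submoduleOf_coboundaries (hP : P.IsPerfect) (n : ℕ) :
    (P.coboundaries n).submoduleOf (P.cocycles n) = LinearMap.ker (extOfCocycle hP n) := by
  ext φ
  cases n with
  | zero => exact (hP.toPerfectResolution.extClass_zero_eq_zero_iff ⟨φ.1, φ.2.2⟩).symm
  | succ n =>
    refine Iff.trans ?_ (hP.toPerfectResolution.extClass_succ_eq_zero_iff n ⟨φ.1, φ.2.2⟩).symm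
    constructor
    · rintro ⟨ψ, -, hψ⟩
      exact ⟨ψ, hψ⟩
    · rintro ⟨ψ, hψ⟩
      exact ⟨ψ, mem_grHom hP _, hψ⟩

/-- The graded Ext-groups agree with the ungraded ones if there is a perfect graded resolution,
because then all linear forms on its terms are sums of homogeneous ones. -/
noncomputable def grExtEquiv (hP : P.IsPerfect) (n : ℕ) :
    P.GrExt n ≃ₗ[Rᵐᵒᵖ] Ext (ModuleCat.of R M) (ModuleCat.of R R) n :=
  (Submodule.quotEquivOfEq _ _ (submoduleOf_coboundaries hP n)).trans
    ((extOfCocycle hP n).quotKerEquivOfSurjective (extOfCocycle_surjective hP n))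

theorem dual_homogeneousComponent (hP : P.IsPerfect) (n : ℕ) (j : ℤ) (φ : (P.X n).Dual) :
    haveI := hP.1
    P.dual n (homogeneousComponent (P.X n).isInternal_homDeg j φ) =
      homogeneousComponent (P.X (n + 1)).isInternal_homDeg j (P.dual n φ) := by
  have := hP.1
  exact map_homogeneousComponent (P.X n).isInternal_homDeg (P.X (n + 1)).isInternal_homDeg
    (P.dual n).toAddMonoidHom (fun i φ (hφ : φ ∈ (P.X n).homDeg i) m x hx ↦ hφ m _ (P.d_deg n m x hx)) j φ

/-- The cocycles of degree `j`. -/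
def cocyclesDeg (P : GradedResolution M) (n : ℕ) (j : ℤ) : AddSubgroup (P.cocycles n) :=
  ((P.X n).homDeg j).comap (P.cocycles n).subtype.toAddMonoidHom

theorem isInternal_cocyclesDeg (hP : P.IsPerfect) (n : ℕ) :
    DirectSum.IsInternal (P.cocyclesDeg n) := by
  have := hP.1
  refine isInternal_comap (P.X n).isInternal_homDeg (P.cocycles n).subtype.toAddMonoidHom
    Subtype.val_injective fun j z ↦
      ⟨⟨homogeneousComponent (P.X n).isInternal_homDeg j z.1, mem_grHom hP _, ?_⟩, rfl⟩
  exact (dual_homogeneousComponent hP n j z.1).trans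
    ((congrArg _ (LinearMap.mem_ker.1 z.2.2)).trans (map_zero _))

/-- The homogeneous elements of degree `j` of the graded Ext-group, as a subgroup. -/
def grExtSubgroup (P : GradedResolution M) (n : ℕ) (j : ℤ) : AddSubgroup (P.GrExt n) :=
  (P.cocyclesDeg n j).map (Submodule.mkQ _).toAddMonoidHom

theorem mem_grExtSubgroup {n : ℕ} {j : ℤ} {x : P.GrExt n} :
    x ∈ P.grExtSubgroup n j ↔ x ∈ P.grExtDeg n j :=
  exists_congr fun _ ↦ and_congr Iff.rfl eq_comm

theorem isInternal_grExtSubgroup (hP : P.IsPerfect) (n : ℕ) :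
    DirectSum.IsInternal (P.grExtSubgroup n) := by
  have := hP.1
  refine isInternal_map (isInternal_cocyclesDeg hP n) (Submodule.mkQ _).toAddMonoidHom
    (Submodule.mkQ_surjective _) fun j z hz ↦ ?_
  have hcomp : (homogeneousComponent (isInternal_cocyclesDeg hP n) j z).1 =
      homogeneousComponent (P.X n).isInternal_homDeg j z.1 :=
    map_homogeneousComponent _ _ (P.cocycles n).subtype.toAddMonoidHom (fun _ _ h ↦ h) j z
  replace hz := (Submodule.Quotient.mk_eq_zero _).1 hz
  refine (Submodule.Quotient.mk_eq_zero _).2 ?_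
  change _ ∈ P.coboundaries n at hz
  change Subtype.val _ ∈ P.coboundaries n
  rw [hcomp]
  cases n with
  | zero =>
    replace hz : z.1 = 0 := hz
    rw [hz, map_zero]
    exact zero_mem _
  | succ n =>
    obtain ⟨ψ, -, hψ⟩ := hz
    refine ⟨homogeneousComponent (P.X n).isInternal_homDeg j ψ, mem_grHom hP _, ?_⟩
    rw [dual_homogeneousComponent hP, hψ]
    rfl

theorem grExtSubgroup_smul {n : ℕ} {i j : ℤ} {r : R} {x : P.GrExt n} (hr : r ∈ G.deg i)
    (hx : x ∈ P.grExtSubgroup n j) : op r • x ∈ P.grExtSubgroup n (j + i) := by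
  obtain ⟨φ, hφ, rfl⟩ := hx
  refine ⟨op r • φ, fun m x hx ↦ ?_, rfl⟩
  rw [← add_assoc]
  exact G.mul_mem (hφ m x hx) hr

end GradedResolution

attribute [local instance] instModuleTensorProductMop

section Forget

variable {k : Type v} {A : Type u} [Field k] [Ring A] [Algebra k A] {𝒜 : ℕ → Submodule k A}

theorem GradedBimodule.IsGradedInvertible.isInvertible {U : GradedBimodule 𝒜}
    (h : U.IsGradedInvertible) : U.toCentralBimodule.IsInvertible := by
  obtain ⟨V, ⟨e, -⟩, ⟨e', -⟩⟩ := h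
  exact ⟨V.toCentralBimodule, ⟨e⟩, ⟨e'⟩⟩

/-- The resolution underlying a perfect graded resolution of the diagonal bimodule. -/
def GradedResolution.IsPerfect.diag [GradedAlgebra 𝒜] {P : GradedResolution (diagModule 𝒜)}
    (hP : P.IsPerfect) : PerfectResolution (Env k A) A :=
  hP.toPerfectResolution

/-- The graded Ext-groups of the diagonal bimodule agree with the ungraded ones. -/
noncomputable def GradedResolution.diagExtEquiv [GradedAlgebra 𝒜]
    {P : GradedResolution (diagModule 𝒜)} (hP : P.IsPerfect) (n : ℕ) :
    P.GrExt n ≃ₗ[(Env k A)ᵐᵒᵖ]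
      Ext (ModuleCat.of (Env k A) A) (ModuleCat.of (Env k A) (Env k A)) n :=
  GradedResolution.grExtEquiv hP n

/-- Forgetting the gradings. -/
theorem IsGradedTwistedCY.isTwistedCY [GradedAlgebra 𝒜] {d : ℕ} (h : IsGradedTwistedCY 𝒜 d) :
    IsTwistedCY k A d := by
  obtain ⟨P, hP, U, hU, hv, φ, -⟩ := h
  refine ⟨(isHomologicallySmooth_iff k A).2 ⟨hP.diag⟩, U.toCentralBimodule, hU.isInvertible,
    fun i hi ↦ ?_, ⟨⟨(GradedResolution.diagExtEquiv hP d).symm.toAddEquiv.trans φ.equiv,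
      fun a b x ↦ ?_⟩⟩⟩
  · have := hv i hi
    exact (GradedResolution.diagExtEquiv hP i).symm.toEquiv.subsingleton
  · refine Eq.trans ?_ (φ.map_smul a b _)
    exact congrArg φ.equiv (map_smul (GradedResolution.diagExtEquiv hP d).symm _ x)

end Forget

section GradedDual

variable {k : Type v} {A : Type u} [Field k] [Ring A] [Algebra k A] {𝒜 : ℕ → Submodule k A}
  [GradedAlgebra 𝒜]

theorem algDeg_mul {i j : ℤ} {a b : A} (ha : a ∈ algDeg 𝒜 i) (hb : b ∈ algDeg 𝒜 j) :
    a * b ∈ algDeg 𝒜 (i + j) := by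
  obtain rfl | ⟨i, rfl, ha⟩ := exists_of_mem_algDeg 𝒜 ha
  · rw [zero_mul]; exact zero_mem _
  obtain rfl | ⟨j, rfl, hb⟩ := exists_of_mem_algDeg 𝒜 hb
  · rw [mul_zero]; exact zero_mem _
  exact SetLike.mul_mem_graded (A := 𝒜) ha hb

variable (𝒜) in
/-- The graded algebra as a `ℤ`-graded ring. -/
def algGrading : ZGrading A where
  deg n := (algDeg 𝒜 n).toAddSubgroup
  isInternal := isInternal_algDeg 𝒜
  one_mem := SetLike.one_mem_graded 𝒜
  mul_mem ha hb := algDeg_mul ha hb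

namespace GradedBimodule

theorem left_mem' (U : GradedBimodule 𝒜) {i j : ℤ} {a : A} {u : U.carrier}
    (ha : a ∈ algDeg 𝒜 i) (hu : u ∈ U.deg j) : a • u ∈ U.deg (i + j) := by
  obtain rfl | ⟨i, rfl, ha⟩ := exists_of_mem_algDeg 𝒜 ha
  · rw [zero_smul]; exact zero_mem _
  · exact U.left_mem i j a u ha hu

theorem right_mem' (U : GradedBimodule 𝒜) {i j : ℤ} {a : A} {u : U.carrier}
    (ha : a ∈ algDeg 𝒜 i) (hu : u ∈ U.deg j) : op a • u ∈ U.deg (j + i) := by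
  obtain rfl | ⟨i, rfl, ha⟩ := exists_of_mem_algDeg 𝒜 ha
  · rw [MulOpposite.op_zero, zero_smul]; exact zero_mem _
  · exact U.right_mem i j a u ha hu

/-- The graded left module underlying a graded bimodule. -/
def leftGraded (U : GradedBimodule 𝒜) : GradedModule (algGrading 𝒜) where
  carrier := U.carrier
  deg := U.deg
  isInternal := U.isInternal
  smul_mem := U.left_mem'

/-- The left dual of a graded bimodule that is finitely generated as a left module. -/
def dual (U : GradedBimodule 𝒜) (hU : Module.Finite A U.carrier) : GradedBimodule 𝒜 where
  toCentralBimodule := U.toCentralBimodule.dual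
  deg := U.leftGraded.homDeg
  isInternal :=
    haveI : Module.Finite A U.leftGraded := hU
    U.leftGraded.isInternal_homDeg
  left_mem i j a f ha hf n x hx := by
    rw [← add_assoc]
    exact hf (n + i) _ (U.right_mem i n a x ha hx)
  right_mem i j a f ha hf n x hx := by
    rw [← add_assoc]
    exact (algGrading 𝒜).mul_mem (hf n x hx) ha

theorem component_op_smul (U : GradedBimodule 𝒜) (m n : ℤ) (a : A) {x : U.carrier}
    (hx : x ∈ U.deg n) : homogeneousComponent U.isInternal (n + m) (op a • x) =
      op (homogeneousComponent (algGrading 𝒜).isInternal m a) • x := by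
  induction a using internal_induction (algGrading 𝒜).isInternal with
  | h0 => simp
  | ha a b ha hb => simp only [MulOpposite.op_add, add_smul, map_add, ha, hb]
  | hh i a ha =>
    have h := U.right_mem' ha hx
    by_cases hi : i = m
    · subst hi
      rw [homogeneousComponent_same _ h, homogeneousComponent_same _ ha]
    · rw [homogeneousComponent_ne _ h (by omega), homogeneousComponent_ne _ ha hi,
        MulOpposite.op_zero, zero_smul]

/-- A graded bimodule that is a balanced progenerator is graded-invertible, because the
isomorphisms with its left dual have degree zero. -/
theorem isGradedInvertible_of_isBalancedProgenerator (U : GradedBimodule 𝒜)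
    (h : IsBalancedProgenerator A U.carrier) : U.IsGradedInvertible := by
  obtain ⟨e, e', he, he'⟩ := CentralBimodule.exists_tensorIso_dual (U := U.toCentralBimodule) h
  refine ⟨U.dual h.dualBasis.finite_projective.1, ⟨e, fun i j u f hu hf ↦ ?_⟩,
    ⟨e', fun i j f u hf hu ↦ ?_⟩⟩
  · exact (he u f).symm ▸ hf i u hu
  -- `a` with `x a = f(x) u` is homogeneous: its other components annihilate `U` from the right
  · replace he' := he' f u
    change e'.equiv (CentralBimodule.tmul (V := U.toCentralBimodule)
      (U := U.toCentralBimodule.dual) f u) ∈ algDeg 𝒜 (i + j)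
    set a := e'.equiv (CentralBimodule.tmul (V := U.toCentralBimodule)
      (U := U.toCentralBimodule.dual) f u) with ha
    suffices hs : homogeneousComponent (algGrading 𝒜).isInternal (i + j) a = a by
      rw [← hs]
      exact homogeneousComponent_mem (algGrading 𝒜).isInternal _ a
    refine eq_of_homogeneousComponent_eq (algGrading 𝒜).isInternal fun m ↦ ?_
    by_cases hm : i + j = m
    · subst hm
      rw [homogeneousComponent_same _ (homogeneousComponent_mem _ _ _)]
    · rw [homogeneousComponent_ne _ (homogeneousComponent_mem _ _ _) hm]
      refine (h.faithful _ fun x ↦ ?_).symm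
      induction x using internal_induction U.isInternal with
      | h0 => rw [smul_zero]
      | ha x y hx hy => rw [smul_add, hx, hy, add_zero]
      | hh n x hx =>
        have hfx : CentralBimodule.dualForm f x • u ∈ U.deg (n + i + j) :=
          U.left_mem' (hf n x hx) hu
        refine (U.component_op_smul m n a hx).symm.trans ?_
        rw [he', homogeneousComponent_ne U.isInternal hfx (by omega)]

end GradedBimodule

end GradedDual

end TwistedCY

/-! ### Length of resolutions and Schanuel's lemma -/

namespace TwistedCY

/-- `N` has a resolution by finitely generated projective modules of length at most `n`. -/
def HasPerfectLength (S : Type u) [Ring S] :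
    ℕ → ∀ (N : Type u) [AddCommGroup N] [Module S N], Prop
  | 0, N, _, _ => Module.Finite S N ∧ Module.Projective S N
  | n + 1, N, _, _ => ∃ (Z F : Type u) (_ : AddCommGroup Z) (_ : AddCommGroup F) (_ : Module S Z)
      (_ : Module S F) (i : Z →ₗ[S] F) (f : F →ₗ[S] N), Module.Finite S F ∧ Module.Projective S F ∧
        Function.Injective i ∧ Function.Exact i f ∧ Function.Surjective f ∧ HasPerfectLength S n Z

namespace HasPerfectLength

variable {S : Type u} [Ring S] {X Y F : Type u} [AddCommGroup X] [AddCommGroup Y] [AddCommGroup F]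
  [Module S X] [Module S Y] [Module S F]

theorem congr {n : ℕ} (e : X ≃ₗ[S] Y) (h : HasPerfectLength S n X) : HasPerfectLength S n Y := by
  cases n with
  | zero =>
    obtain ⟨_, _⟩ := h
    exact ⟨Module.Finite.equiv e, Module.Projective.of_equiv e⟩
  | succ n =>
    obtain ⟨Z, F, _, _, _, _, i, f, h1, h2, h3, h4, h5, h6⟩ := h
    refine ⟨Z, F, _, _, _, _, i, e.toLinearMap.comp f, h1, h2, h3, fun x ↦ ?_,
      e.surjective.comp h5, h6⟩
    rw [← h4 x]
    exact map_eq_zero_iff e e.injective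

theorem finite {n : ℕ} (h : HasPerfectLength S n X) : Module.Finite S X := by
  cases n with
  | zero => exact h.1
  | succ n =>
    obtain ⟨Z, F, _, _, _, _, i, f, h1, h2, h3, h4, h5, h6⟩ := h
    exact Module.Finite.of_surjective f h5

variable [Module.Finite S F] [Module.Projective S F] {i : X →ₗ[S] Y} {p : Y →ₗ[S] F}

/-- A short exact sequence that ends in a projective module splits. -/
theorem exists_equiv_prod (hi : Function.Injective i) (he : Function.Exact i p)
    (hp : Function.Surjective p) : Nonempty (Y ≃ₗ[S] X × F) := by
  obtain ⟨s, hs⟩ := Module.projective_lifting_property p LinearMap.id hp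
  exact ⟨(he.splitSurjectiveEquiv hi ⟨s, hs⟩).1⟩

/-- In a short exact sequence `0 → X → Y → F → 0` with `F` finitely generated projective, the
middle term is at most as long as the left term: add `F` to the cover of `X`. -/
theorem of_exact_middle {n : ℕ} (hi : Function.Injective i) (he : Function.Exact i p)
    (hp : Function.Surjective p) (h : HasPerfectLength S n X) : HasPerfectLength S n Y := by
  cases n with
  | zero =>
    obtain ⟨_, _⟩ := h
    obtain ⟨e⟩ := exists_equiv_prod hi he hp
    exact ⟨Module.Finite.equiv e.symm, Module.Projective.of_equiv e.symm⟩
  | succ n =>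
    obtain ⟨Z, L, _, _, _, _, j, q, _, _, hj, hjq, hq, h⟩ := h
    obtain ⟨s, hs⟩ := Module.projective_lifting_property p LinearMap.id hp
    have hs (x : F) : p (s x) = x := LinearMap.congr_fun hs x
    have hpi (x : X) : p (i x) = 0 := he.apply_apply_eq_zero x
    refine ⟨Z, L × F, _, _, _, _, (LinearMap.inl S L F).comp j, (i.comp q).coprod s,
      inferInstance, inferInstance, LinearMap.inl_injective.comp hj, ?_, fun y ↦ ?_, h⟩
    · rintro ⟨g, x⟩
      constructor
      · intro h0
        rw [LinearMap.coprod_apply, LinearMap.comp_apply] at h0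
        have hx : x = 0 := by
          have := congrArg p h0
          rwa [map_add, hpi, hs, zero_add, map_zero] at this
        subst hx
        rw [map_zero, add_zero, map_eq_zero_iff i hi, hjq g] at h0
        obtain ⟨z, rfl⟩ := h0
        exact ⟨z, rfl⟩
      · rintro ⟨z, hz⟩
        rw [← hz]
        simp [hjq.apply_apply_eq_zero]
    · obtain ⟨x, hx⟩ := (he (y - s (p y))).1 (by rw [map_sub, hs, sub_self])
      obtain ⟨g, rfl⟩ := hq x
      exact ⟨(g, p y), by simp [hx]⟩

theorem finite_projective_left [Module.Finite S Y] [Module.Projective S Y]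
    (hi : Function.Injective i) (he : Function.Exact i p) (hp : Function.Surjective p) :
    Module.Finite S X ∧ Module.Projective S X := by
  obtain ⟨e⟩ := exists_equiv_prod hi he hp
  have : (LinearMap.fst S X F ∘ₗ e.toLinearMap) ∘ₗ (e.symm.toLinearMap ∘ₗ LinearMap.inl S X F) =
      LinearMap.id := by
    ext x
    simp
  exact ⟨Module.Finite.of_surjective (LinearMap.fst S X F ∘ₗ e.toLinearMap)
    fun x ↦ ⟨_, LinearMap.congr_fun this x⟩, Module.Projective.of_split _ _ this⟩

/-- In a short exact sequence `0 → X → Y → F → 0` with `F` finitely generated projective, the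
left term is at most as long as the middle term: take the kernel of the map from the cover of `Y`
to `F`. -/
theorem of_exact_left {n : ℕ} (hi : Function.Injective i) (he : Function.Exact i p)
    (hp : Function.Surjective p) (h : HasPerfectLength S n Y) : HasPerfectLength S n X := by
  cases n with
  | zero =>
    obtain ⟨_, _⟩ := h
    exact finite_projective_left hi he hp
  | succ n =>
    obtain ⟨Z, L, _, _, _, _, j, q, _, _, hj, hjq, hq, h⟩ := h
    have hpq : Function.Surjective (p.comp q) := hp.comp hq
    have hker := finite_projective_left (i := (LinearMap.ker (p.comp q)).subtype) (p := p.comp q)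
      Subtype.val_injective (LinearMap.exact_subtype_ker_map _) hpq
    let e : X ≃ₗ[S] LinearMap.ker p := LinearEquiv.ofBijective
      (i.codRestrict (LinearMap.ker p) fun x ↦ he.apply_apply_eq_zero x)
      ⟨fun x y hxy ↦ hi (congrArg Subtype.val hxy), fun y ↦ by
        obtain ⟨x, hx⟩ := (he y).1 y.2
        exact ⟨x, Subtype.ext hx⟩⟩
    refine congr e.symm ⟨Z, LinearMap.ker (p.comp q), _, _, _, _,
      j.codRestrict _ fun z ↦ by simp [hjq.apply_apply_eq_zero],
      q.restrict (p := LinearMap.ker (p.comp q)) (q := LinearMap.ker p) fun x hx ↦ hx,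
      hker.1, hker.2, fun x y hxy ↦ hj (congrArg Subtype.val hxy), fun x ↦ ?_, fun y ↦ ?_, h⟩
    · rw [← Subtype.val_inj]
      refine (hjq x.1).trans ⟨?_, ?_⟩
      · rintro ⟨z, hz⟩
        exact ⟨z, Subtype.ext hz⟩
      · rintro ⟨z, hz⟩
        exact ⟨z, congrArg Subtype.val hz⟩
    · obtain ⟨g, hg⟩ := hq y.1
      exact ⟨⟨g, by simp [hg]⟩, Subtype.ext hg⟩

/-- Schanuel's lemma: the kernel of any finitely generated projective cover of a module of length
at most `n + 1` has length at most `n`.  Both kernels are compared with the fibre product `Q` of the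
two covers. -/
theorem of_exact_right {n : ℕ} {g : F →ₗ[S] Y} {j : X →ₗ[S] F} (hj : Function.Injective j)
    (he : Function.Exact j g) (hg : Function.Surjective g) (h : HasPerfectLength S (n + 1) Y) :
    HasPerfectLength S n X := by
  obtain ⟨Z, L, _, _, _, _, i, f, _, _, hi, hif, hf, h⟩ := h
  let Q : Submodule S (L × F) := LinearMap.ker (f.comp (LinearMap.fst S L F) -
    g.comp (LinearMap.snd S L F))
  have hQ (x : L) (y : F) : (x, y) ∈ Q ↔ f x = g y := by
    simp [Q, sub_eq_zero]
  have hq : HasPerfectLength S n Q := by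
    refine of_exact_middle (i := ((LinearMap.inl S L F).comp i).codRestrict Q fun z ↦ ?_)
      (p := (LinearMap.snd S L F).comp Q.subtype) (fun x y hxy ↦ hi ?_) ?_ (fun y ↦ ?_) h
    · exact (hQ _ _).2 (by simp [hif.apply_apply_eq_zero])
    · exact congrArg (fun t ↦ t.1.1) hxy
    · rintro ⟨⟨x, y⟩, hxy⟩
      rw [hQ] at hxy
      constructor
      · rintro (rfl : y = 0)
        rw [map_zero, hif x] at hxy
        obtain ⟨z, rfl⟩ := hxy
        exact ⟨z, rfl⟩
      · rintro ⟨z, hz⟩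
        exact (congrArg (fun t ↦ t.1.2) hz).symm
    · obtain ⟨x, hx⟩ := hf (g y)
      exact ⟨⟨(x, y), (hQ _ _).2 hx⟩, rfl⟩
  refine of_exact_left (i := ((LinearMap.inr S L F).comp j).codRestrict Q fun z ↦ ?_)
      (p := (LinearMap.fst S L F).comp Q.subtype) (fun x y hxy ↦ hj ?_) ?_ (fun x ↦ ?_) hq
  · exact (hQ _ _).2 (by simp [he.apply_apply_eq_zero])
  · exact congrArg (fun t ↦ t.1.2) hxy
  · rintro ⟨⟨x, y⟩, hxy⟩
    rw [hQ] at hxy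
    constructor
    · rintro (rfl : x = 0)
      rw [map_zero, eq_comm, he y] at hxy
      obtain ⟨z, rfl⟩ := hxy
      exact ⟨z, rfl⟩
    · rintro ⟨z, hz⟩
      exact (congrArg (fun t ↦ t.1.1) hz).symm
  · obtain ⟨y, hy⟩ := hg (f x)
    exact ⟨⟨(x, y), (hQ _ _).2 hy.symm⟩, rfl⟩

end HasPerfectLength

theorem PerfectResolution.hasPerfectLength {S : Type u} [Ring S] (n : ℕ) {N : Type u}
    [AddCommGroup N] [Module S N] (P : PerfectResolution S N)
    (hn : ∀ m, n < m → Subsingleton (P.X m)) : HasPerfectLength S n N := by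
  induction n generalizing N with
  | zero =>
    have := hn 1 one_pos
    have hinj : Function.Injective P.ε := by
      rw [injective_iff_map_eq_zero]
      intro x hx
      obtain ⟨y, rfl⟩ := (P.exact_zero x).1 hx
      rw [Subsingleton.elim y 0, map_zero]
    exact HasPerfectLength.congr (n := 0)
      (LinearEquiv.ofBijective P.ε ⟨hinj, P.ε_surjective⟩) ⟨inferInstance, inferInstance⟩
  | succ n ih =>
    refine ⟨LinearMap.ker P.ε, P.X 0, _, _, _, _, (LinearMap.ker P.ε).subtype, P.ε, inferInstance,
      inferInstance, Subtype.val_injective, LinearMap.exact_subtype_ker_map _, P.ε_surjective,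
      ih { X n := P.X (n + 1)
           bounded := ⟨n, fun m hm ↦ hn (m + 1) (by omega)⟩
           d n := P.d (n + 1)
           ε := (P.d 0).codRestrict _ fun x ↦ P.exact_zero.apply_apply_eq_zero x
           ε_surjective y := by
             obtain ⟨x, hx⟩ := (P.exact_zero y).1 y.2
             exact ⟨x, Subtype.ext hx⟩
           exact_zero x := by
             rw [← Subtype.val_inj]
             exact P.exact_succ 0 x
           exact_succ n := P.exact_succ (n + 1) } fun m hm ↦ hn (m + 1) (by omega)⟩

end TwistedCY

/-! ### Graded resolutions from resolutions of a base change -/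

namespace TwistedCY

section

variable {R : Type u} [Ring R] {G : ZGrading R}

namespace GradedModule

/-- The kernel of a homomorphism of degree zero. -/
def ker {F M : GradedModule G} (f : F →ₗ[R] M) (hf : ∀ (i : ℤ) (x : F), x ∈ F.deg i → f x ∈ M.deg i) :
    GradedModule G where
  carrier := LinearMap.ker f
  deg n := (F.deg n).comap (LinearMap.ker f).subtype.toAddMonoidHom
  isInternal := isInternal_comap F.isInternal (LinearMap.ker f).subtype.toAddMonoidHom
    Subtype.val_injective fun n z ↦ ⟨⟨homogeneousComponent F.isInternal n z.1,
      (map_homogeneousComponent F.isInternal M.isInternal f.toAddMonoidHom hf n z.1).trans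
        ((congrArg _ z.2).trans (map_zero _))⟩, rfl⟩
  smul_mem hr hx := F.smul_mem hr hx

/-- The free module with a basis whose elements have the degrees `e i`. -/
def free (G : ZGrading R) {ι : Type u} [Fintype ι] (e : ι → ℤ) : GradedModule G where
  carrier := ι → R
  deg n :=
    { carrier := {f | ∀ i, f i ∈ G.deg (n - e i)}
      add_mem' hf hg i := add_mem (hf i) (hg i)
      zero_mem' _ := zero_mem _
      neg_mem' hf i := neg_mem (hf i) }
  isInternal := by
    classical
    refine isInternal_of_components (fun n ↦ AddMonoidHom.mk'
      (fun f i ↦ homogeneousComponent G.isInternal (n - e i) (f i)) fun f g ↦ ?_)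
      (fun n f hf ↦ ?_) (fun m n hmn f hf ↦ ?_) fun f ↦ ?_
    · funext i
      exact map_add _ _ _
    · funext i
      exact homogeneousComponent_same _ (hf i)
    · funext i
      exact homogeneousComponent_ne _ (hf i) (by omega)
    · rw [← Finset.univ_sum_single f]
      refine sum_mem fun i _ ↦ ?_
      generalize f i = r
      induction r using internal_induction G.isInternal with
      | h0 => rw [Pi.single_zero]; exact zero_mem _
      | ha r s hr hs => rw [Pi.single_add]; exact add_mem hr hs
      | hh n r hr =>
        refine AddSubgroup.mem_iSup_of_mem (n + e i) fun j ↦ ?_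
        obtain rfl | hij := eq_or_ne j i
        · rwa [Pi.single_eq_same, add_sub_cancel_right]
        · rw [Pi.single_eq_of_ne hij]
          exact zero_mem _
  smul_mem {i j r f} hr hf l := by
    rw [add_sub_assoc]
    exact G.mul_mem hr (hf l)

theorem exists_homogeneous_generators (M : GradedModule G) [hM : Module.Finite R M] :
    ∃ s : Finset M, (∀ x ∈ s, ∃ n, x ∈ M.deg n) ∧ Submodule.span R (s : Set M) = ⊤ := by
  have htop : Submodule.span R {x : M | ∃ n, x ∈ M.deg n} = ⊤ := by
    refine eq_top_iff.2 fun x _ ↦ ?_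
    induction x using internal_induction M.isInternal with
    | h0 => exact zero_mem _
    | ha x y hx hy => exact add_mem (hx trivial) (hy trivial)
    | hh n x hx => exact Submodule.subset_span ⟨n, hx⟩
  obtain ⟨s, hs, hs'⟩ := (Submodule.fg_span_iff_fg_span_finset_subset _).1 (htop ▸ hM.fg_top)
  exact ⟨s, hs, hs'.symm.trans htop⟩

/-- A finitely generated graded module is the image of a finitely generated graded free module. -/
theorem exists_free_cover (M : GradedModule G) [Module.Finite R M] :
    ∃ (F : GradedModule G) (f : F →ₗ[R] M), Module.Finite R F ∧ Module.Projective R F ∧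
      (∀ (i : ℤ) (x : F), x ∈ F.deg i → f x ∈ M.deg i) ∧ Function.Surjective f := by
  obtain ⟨s, hs, hspan⟩ := M.exists_homogeneous_generators
  choose e he using fun i : s ↦ hs i.1 i.2
  have hsurj : Function.Surjective (Fintype.linearCombination R fun i : s ↦ i.1) := by
    rw [← LinearMap.range_eq_top, Fintype.range_linearCombination, ← hspan]
    simp
  refine ⟨free G e, Fintype.linearCombination R fun i : s ↦ i.1,
    inferInstanceAs (Module.Finite R (s → R)), inferInstanceAs (Module.Projective R (s → R)),
    fun n x hx ↦ ?_, hsurj⟩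
  refine sum_mem fun i _ ↦ ?_
  have := M.smul_mem (hx i) (he i)
  rwa [sub_add_cancel] at this

/-- The zero module. -/
def zero (G : ZGrading R) : GradedModule G where
  carrier := PUnit.{u + 1}
  deg _ := ⊤
  isInternal := isInternal_of_components (fun _ ↦ 0) (fun _ _ _ ↦ rfl) (fun _ _ _ _ _ ↦ rfl)
    fun _ ↦ AddSubgroup.mem_iSup_of_mem 0 trivial
  smul_mem _ _ := trivial

end GradedModule

namespace GradedResolution

/-- The trivial resolution of a graded module without nonzero elements. -/
def ofSubsingleton (M : GradedModule G) [Subsingleton M] : GradedResolution M where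
  X _ := GradedModule.zero G
  projective _ := inferInstanceAs (Module.Projective R PUnit.{u + 1})
  d _ := 0
  ε := 0
  d_deg _ _ _ _ := trivial
  ε_deg i _ _ := zero_mem (M.deg i)
  ε_surjective _ := ⟨PUnit.unit, Subsingleton.elim _ _⟩
  exact_zero _ := ⟨fun _ ↦ ⟨PUnit.unit, rfl⟩, fun _ ↦ Subsingleton.elim _ _⟩
  exact_succ _ _ := ⟨fun _ ↦ ⟨PUnit.unit, rfl⟩, fun _ ↦ rfl⟩

/-- A resolution of the kernel of `f : F → M`, extended by `f`. -/
def cons {F M : GradedModule G} [Module.Projective R F] (f : F →ₗ[R] M)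
    (hf : ∀ (i : ℤ) (x : F), x ∈ F.deg i → f x ∈ M.deg i) (hs : Function.Surjective f)
    (P : GradedResolution (GradedModule.ker f hf)) : GradedResolution M where
  X
    | 0 => F
    | n + 1 => P.X n
  projective
    | 0 => inferInstance
    | n + 1 => P.projective n
  d
    | 0 => (LinearMap.ker f).subtype.comp P.ε
    | n + 1 => P.d n
  ε := f
  d_deg
    | 0 => P.ε_deg
    | n + 1 => P.d_deg n
  ε_deg := hf
  ε_surjective := hs
  exact_zero x := by
    constructor
    · intro hx
      obtain ⟨y, hy⟩ := P.ε_surjective ⟨x, hx⟩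
      exact ⟨y, congrArg Subtype.val hy⟩
    · rintro ⟨y, rfl⟩
      exact (P.ε y).2
  exact_succ
    | 0 => fun x ↦ (map_eq_zero_iff (LinearMap.ker f).subtype Subtype.val_injective).trans
        (P.exact_zero x)
    | n + 1 => P.exact_succ n

theorem IsPerfect.cons {F M : GradedModule G} [Module.Projective R F] [hF : Module.Finite R F]
    {f : F →ₗ[R] M} {hf : ∀ (i : ℤ) (x : F), x ∈ F.deg i → f x ∈ M.deg i}
    {hs : Function.Surjective f} {P : GradedResolution (GradedModule.ker f hf)}
    (hP : P.IsPerfect) : (GradedResolution.cons f hf hs P).IsPerfect := by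
  obtain ⟨h, N, hN⟩ := hP
  refine ⟨fun n ↦ ?_, N + 1, fun n hn ↦ ?_⟩
  · cases n with
    | zero => exact hF
    | succ n => exact h n
  · cases n with
    | zero => omega
    | succ n => exact hN n (by omega)

end GradedResolution

end

/-- A graded module whose base change has a resolution of finite length by finitely generated
projective modules has such a graded resolution: being finitely generated, and being finitely
generated projective, descend, and a syzygy of the base change is the base change of a syzygy. -/
theorem HasPerfectLength.exists_gradedResolution {k : Type v} {K : Type w} {R : Type u}
    {S : Type (max u w)} [Field k] [Field K] [Algebra k K] [Ring R] [Algebra k R] [Ring S]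
    {θ : K ⊗[k] R ≃+* S} {G : ZGrading R} (n : ℕ) (M : GradedModule G) [Module k M]
    [IsScalarTower k R M] {N : Type (max u w)} [AddCommGroup N] [Module S N] {T : K ⊗[k] M ≃+ N}
    (h : IsModuleBaseChange θ T) (hN : HasPerfectLength S n N) :
    ∃ P : GradedResolution M, P.IsPerfect := by
  induction n generalizing M N with
  | zero =>
    obtain ⟨_, _⟩ := hN
    obtain ⟨_, _⟩ := (h.hasDualBasis_of_baseChange hasDualBasis_of_projective).finite_projective
    have : Subsingleton (GradedModule.ker (LinearMap.id : M →ₗ[R] M) fun _ _ hx ↦ hx) :=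
      ⟨fun x y ↦ Subtype.ext (x.2.trans y.2.symm)⟩
    exact ⟨GradedResolution.cons LinearMap.id (fun _ _ hx ↦ hx) Function.surjective_id
      (GradedResolution.ofSubsingleton _), GradedResolution.IsPerfect.cons
        ⟨fun _ ↦ inferInstanceAs (Module.Finite R PUnit.{u + 1}),
          0, fun _ _ ↦ inferInstanceAs (Subsingleton PUnit.{u + 1})⟩⟩
  | succ n ih =>
    have := hN.finite
    have : Module.Finite R M := h.finite_of_baseChange
    obtain ⟨F, f, _, _, hf, hs⟩ := M.exists_free_cover
    let Z := GradedModule.ker f hf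
    let : Module k F := Module.restrictScalars k R F
    let : Module k Z := Module.restrictScalars k R Z
    have : IsScalarTower k R F := IsScalarTower.restrictScalars k R F
    have : IsScalarTower k R Z := IsScalarTower.restrictScalars k R Z
    let : Module S (K ⊗[k] F) := baseChangeModule θ F
    let : Module S (K ⊗[k] Z) := baseChangeModule θ Z
    have hF : IsModuleBaseChange θ (AddEquiv.refl (K ⊗[k] F)) :=
      isModuleBaseChange_baseChangeModule θ F
    have hZ : IsModuleBaseChange θ (AddEquiv.refl (K ⊗[k] Z)) :=
      isModuleBaseChange_baseChangeModule θ Z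
    let i : Z →ₗ[R] F := (LinearMap.ker f).subtype
    obtain ⟨_, _⟩ := (hF.hasDualBasis hasDualBasis_of_projective).finite_projective
    have hi : Function.Injective (hZ.map hF i) := fun x y hxy ↦
      Module.Flat.lTensor_preserves_injective_linearMap (M := K) (i.restrictScalars k)
        Subtype.val_injective ((hZ.map_apply hF i x).symm.trans (hxy.trans (hZ.map_apply hF i y)))
    have hsurj : Function.Surjective (hF.map h f) := fun y ↦ by
      obtain ⟨y, rfl⟩ := T.surjective y
      obtain ⟨x, rfl⟩ := LinearMap.lTensor_surjective K (g := f.restrictScalars k) hs y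
      exact ⟨x, hF.map_apply h f x⟩
    obtain ⟨P, hP⟩ := ih Z hZ (hN.of_exact_right hi
      (PerfectResolution.exact_map hZ hF h (LinearMap.exact_subtype_ker_map f)) hsurj)
    exact ⟨GradedResolution.cons f hf hs P, hP.cons⟩

end TwistedCY

/-! ### Descent -/

namespace TwistedCY

attribute [local instance] instModuleTensorProductMop

section OfEnv

variable (k : Type v) {A : Type u} [Field k] [Ring A] [Algebra k A]

/-- A right module over the enveloping algebra as a bimodule: `a x b = x • (b ⊗ op a)`. -/
def CentralBimodule.ofEnv (E : Type u) [AddCommGroup E] [Module (Env k A)ᵐᵒᵖ E] :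
    CentralBimodule k A :=
  letI : Module k E := Module.restrictScalars k (Env k A)ᵐᵒᵖ E
  haveI : IsScalarTower k (Env k A)ᵐᵒᵖ E := IsScalarTower.restrictScalars k (Env k A)ᵐᵒᵖ E
  letI : Module A E := Module.compHom E
    ((RingHom.op (Algebra.TensorProduct.includeRight : Aᵐᵒᵖ →ₐ[k] Env k A).toRingHom).comp
      (RingEquiv.opOp A).toRingHom)
  letI : Module Aᵐᵒᵖ E := Module.compHom E
    (RingHom.op (Algebra.TensorProduct.includeLeft : A →ₐ[k] Env k A).toRingHom)
  haveI hl (a : A) (x : E) : a • x = op (1 ⊗ₜ op a : Env k A) • x := rfl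
  haveI hr (b : A) (x : E) : op b • x = op (b ⊗ₜ 1 : Env k A) • x := rfl
  { carrier := E
    smulComm := ⟨fun a b x ↦ by
      induction b using MulOpposite.rec' with | _ b
      rw [hl, hr, hr, hl, ← mul_smul, ← mul_smul, ← op_mul, ← op_mul,
        Algebra.TensorProduct.tmul_mul_tmul, Algebra.TensorProduct.tmul_mul_tmul, one_mul, one_mul,
        mul_one, mul_one]⟩
    leftTower := ⟨fun c a x ↦ by
      rw [hl, hl, ← smul_assoc, MulOpposite.op_smul, TensorProduct.tmul_smul, MulOpposite.op_smul]⟩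
    rightTower := ⟨fun c b x ↦ by
      induction b using MulOpposite.rec' with | _ b
      rw [← MulOpposite.op_smul, hr, hr, ← smul_assoc, ← TensorProduct.smul_tmul',
        MulOpposite.op_smul]⟩ }

/-- The identity map from a right module over the enveloping algebra to the bimodule. -/
def CentralBimodule.ofEnvIso (E : Type u) [AddCommGroup E] [Module (Env k A)ᵐᵒᵖ E] :
    CentralBimodule.EnvIso E (CentralBimodule.ofEnv k (A := A) E) where
  equiv := AddEquiv.refl E
  map_smul a b x := by
    change op (b ⊗ₜ op a : Env k A) • x = op (1 ⊗ₜ op a : Env k A) • op (b ⊗ₜ 1 : Env k A) • x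
    rw [← mul_smul, ← op_mul, Algebra.TensorProduct.tmul_mul_tmul, one_mul, mul_one]

end OfEnv

section Descent

variable {k : Type v} {K : Type w} {A : Type u} [Field k] [Field K] [Algebra k K] [Ring A]
  [Algebra k A] {𝒜 : ℕ → Submodule k A} [GradedAlgebra 𝒜]

/-- The diagonal bimodule has a perfect graded resolution if that of `K ⊗ A` has an ungraded one. -/
theorem GradedResolution.exists_of_isHomologicallySmooth_baseChange
    (h : IsHomologicallySmooth K (K ⊗[k] A)) :
    ∃ P : GradedResolution (diagModule 𝒜), P.IsPerfect := by
  obtain ⟨Q⟩ := (isHomologicallySmooth_iff K (K ⊗[k] A)).1 h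
  obtain ⟨n, hn⟩ := Q.bounded
  exact @HasPerfectLength.exists_gradedResolution k K (Env k A) (Env K (K ⊗[k] A)) _ _ _ _ _ _
    (envBaseChange k K A) (envGrading 𝒜) n (diagModule 𝒜) (inferInstanceAs (Module k A))
    (isScalarTower_env k A) (K ⊗[k] A) _ _ (AddEquiv.refl (K ⊗[k] A))
    (isModuleBaseChange_env k K A) (Q.hasPerfectLength n hn)

namespace GradedResolution

variable {P : GradedResolution (diagModule 𝒜)}

/-- The graded Ext-group of the diagonal bimodule as a graded bimodule. -/
def extBimodule (hP : P.IsPerfect) (n : ℕ) : GradedBimodule 𝒜 where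
  toCentralBimodule := CentralBimodule.ofEnv k (P.GrExt n)
  deg := P.grExtSubgroup n
  isInternal := isInternal_grExtSubgroup hP n
  left_mem i j a x ha hx := by
    rw [add_comm]
    refine grExtSubgroup_smul (G := envGrading 𝒜) (r := 1 ⊗ₜ op a) ?_ hx
    exact Submodule.subset_span ⟨0, i, 1, a, by simp, SetLike.one_mem_graded 𝒜, ha, rfl⟩
  right_mem i j b x hb hx := by
    refine grExtSubgroup_smul (G := envGrading 𝒜) (r := b ⊗ₜ op 1) ?_ hx
    exact Submodule.subset_span ⟨i, 0, b, 1, by simp, hb, SetLike.one_mem_graded 𝒜, rfl⟩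

/-- Vanishing of the Ext-groups over an extension field descends. -/
theorem subsingleton_grExt (hP : P.IsPerfect) (n : ℕ)
    (h : Subsingleton (Ext (ModuleCat.of (Env K (K ⊗[k] A)) (K ⊗[k] A))
      (ModuleCat.of (Env K (K ⊗[k] A)) (Env K (K ⊗[k] A))) n)) : Subsingleton (P.GrExt n) := by
  let : Module k (P.GrExt n) := Module.restrictScalars k (Env k A)ᵐᵒᵖ _
  obtain ⟨e, -⟩ := hP.diag.exists_ext_env_baseChange (K := K) n
    (diagExtEquiv hP n).symm.toAddEquiv (fun c x ↦ map_smul (diagExtEquiv hP n).symm _ x)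
  obtain ⟨l, hl⟩ := exists_retraction k K
  refine ⟨fun x y ↦ ?_⟩
  rw [← contract_one_tmul hl x, ← contract_one_tmul hl y,
    e.injective (Subsingleton.elim (e (1 ⊗ₜ x)) (e (1 ⊗ₜ y)))]

/-- If the Ext-group over an extension field is an invertible bimodule, then the graded Ext-group is
a balanced progenerator, because its base change is one. -/
theorem isBalancedProgenerator_extBimodule (hP : P.IsPerfect) (n : ℕ)
    {W : CentralBimodule K (K ⊗[k] A)} (hW : W.IsInvertible)
    (φ : CentralBimodule.EnvIso (Ext (ModuleCat.of (Env K (K ⊗[k] A)) (K ⊗[k] A))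
      (ModuleCat.of (Env K (K ⊗[k] A)) (Env K (K ⊗[k] A))) n) W) :
    IsBalancedProgenerator A (extBimodule hP n).carrier := by
  let ψ := CentralBimodule.ofEnvIso k (A := A) (P.GrExt n)
  let f := (diagExtEquiv hP n).symm.toAddEquiv.trans ψ.equiv
  have hf (r : Env k A) (x) : f (op r • x) = ψ.equiv (op r • (diagExtEquiv hP n).symm x) :=
    congrArg ψ.equiv (map_smul (diagExtEquiv hP n).symm (op r) x)
  obtain ⟨e, he⟩ := hP.diag.exists_ext_env_baseChange (K := K) n f
    (fun c x ↦ (hf _ x).trans (ψ.map_algebraMap c _))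
  have hab (a b : A) (x) : f (op (b ⊗ₜ op a : Env k A) • x) = a • op b • f x :=
    (hf _ x).trans (ψ.map_smul a b _)
  change IsBalancedProgenerator A (CentralBimodule.ofEnv k (A := A) (P.GrExt n))
  refine IsBalancedProgenerator.of_baseChange (k := k) (K := K) (N := W)
    (U := CentralBimodule.ofEnv k (A := A) (P.GrExt n)) (T := e.trans φ.equiv)
    hW.isBalancedProgenerator ⟨fun c c' a x ↦ ?_⟩ fun c c' a x ↦ ?_
  · obtain ⟨x, rfl⟩ := f.surjective x
    have h1 := he 1 c c' a 1 x
    rw [hab, op_one, one_smul, one_mul] at h1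
    refine Eq.symm ((congrArg φ.equiv h1).trans ((φ.map_smul _ _ _).trans ?_))
    rw [← Algebra.TensorProduct.one_def, op_one, one_smul]
    rfl
  · obtain ⟨x, rfl⟩ := f.surjective x
    have h1 := he c 1 c' 1 a x
    rw [hab, one_smul, mul_one] at h1
    refine Eq.symm ((congrArg φ.equiv h1).trans ((φ.map_smul _ _ _).trans ?_))
    rw [← Algebra.TensorProduct.one_def, one_smul]
    rfl

end GradedResolution

/-- The twisted Calabi-Yau property of the base change descends to the graded twisted Calabi-Yau
property. -/
theorem IsTwistedCY.isGradedTwistedCY_of_baseChange {d : ℕ}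
    (h : IsTwistedCY K (K ⊗[k] A) d) : IsGradedTwistedCY 𝒜 d := by
  obtain ⟨hs, W, hW, hv, ⟨φ⟩⟩ := h
  obtain ⟨P, hP⟩ := GradedResolution.exists_of_isHomologicallySmooth_baseChange (𝒜 := 𝒜) hs
  exact ⟨P, hP, GradedResolution.extBimodule hP d,
    GradedBimodule.isGradedInvertible_of_isBalancedProgenerator _
      (GradedResolution.isBalancedProgenerator_extBimodule hP d hW φ),
    fun i hi ↦ GradedResolution.subsingleton_grExt hP i (hv i hi),
    CentralBimodule.ofEnvIso k (A := A) (P.GrExt d),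
    fun j x hx ↦ GradedResolution.mem_grExtSubgroup.2 hx⟩

/-- An algebra that is twisted Calabi-Yau and graded is graded twisted Calabi-Yau: this is descent
along the trivial extension of the ground field. -/
theorem IsTwistedCY.isGradedTwistedCY {d : ℕ} (h : IsTwistedCY k A d) : IsGradedTwistedCY 𝒜 d :=
  (h.baseChange (K := k)).isGradedTwistedCY_of_baseChange

end Descent

end TwistedCY

theorem mainTheorem11 (k : Type v) [Field k] (A : Type u) [Ring A] [Algebra k A]
    (K : Type w) [Field K] [Algebra k K] (d : ℕ) :
    (TwistedCY.IsTwistedCY k A d → TwistedCY.IsTwistedCY K (K ⊗[k] A) d) ∧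
    (∀ (𝒜 : ℕ → Submodule k A) [GradedAlgebra 𝒜], Module.Finite k (𝒜 0) →
      (TwistedCY.IsTwistedCY K (K ⊗[k] A) d ↔ TwistedCY.IsTwistedCY k A d) ∧
      (TwistedCY.IsGradedTwistedCY (fun i ↦ (𝒜 i).baseChange K) d ↔
        TwistedCY.IsGradedTwistedCY 𝒜 d)) := by
  refine ⟨fun h ↦ h.baseChange, fun 𝒜 _ _ ↦ ⟨⟨fun h ↦ ?_, fun h ↦ h.baseChange⟩,
    fun h ↦ h.isTwistedCY.isGradedTwistedCY_of_baseChange,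
    fun h ↦ h.isTwistedCY.baseChange.isGradedTwistedCY⟩⟩
  exact (h.isGradedTwistedCY_of_baseChange (𝒜 := 𝒜)).isTwistedCY
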